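/- Let $h\in\mathbb{C}$ (half of the boundary dimension), let $(x)_n=x(x+1)\cdots(x+n-1)$, and $$F_A^{(r)}[a,\{b_j\},\{c_j\};x_1,\dots,x_r]=\sum_{i_1,\dots,i_r\ge0}\frac{(a)_{i_1+\cdots+i_r}\prod_j(b_j)_{i_j}}{\prod_j(c_j)_{i_j}\,i_j!}\prod_jx_j^{i_j}.$$ **Tree rules.** In the Mellin pre-amplitude $M$ of a scalar tree Witten diagram a bulk-to-bulk propagator with spectrum variable $c$ and Mandelstam variable $s$ contributes $\Gamma[\frac{h+c-s}{2}]\Gamma[\frac{h-c-s}{2}]$. A bulk vertex with $r\ge0$ propagators, whose boundary points have total dimension $D$, contributes the Mellin integral $$\mathcal{V}_r(D,c,s)=\int\prod_{a=1}^r\frac{dw_a}{2\pi i}\;\Gamma\Big[\tfrac{D+(r-2)h+\sum_a(c_a+2w_a)}{2}\Big]\prod_{a=1}^r\frac{\Gamma[-w_a]\,\Gamma[-c_a-w_a]\,\Gamma[\frac{h+c_a-s_a}{2}+w_a]}{\Gamma[\frac{h+c_a-s_a}{2}]\,\Gamma[\frac{h-c_a-s_a}{2}]},$$ that is, the analytic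 continuation in $(D,c,s)\in\mathbb{C}^{1+2r}$ of this integral from the parameters for which vertical contours give all Gamma functions of $w$ arguments of positive real part. $M$ is the product of all these contributions. Up to an overall constant, the Mellin amplitude is the spectrum integral of $$J(c,s)=M(c,s)\prod_a\frac{1}{\big((\underline\Delta_a-h)^2-c_a^2\big)\Gamma[c_a]\Gamma[-c_a]}.$$ **Known rules (Paulos et al.).** A vertex with legs of dimensions $\Delta_1,\dots,\Delta_r$ and integers $n_1,\dots,n_r\ge0$ has the factor $$V^{\Delta_1,\dots,\Delta_r}_{[n_1,\dots,n_r]}=\Gamma\Big[\tfrac{\sum_a\Delta_a}{2}-h\Big]\prod_a(\Delta_a-h+1)_{n_a}\;F_A^{(r)}\Big[\tfrac{\sum_a\Delta_a}{2}-h,\{-n_a\},\{\Delta_a-h+1\};1,\dots,1\Big],$$ boundary points being legs with integer $0$; a propagator of dimension $\underline\Delta$ with integer $n$ has the factor $\frac{1}{n!}\,\frac{-1}{\Gamma[\underline\Delta-h+n+1]}$. **Theorem.** 1. $\mathcal{V}_r$ exists and is unique as an analytic function on the set of all $(D,c,s)$ with $D+(r-2)h\pm c_1\pm\cdots\pm c_r\notin\{0,-2,-4,\dots\}$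 for every choice of signs. 2. Let a vertex have propagators of dimensions $\underline\Delta_a\in\mathbb{C}$ with integers $n_a\ge0$, and (possibly no) boundary points of dimensions $\delta_i\in\mathbb{C}$ with $D=\sum_i\delta_i$. If the point $c_a=\underline\Delta_a-h$, $s_a=\underline\Delta_a+2n_a$ lies in the set of part 1 and $(\underline\Delta_a-h+1)_{n_a}\ne0$ for all $a$, then at this point $$\mathcal{V}_r(D,c,s)=(-1)^{\sum_an_a}\,V^{\{\delta_i\},\{\underline\Delta_a\}}_{[\{0\},\{n_a\}]}.$$ In particular, for a purely internal vertex ($D=0$) the value is $(-1)^{\sum_an_a}\,V^{\underline\Delta_1,\dots,\underline\Delta_r}_{[n_1,\dots,n_r]}$. 3. For $\underline\Delta-h\notin\mathbb{Z}$, take the contribution of either pole $c=\pm(\underline\Delta-h)$ of $\frac{1}{(\underline\Delta-h)^2-c^2}$ (minus the residue at $\underline\Delta-h$, which lies to the right of the contour, or plus the residue at $h-\underline\Delta$, which lies to the left) to the spectrum integral of $$\frac{\Gamma[\frac{h+c-s}{2}]\,\Gamma[\frac{h-c-s}{2}]}{\big((\underline\Delta-h)^2-c^2\big)\Gamma[c]\Gamma[-c]}.$$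 Its residue at $s=\underline\Delta+2n$ is $\frac{1}{n!}\,\frac{-1}{\Gamma[\underline\Delta-h+n+1]}$. 4. Consider any tree diagram with $\underline\Delta_a-h\notin\mathbb{Z}$ for all propagators $a$ and, at every vertex, the genericity condition of part 1 at $c_a=\underline\Delta_a-h$. For any choice, for every $a$, of one of the two poles $c_a=\pm(\underline\Delta_a-h)$ of the spectrum density, the contribution of these poles (with the signs of part 3) to the spectrum integral of $J$ has at $s_a=\underline\Delta_a+2n_a$ for all $a$ the multiple residue $$\prod_{\text{propagators }a}\frac{1}{n_a!}\,\frac{-1}{\Gamma[\underline\Delta_a-h+n_a+1]}\ \prod_{\text{vertices }A}V_A,$$ where $V_A$ is the known factor of the vertex $A$, formed from its propagators with the integers $n_a$ and its boundary points with the integers $0$. The sign $(-1)^{n_a}$ of part 2 occurs at both ends of each propagator and cancels. -/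

import Mathlib

open Filter Topology MeasureTheory

noncomputable section

namespace WittenTree

/-! Throughout, `h` is half of the boundary dimension. A bulk vertex with `r` bulk-to-bulk
propagators is described by a finite index type `ι` of cardinality `r` labelling these propagators,
by the sum `D` of the conformal dimensions of the boundary points attached to the vertex, and by the
spectrum variables `c` and the Mandelstam variables `s` of the propagators. -/

/-- The argument `(D + (r - 2) h + ∑ (c_a + 2 w_a)) / 2` of the collective Gamma function. -/
def vertexArg {ι : Type} [Fintype ι] (h D : ℂ) (c w : ι → ℂ) : ℂ :=
  (D + ((Fintype.card ι : ℂ) - 2) * h + ∑ a, (c a + 2 * w a)) / 2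

/-- The integrand of the vertex rule. -/
def vertexIntegrand {ι : Type} [Fintype ι] (h D : ℂ) (c s w : ι → ℂ) : ℂ :=
  Complex.Gamma (vertexArg h D c w) *
    ∏ a, Complex.Gamma (-w a) * Complex.Gamma (-c a - w a)
        * Complex.Gamma ((h + c a - s a) / 2 + w a)
      / (Complex.Gamma ((h + c a - s a) / 2) * Complex.Gamma ((h - c a - s a) / 2))

/-- The vertical contours `Re w_a = κ_a` separate the left poles of the integrand from the right
poles: on them all Gamma functions that involve `w` have an argument of positive real part. -/
def Separates {ι : Type} [Fintype ι] (h D : ℂ) (c s : ι → ℂ) (κ : ι → ℝ) : Prop :=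
  0 < (vertexArg h D c (fun a => (κ a : ℂ))).re ∧
    ∀ a, 0 < (-(κ a : ℂ)).re ∧ 0 < (-c a - (κ a : ℂ)).re
      ∧ 0 < ((h + c a - s a) / 2 + (κ a : ℂ)).re

/-- The integral `∫ ∏ dw_a / (2πi)` of the integrand over the contours `w_a = κ_a + i y_a`. -/
def vertexIntegral {ι : Type} [Fintype ι] (h D : ℂ) (c s : ι → ℂ) (κ : ι → ℝ) : ℂ :=
  ∫ y : ι → ℝ, (((2 * Real.pi)⁻¹ ^ Fintype.card ι : ℝ) : ℂ) *
    vertexIntegrand h D c s (fun a => (κ a : ℂ) + (y a : ℂ) * Complex.I)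

/-- The complement of the poles of all the `Γ((D + (r - 2) h ± c_1 ± ⋯ ± c_r) / 2)`, in the space of
the parameters `(D, c, s)`. -/
def vertexRegular (ι : Type) [Fintype ι] (h : ℂ) : Set (ℂ × (ι → ℂ) × (ι → ℂ)) :=
  {p | ∀ (σ : ι → ℤˣ) (k : ℕ),
    p.1 + ((Fintype.card ι : ℂ) - 2) * h + ∑ a, (((σ a : ℤˣ) : ℤ) : ℂ) * p.2.1 a ≠ -2 * (k : ℂ)}

/-- `F` is the Mellin integral of the vertex rule as a function of `(D, c, s)`: the analytic
continuation to `vertexRegular` of the integral over separating vertical contours. -/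
def IsVertexFactor {ι : Type} [Fintype ι] (h : ℂ) (F : ℂ × (ι → ℂ) × (ι → ℂ) → ℂ) : Prop :=
  AnalyticOnNhd ℂ F (vertexRegular ι h) ∧
    ∀ (D : ℂ) (c s : ι → ℂ) (κ : ι → ℝ), Separates h D c s κ →
      F (D, c, s) = vertexIntegral h D c s κ

open Classical in
/-- The contribution of a bulk vertex to a tree pre-amplitude. -/
def vertexFactor {ι : Type} [Fintype ι] (h : ℂ) : ℂ × (ι → ℂ) × (ι → ℂ) → ℂ :=
  if H : ∃ F : ℂ × (ι → ℂ) × (ι → ℂ) → ℂ, IsVertexFactor h F then H.choose else 0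

/-- The contribution `Γ((h ± c - s) / 2)` of a bulk-to-bulk propagator to a tree pre-amplitude. -/
def propagatorFactor (h c s : ℂ) : ℂ :=
  Complex.Gamma ((h + c - s) / 2) * Complex.Gamma ((h - c - s) / 2)

/-- The density `1 / (((Δ - h) ^ 2 - c ^ 2) Γ(± c))` of the spectrum integral over `c` that leads
from the pre-amplitude to the Mellin amplitude. -/
def spectrumDensity (h Δ c : ℂ) : ℂ :=
  1 / ((Δ - h) ^ 2 - c ^ 2) / (Complex.Gamma c * Complex.Gamma (-c))

/-- The Pochhammer symbol `(x)_n = x (x + 1) ⋯ (x + n - 1)`. -/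
def poch (x : ℂ) (n : ℕ) : ℂ := (ascPochhammer ℂ n).eval x

/-- The generalized Lauricella function `F_A^{(r)}[a, b, c; x]`. -/
def lauricellaFA {ι : Type} [Fintype ι] (a : ℂ) (b c x : ι → ℂ) : ℂ :=
  ∑' i : ι → ℕ, poch a (∑ j, i j) * (∏ j, poch (b j) (i j))
    / ((∏ j, poch (c j) (i j)) * ∏ j, ((i j).factorial : ℂ)) * ∏ j, x j ^ i j

/-- The known vertex rule: `V` for a vertex whose legs, labelled by `ι`, have the conformal
dimensions `Δ` and the integers `n`. -/
def knownVertex {ι : Type} [Fintype ι] (h : ℂ) (Δ : ι → ℂ) (n : ι → ℕ) : ℂ :=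
  Complex.Gamma ((∑ a, Δ a) / 2 - h) * (∏ a, poch (Δ a - h + 1) (n a)) *
    lauricellaFA ((∑ a, Δ a) / 2 - h) (fun a => -(n a : ℂ)) (fun a => Δ a - h + 1) (fun _ => 1)

/-- The known propagator rule. -/
def knownPropagator (h Δ : ℂ) (n : ℕ) : ℂ :=
  1 / (n.factorial : ℂ) * (-1 / Complex.Gamma (Δ - h + n + 1))

section Tree

/-! A tree diagram: a graph `G` with the bulk vertices as vertices and the bulk-to-bulk propagators
as edges, and boundary points `E` of dimensions `δ`, the point `e` being attached to the bulk vertex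
`att e`. -/

variable {V E : Type} [Fintype V] [DecidableEq V] [Fintype E]

/-- The boundary points attached to the bulk vertex `A`. -/
abbrev Ext (att : E → V) (A : V) : Type := {e : E // att e = A}

/-- The bulk-to-bulk propagators attached to the bulk vertex `A`. -/
abbrev Inc (G : SimpleGraph V) (A : V) : Type := {e : G.edgeSet // A ∈ (e : Sym2 V)}

/-- The pre-amplitude of a tree diagram: the product of the contributions of all propagators and
all vertices. -/
def preAmplitude (G : SimpleGraph V) [DecidableRel G.Adj] (att : E → V) (h : ℂ) (δ : E → ℂ)
    (c s : G.edgeSet → ℂ) : ℂ :=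
  (∏ e, propagatorFactor h (c e) (s e)) *
    ∏ A, vertexFactor h (∑ i : Ext att A, δ i, (fun e : Inc G A => c e), fun e : Inc G A => s e)

/-- The integrand of the spectrum integrals that give the Mellin amplitude, up to the factor of the
normalization that only depends on the boundary points, on `h` and on the number of vertices. -/
def amplitudeIntegrand (G : SimpleGraph V) [DecidableRel G.Adj] (att : E → V) (h : ℂ) (δ : E → ℂ)
    (Δ c s : G.edgeSet → ℂ) : ℂ :=
  (∏ e, spectrumDensity h (Δ e) (c e)) * preAmplitude G att h δ c s

/-- The known vertex rule at the bulk vertex `A`: the boundary points enter as legs with the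
integer `0`. -/
def knownVertexAt (G : SimpleGraph V) [DecidableRel G.Adj] (att : E → V) (h : ℂ) (δ : E → ℂ)
    (Δ : G.edgeSet → ℂ) (n : G.edgeSet → ℕ) (A : V) : ℂ :=
  knownVertex h (Sum.elim (fun i : Ext att A => δ i) (fun e : Inc G A => Δ e))
    (Sum.elim (fun _ => 0) (fun e : Inc G A => n e))

end Tree

/-- `R` is the coefficient that the integrand `J(c, s)` of the spectrum integrals gives to
`∏ 1 / (s_a - Δ_a - 2 n_a)` when the pole of the spectrum density at `c_a = ε_a (Δ_a - h)` is taken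
for every `a`: the residues in `c` at these points, and then the residues in `s` at
`s_a = Δ_a + 2 n_a`. The sign of the factor `Δ_a - h - ε_a c_a` accounts for the pole at `Δ_a - h`
being on the right of the contour and the one at `h - Δ_a` on the left. -/
def IsPhysicalResidue {P : Type} [Fintype P] (h : ℂ) (Δ : P → ℂ) (n : P → ℕ) (ε : P → ℤˣ)
    (J : (P → ℂ) → (P → ℂ) → ℂ) (R : ℂ) : Prop :=
  ∃ ρ : (P → ℂ) → ℂ,
    (∀ᶠ s in 𝓝[{s | ∀ a, s a ≠ Δ a + 2 * n a}] (fun a => Δ a + 2 * n a),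
      Tendsto (fun c => (∏ a, (Δ a - h - (((ε a : ℤˣ) : ℤ) : ℂ) * c a)) * J c s)
        (𝓝[{c | ∀ a, c a ≠ (((ε a : ℤˣ) : ℤ) : ℂ) * (Δ a - h)}]
          (fun a => (((ε a : ℤˣ) : ℤ) : ℂ) * (Δ a - h)))
        (𝓝 (ρ s))) ∧
    Tendsto (fun s => (∏ a, (s a - Δ a - 2 * n a)) * ρ s)
      (𝓝[{s | ∀ a, s a ≠ Δ a + 2 * n a}] (fun a => Δ a + 2 * n a)) (𝓝 R)

end WittenTree

end

noncomputable section

/-! Put A = (D + (r - 2) h + ∑ c_j) / 2 and a_j = (h + c_j - s_j) / 2. In the variables (A, a, c)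
the factor of one leg is, up to the sign of w, the Mellin transform of Tricomi's function U(a, 1 +
c, t). Writing the collective Gamma function as an Euler integral over t and exchanging integrals
turns the vertex into ∫ t^(A-1) e^(-t) ∏ U(a_j, 1 + c_j, t) dt (`integral_mbIntegrand`). Expanding
each U as an integral makes this an integral of exponentials linear in the parameters, hence
analytic where it converges absolutely (`analyticOnNhd_baseVertex`).

The continuation comes from contiguity relations. For each set T of legs, A - ∑_{j ∈ T} c_j times
the vertex is a combination of vertices for which this quantity is larger by one
(`wall_mul_baseVertex`); for each leg, a relation without denominators raises a_j and a_j - c_j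
(`baseVertex_leg_relation`). Iterating them reaches every point at which no A - ∑_T c_j is a
nonpositive integer (`exists_vertex_continuation`). These are the walls of the theorem, T being the
set of minus signs. The complement of countably many complex hyperplanes is connected, which gives
uniqueness (`IsVertexFactor.eqOn`).

At a propagator pole a_j = -n_j, and U(-n, 1 + c, t) is (-1)^n times a Laguerre polynomial.
Integrating the product of these polynomials against t^(A-1) e^(-t) term by term gives Gamma
functions, and the sum is F_A. Such points lie outside the region of the integral, so the value is
derived from a descent relation for the continued function: a = 0 on all legs gives Γ(A)
(`continuation_zero`), and the recurrence of the Laguerre polynomials does the rest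
(`continuation_neg_natCast`, `knownVertex_eq`).

For the tree, vertices are analytic at the relevant points and even in each c (`vertexFactor_flip`),
so only the spectrum densities and the propagator factors are singular there. The functional
equation of Γ evaluates these residues (`residue_eq_knownPropagator`), and the vertex signs cancel
because an edge has two ends. -/

namespace WittenTree

/-! ### Analyticity of Laplace type integrals in several complex parameters. -/

section Laplace

variable {κ X : Type*} [Fintype κ] [MeasurableSpace X]

/-- The linear functional `p ↦ ∑ i, p i * l i`. -/
def dotFunctional (l : κ → ℝ) : (κ → ℂ) →L[ℂ] ℂ :=
  ∑ i, (l i : ℂ) • ContinuousLinearMap.proj (R := ℂ) (φ := fun _ : κ => ℂ) i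

theorem dotFunctional_apply (l : κ → ℝ) (p : κ → ℂ) :
    dotFunctional l p = ∑ i, p i * l i := by
  simp [dotFunctional, mul_comm]

theorem norm_dotFunctional_le (l : κ → ℝ) : ‖dotFunctional l‖ ≤ ∑ i, |l i| := by
  refine ContinuousLinearMap.opNorm_le_bound _ (by positivity) fun p => ?_
  rw [dotFunctional_apply, Finset.sum_mul]
  refine (norm_sum_le _ _).trans (Finset.sum_le_sum fun i _ => ?_)
  rw [norm_mul, Complex.norm_real, Real.norm_eq_abs, mul_comm]
  gcongr
  exact norm_le_pi_norm p i

theorem measurable_dotFunctional {lam : X → κ → ℝ} (h : ∀ i, Measurable fun x => lam x i) :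
    StronglyMeasurable fun x => dotFunctional (lam x) := by
  unfold dotFunctional
  refine Finset.stronglyMeasurable_fun_sum _ fun i _ => ?_
  exact (Complex.measurable_ofReal.comp (h i)).stronglyMeasurable.smul_const _

/-- The left side is the term of the right side whose signs are those of l. This lets finitely many
corners of a polydisc dominate the integrand on the whole polydisc. -/
theorem exp_abs_sum_le [DecidableEq κ] (l : κ → ℝ) (r : ℝ) :
    Real.exp (r * ∑ i, |l i|) ≤ ∑ σ : κ → ℤˣ, Real.exp (∑ i, r * ((σ i : ℤ) : ℝ) * l i) := by
  let σ₀ : κ → ℤˣ := fun i => if 0 ≤ l i then 1 else -1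
  have h : r * ∑ i, |l i| = ∑ i, r * ((σ₀ i : ℤ) : ℝ) * l i := by
    rw [Finset.mul_sum]
    refine Finset.sum_congr rfl fun i _ => ?_
    by_cases hi : 0 ≤ l i
    · simp [σ₀, hi, abs_of_nonneg hi]
    · simp [σ₀, hi, abs_of_neg (not_le.mp hi)]
  rw [h]
  exact Finset.single_le_sum (f := fun σ : κ → ℤˣ => Real.exp (∑ i, r * ((σ i : ℤ) : ℝ) * l i))
    (fun _ _ => (Real.exp_pos _).le) (Finset.mem_univ σ₀)

/-- A Laplace type integral is analytic on each open set of absolute convergence. -/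
theorem analyticOnNhd_integral_cexp (μ : Measure X) (lam : X → κ → ℝ) (g : X → ℂ)
    {Ω : Set (κ → ℂ)} (hΩ : IsOpen Ω) (hlam : ∀ i, Measurable fun x => lam x i)
    (hint : ∀ p ∈ Ω, Integrable (fun x => g x * Complex.exp (∑ i, p i * lam x i)) μ) :
    AnalyticOnNhd ℂ (fun p => ∫ x, g x * Complex.exp (∑ i, p i * lam x i) ∂μ) Ω := by
  classical
  intro p₀ hp₀
  obtain ⟨r, hr, hball⟩ := Metric.isOpen_iff.mp hΩ p₀ hp₀
  set s : ℝ := r / 2 with hs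
  have hs0 : 0 < s := by positivity
  set G : X → ℂ := fun x => g x * Complex.exp (∑ i, p₀ i * lam x i) with hG
  set ℓ : X → ((κ → ℂ) →L[ℂ] ℂ) := fun x => dotFunctional (lam x) with hℓ
  have hGint : Integrable G μ := hint p₀ hp₀
  have hℓm : StronglyMeasurable ℓ := measurable_dotFunctional hlam
  -- One dominating function controls all Taylor coefficients: it is bounded by the sum of the norms
  -- of the integrand at the corners p₀ ± s, which lie in the ball because s = r / 2.
  have hdom : Integrable (fun x => ‖G x‖ * Real.exp (s * ‖ℓ x‖)) μ := by
    have hsum : Integrable (fun x => ∑ σ : κ → ℤˣ,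
        ‖g x * Complex.exp (∑ i, (p₀ i + s * ((σ i : ℤ) : ℂ)) * lam x i)‖) μ := by
      refine integrable_finsetSum _ fun σ _ => (hint _ (hball ?_)).norm
      rw [Metric.mem_ball, dist_eq_norm]
      refine lt_of_le_of_lt ((pi_norm_le_iff_of_nonneg hs0.le).mpr fun i => ?_)
        (show s < r by linarith)
      rcases Int.units_eq_one_or (σ i) with h | h <;> simp [h, abs_of_pos hs0]
    refine hsum.mono' (hGint.1.norm.mul ?_) (ae_of_all _ fun x => ?_)
    · exact (Real.continuous_exp.comp_stronglyMeasurable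
        (hℓm.norm.const_mul s)).aestronglyMeasurable
    · rw [Real.norm_of_nonneg (by positivity)]
      calc ‖G x‖ * Real.exp (s * ‖ℓ x‖)
          ≤ ‖G x‖ * ∑ σ : κ → ℤˣ, Real.exp (∑ i, s * ((σ i : ℤ) : ℝ) * lam x i) := by
            gcongr
            refine le_trans ?_ (exp_abs_sum_le (lam x) s)
            gcongr
            exact norm_dotFunctional_le _
        _ = _ := by
            rw [Finset.mul_sum]
            refine Finset.sum_congr rfl fun σ _ => ?_
            have : (∑ i, (p₀ i + s * ((σ i : ℤ) : ℂ)) * lam x i)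
                = (∑ i, p₀ i * lam x i) + ((∑ i, s * ((σ i : ℤ) : ℝ) * lam x i : ℝ) : ℂ) := by
              push_cast
              rw [← Finset.sum_add_distrib]
              exact Finset.sum_congr rfl fun i _ => by ring
            rw [this, Complex.exp_add, ← mul_assoc, ← Complex.ofReal_exp]
            simp only [hG, norm_mul, Complex.norm_real, Real.norm_of_nonneg (Real.exp_pos _).le]
  have hpow : ∀ (n : ℕ) (x : X), (s * ‖ℓ x‖) ^ n / n.factorial ≤ Real.exp (s * ‖ℓ x‖) :=
    fun n x => Real.pow_div_factorial_le_exp _ (by positivity) n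
  -- The n-th Taylor term of the integrand at p₀, G(x) ℓ(x)^n / n!, as a multilinear map; its
  -- integral is the n-th term of the power series sought.
  let m : ∀ n : ℕ, X → ContinuousMultilinearMap ℂ (fun _ : Fin n => (κ → ℂ)) ℂ := fun n x =>
    (G x * ((n.factorial : ℂ))⁻¹) •
      (ContinuousMultilinearMap.mkPiAlgebraFin ℂ n ℂ).compContinuousLinearMap fun _ => ℓ x
  have hmnorm : ∀ n x, ‖m n x‖ ≤ ‖G x‖ * (‖ℓ x‖ ^ n / n.factorial) := by
    intro n x
    refine ContinuousMultilinearMap.opNorm_le_bound (by positivity) fun v => ?_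
    simp only [m, smul_apply, smul_eq_mul, norm_mul, norm_inv,
      ContinuousMultilinearMap.compContinuousLinearMap_apply,
      ContinuousMultilinearMap.mkPiAlgebraFin_apply, Complex.norm_natCast]
    rw [List.prod_ofFn, norm_prod]
    have : ∏ i, ‖ℓ x (v i)‖ ≤ ∏ i, (‖ℓ x‖ * ‖v i‖) :=
      Finset.prod_le_prod (fun _ _ => norm_nonneg _) fun i _ => (ℓ x).le_opNorm _
    rw [Finset.prod_mul_distrib, Finset.prod_const, Finset.card_univ, Fintype.card_fin] at this
    calc _ ≤ ‖G x‖ * (n.factorial : ℝ)⁻¹ * (‖ℓ x‖ ^ n * ∏ i, ‖v i‖) := by gcongr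
      _ = _ := by ring
  have hmmeas : ∀ n, AEStronglyMeasurable (m n) μ := by
    intro n
    refine (hGint.1.mul_const _).smul ?_
    have hc : Continuous fun L : (κ → ℂ) →L[ℂ] ℂ =>
        (ContinuousMultilinearMap.mkPiAlgebraFin ℂ n ℂ).compContinuousLinearMap
          fun _ : Fin n => L := by
      have h1 := (ContinuousMultilinearMap.compContinuousLinearMapContinuousMultilinear ℂ
        (fun _ : Fin n => (κ → ℂ)) (fun _ : Fin n => ℂ) ℂ).cont
      have h2 : Continuous fun L : (κ → ℂ) →L[ℂ] ℂ => (fun _ : Fin n => L) := by fun_prop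
      exact (ContinuousLinearMap.apply ℂ _ (ContinuousMultilinearMap.mkPiAlgebraFin ℂ n
        ℂ)).continuous.comp (h1.comp h2)
    exact (hc.comp_stronglyMeasurable hℓm).aestronglyMeasurable
  have hmint : ∀ n, Integrable (m n) μ := by
    intro n
    refine (hdom.const_mul ((s ^ n)⁻¹)).mono' (hmmeas n) (ae_of_all _ fun x => ?_)
    refine (hmnorm n x).trans ?_
    rw [← mul_assoc, mul_comm (s ^ n)⁻¹, mul_assoc]
    gcongr
    have := hpow n x
    rw [mul_pow, mul_div_assoc] at this
    rwa [le_inv_mul_iff₀ (by positivity)]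
  have happ : ∀ n x (y : κ → ℂ), m n x (fun _ => y) = G x * ((ℓ x y) ^ n / n.factorial) := by
    intro n x y
    simp [m, div_eq_mul_inv]
    ring
  refine ⟨fun n => ∫ x, m n x ∂μ, (s.toNNReal : ENNReal), ?_, by simpa using hs0, ?_⟩
  · refine FormalMultilinearSeries.le_radius_of_bound _
      (∫ x, ‖G x‖ * Real.exp (s * ‖ℓ x‖) ∂μ) fun n => ?_
    rw [Real.coe_toNNReal _ hs0.le]
    calc ‖∫ x, m n x ∂μ‖ * s ^ n ≤ (∫ x, ‖m n x‖ ∂μ) * s ^ n := by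
          gcongr; exact norm_integral_le_integral_norm _
      _ = ∫ x, ‖m n x‖ * s ^ n ∂μ := (integral_mul_const _ _).symm
      _ ≤ _ := by
          refine integral_mono ((hmint n).norm.mul_const _) hdom fun x => ?_
          calc ‖m n x‖ * s ^ n ≤ ‖G x‖ * (‖ℓ x‖ ^ n / n.factorial) * s ^ n := by
                gcongr; exact hmnorm n x
            _ = ‖G x‖ * ((s * ‖ℓ x‖) ^ n / n.factorial) := by rw [mul_pow]; ring
            _ ≤ _ := by gcongr; exact hpow n x
  · intro y hy
    have hy' : ‖y‖ < s := by
      rw [Metric.eball_coe, Real.coe_toNNReal _ hs0.le] at hy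
      simpa using hy
    have hval : ∀ n, (∫ x, m n x ∂μ) (fun _ => y) = ∫ x, G x * ((ℓ x y) ^ n / n.factorial) ∂μ := by
      intro n
      have := (ContinuousMultilinearMap.apply ℂ (fun _ : Fin n => (κ → ℂ)) ℂ
        (fun _ => y)).integral_comp_comm (hmint n)
      simp only [ContinuousMultilinearMap.apply_apply] at this
      rw [← this]
      exact integral_congr_ae (ae_of_all _ fun x => happ n x y)
    simp only [hval]
    have hnb : ∀ x, ‖ℓ x y‖ ≤ s * ‖ℓ x‖ := fun x => by
      refine ((ℓ x).le_opNorm y).trans ?_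
      rw [mul_comm]; gcongr
    refine hasSum_integral_of_dominated_convergence
      (fun n x => ‖G x‖ * ((s * ‖ℓ x‖) ^ n / n.factorial)) ?_ ?_ ?_ ?_ ?_
    · intro n
      have := (ContinuousMultilinearMap.apply ℂ (fun _ : Fin n => (κ → ℂ)) ℂ
        (fun _ => y)).continuous.comp_aestronglyMeasurable (hmmeas n)
      refine this.congr (ae_of_all _ fun x => ?_)
      exact happ n x y
    · intro n
      refine ae_of_all _ fun x => ?_
      rw [norm_mul, norm_div, norm_pow, Complex.norm_natCast]
      gcongr
      exact hnb x
    · exact ae_of_all _ fun x => (Real.summable_pow_div_factorial _).mul_left _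
    · refine hdom.congr (ae_of_all _ fun x => ?_)
      simp only
      rw [tsum_mul_left, Real.exp_eq_exp_ℝ, NormedSpace.exp_eq_tsum_div]
    · refine ae_of_all _ fun x => ?_
      have h1 : HasSum (fun n : ℕ => (ℓ x y) ^ n / (n.factorial : ℂ)) (Complex.exp (ℓ x y)) := by
        rw [Complex.exp_eq_exp_ℂ]
        exact NormedSpace.expSeries_div_hasSum_exp (ℓ x y)
      have h2 := h1.mul_left (G x)
      have h3 : G x * Complex.exp (ℓ x y)
          = g x * Complex.exp (∑ i, (p₀ + y) i * lam x i) := by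
        simp only [hG, hℓ, dotFunctional_apply, mul_assoc, ← Complex.exp_add,
          ← Finset.sum_add_distrib, Pi.add_apply, add_mul]
      rw [h3] at h2
      exact h2

end Laplace

/-! ### Continuation by shift operators, and connectedness of hyperplane complements. -/

section Continuation

variable {W E : Type*} [NormedAddCommGroup E] [NormedSpace ℂ E]

/-- Analytic continuation by operators `R w`, each of which fixes the given function `f₀` and
extends analytic functions from the domain `Ω k` to the domain `Ω (k + Pi.single w 1)`. -/
theorem exists_analytic_continuation [Fintype W] [DecidableEq W] (Ω : (W → ℕ) → Set E)
    (hmono : Monotone Ω) (hopen : ∀ k, IsOpen (Ω k)) (R : W → (E → ℂ) → E → ℂ) (f₀ : E → ℂ)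
    (h₀ : AnalyticOnNhd ℂ f₀ (Ω 0))
    (hext : ∀ w k f, AnalyticOnNhd ℂ f (Ω k) → AnalyticOnNhd ℂ (R w f) (Ω (k + Pi.single w 1)))
    (hcongr : ∀ w k f g, Set.EqOn f g (Ω k) → Set.EqOn (R w f) (R w g) (Ω (k + Pi.single w 1)))
    (hfix : ∀ w, Set.EqOn (R w f₀) f₀ (Ω 0)) :
    ∃ F : E → ℂ, AnalyticOnNhd ℂ F (⋃ n : ℕ, Ω fun _ => n) ∧ Set.EqOn F f₀ (Ω 0) := by
  let S : List W → (E → ℂ) → E → ℂ := fun l f => l.foldr R f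
  have hSext : ∀ (l : List W) k f, AnalyticOnNhd ℂ f (Ω k) →
      AnalyticOnNhd ℂ (S l f) (Ω (k + (l.map fun w => Pi.single w 1).sum)) := by
    intro l k f hf
    induction l with
    | nil => simpa [S] using hf
    | cons w l ih =>
      have := hext w _ _ ih
      rw [List.map_cons, List.sum_cons, add_comm (Pi.single w 1), ← add_assoc]
      exact this
  have hScongr : ∀ (l : List W) k f g, Set.EqOn f g (Ω k) →
      Set.EqOn (S l f) (S l g) (Ω (k + (l.map fun w => Pi.single w 1).sum)) := by
    intro l k f g hf
    induction l with
    | nil => simpa [S] using hf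
    | cons w l ih =>
      have := hcongr w _ _ _ ih
      rw [List.map_cons, List.sum_cons, add_comm (Pi.single w 1), ← add_assoc]
      exact this
  have hSfix : ∀ l : List W, Set.EqOn (S l f₀) f₀ (Ω 0) := by
    intro l
    induction l with
    | nil => exact fun _ _ => rfl
    | cons w l ih =>
      exact ((hcongr w 0 _ _ ih).mono (hmono (by simp))).trans (hfix w)
  -- Applying each operator once raises every index by one, so the iterates of this single pass
  -- exhaust the diagonal domains.
  have hone : ((Finset.univ : Finset W).toList.map fun w => (Pi.single w 1 : W → ℕ)).sum
      = fun _ => 1 := by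
    rw [Finset.sum_map_toList]
    exact Finset.univ_sum_single fun _ : W => (1 : ℕ)
  let Q : (E → ℂ) → E → ℂ := S (Finset.univ : Finset W).toList
  let f : ℕ → E → ℂ := fun n => Q^[n] f₀
  have hfs : ∀ n, f (n + 1) = Q (f n) := fun n => Function.iterate_succ_apply' _ _ _
  have hfan : ∀ n, AnalyticOnNhd ℂ (f n) (Ω fun _ => n) := by
    intro n
    induction n with
    | zero => exact h₀
    | succ n ih =>
      have := hSext (Finset.univ : Finset W).toList _ _ ih
      rw [hone] at this
      rw [hfs]
      exact this
  have hfeq : ∀ n, Set.EqOn (f (n + 1)) (f n) (Ω fun _ => n) := by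
    intro n
    induction n with
    | zero => exact hSfix _
    | succ n ih =>
      have := hScongr (Finset.univ : Finset W).toList _ _ _ ih
      rw [hone] at this
      intro p hp
      rw [hfs (n + 1)]
      exact (this hp).trans (congrFun (hfs n) p).symm
  have hfle : ∀ n m, n ≤ m → Set.EqOn (f m) (f n) (Ω fun _ => n) := by
    intro n m hnm
    induction m, hnm using Nat.le_induction with
    | base => exact fun _ _ => rfl
    | succ m hm ih => exact ((hfeq m).mono (hmono fun _ => hm)).trans ih
  classical
  -- The iterates agree wherever the earlier one is controlled, so they can be glued; the first
  -- admissible index is only a convenient choice.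
  let F : E → ℂ := fun p => if h : ∃ n : ℕ, p ∈ Ω fun _ => n then f (Nat.find h) p else 0
  have hF : ∀ n, Set.EqOn F (f n) (Ω fun _ => n) := by
    intro n p hp
    have h : ∃ n : ℕ, p ∈ Ω fun _ => n := ⟨n, hp⟩
    simp only [F, dif_pos h]
    exact (hfle _ n (Nat.find_min' h hp) (Nat.find_spec h)).symm
  refine ⟨F, ?_, hF 0⟩
  intro p hp
  obtain ⟨n, hn⟩ := Set.mem_iUnion.mp hp
  exact (hfan n p hn).congr ((hF n).eventuallyEq_of_mem ((hopen _).mem_nhds hn)).symm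

/-- The complement of countably many affine hyperplanes in a complex vector space is connected. -/
theorem isPreconnected_setOf_forall_affine_ne_zero {κ : Type*} [Countable κ]
    (L : κ → E →ₗ[ℂ] ℂ) (b : κ → ℂ) : IsPreconnected {p : E | ∀ i, L i p + b i ≠ 0} := by
  refine isPreconnected_of_forall_pair fun p hp q hq => ?_
  -- On the complex line through p and q each hyperplane removes at most one point, since it misses
  -- p. A plane without countably many points is connected.
  let φ : ℂ → E := fun z => p + z • (q - p)
  let C : Set ℂ := ⋃ i, {z | L i (φ z) + b i = 0}
  have hC : C.Countable := by
    refine Set.countable_iUnion fun i => Set.Subsingleton.countable ?_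
    have hφ : ∀ z, L i (φ z) + b i = (L i p + b i) + z * (L i q - L i p) := fun z => by
      simp [φ]; ring
    intro z hz w hw
    rw [Set.mem_ofPred_eq, hφ] at hz hw
    have hne : L i q - L i p ≠ 0 := by
      intro h0
      rw [h0, mul_zero, add_zero] at hz
      exact hp i hz
    exact mul_right_cancel₀ hne (by linear_combination hz - hw)
  have hconn : IsPreconnected Cᶜ :=
    (hC.isConnected_compl_of_one_lt_rank (by simp)).isPreconnected
  refine ⟨φ '' Cᶜ, ?_, ⟨0, ?_, by simp [φ]⟩, ⟨1, ?_, by simp [φ]⟩, hconn.image φ ?_⟩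
  · rintro _ ⟨z, hz, rfl⟩ i h
    exact hz (Set.mem_iUnion.mpr ⟨i, h⟩)
  · intro h
    obtain ⟨i, hi⟩ := Set.mem_iUnion.mp h
    exact hp i (by simpa [φ] using hi)
  · intro h
    obtain ⟨i, hi⟩ := Set.mem_iUnion.mp h
    exact hq i (by simpa [φ] using hi)
  · exact Continuous.continuousOn (by fun_prop)

end Continuation

/-! ### Tricomi's function, its Mellin transform, and Mellin inversion. -/

section Tricomi

/-- Lebesgue measure on the positive half-line. -/
abbrev posMeasure : Measure ℝ := volume.restrict (Set.Ioi 0)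

theorem ae_posMeasure {P : ℝ → Prop} (h : ∀ x, 0 < x → P x) : ∀ᵐ x ∂posMeasure, P x :=
  ae_restrict_of_forall_mem measurableSet_Ioi h

theorem image_div_one_add : (fun x : ℝ => x / (1 + x)) '' Set.Ioi 0 = Set.Ioo 0 1 := by
  ext y
  constructor
  · rintro ⟨x, hx, rfl⟩
    have hx : 0 < x := hx
    exact ⟨by positivity, by rw [div_lt_one (by positivity)]; linarith⟩
  · rintro ⟨h0, h1⟩
    have : 0 < 1 - y := by linarith
    refine ⟨y / (1 - y), by simp only [Set.mem_Ioi]; positivity, ?_⟩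
    change y / (1 - y) / (1 + y / (1 - y)) = y
    have h2 : 1 + y / (1 - y) = (1 - y)⁻¹ := by field_simp; ring
    rw [h2, div_inv_eq_mul, div_mul_cancel₀ _ this.ne']

theorem hasDerivAt_div_one_add {x : ℝ} (hx : 0 < x) :
    HasDerivAt (fun x : ℝ => x / (1 + x)) (1 / (1 + x) ^ 2) x := by
  have h := (hasDerivAt_id' x).div ((hasDerivAt_id' x).const_add 1) (by positivity : 1 + x ≠ 0)
  refine h.congr_deriv ?_
  field_simp
  ring

theorem injOn_div_one_add : Set.InjOn (fun x : ℝ => x / (1 + x)) (Set.Ioi 0) := by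
  intro x hx y hy h
  have hx : 0 < x := hx
  have hy : 0 < y := hy
  simp only at h
  rw [div_eq_div_iff (by positivity) (by positivity)] at h
  linarith

/-- The substitution y = x / (1 + x), with Jacobian included, carries the beta integrand from (0, 1)
to the half-line, where it is the algebraic part of U. -/
theorem beta_substitution (u v : ℂ) {x : ℝ} (hx : 0 < x) :
    |1 / (1 + x) ^ 2| • (((x / (1 + x) : ℝ) : ℂ) ^ (u - 1) * (1 - ((x / (1 + x) : ℝ) : ℂ)) ^ (v - 1))
      = (x : ℂ) ^ (u - 1) * (1 + x : ℂ) ^ (-u - v) := by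
  have h1 : (0 : ℝ) < 1 + x := by positivity
  have h2 : (1 : ℂ) - ((x / (1 + x) : ℝ) : ℂ) = (((1 + x)⁻¹ : ℝ) : ℂ) := by
    rw [← Complex.ofReal_one, ← Complex.ofReal_sub]
    congr 1
    field_simp
    ring
  have h3 : ((1 + x : ℝ) : ℂ) ≠ 0 := Complex.ofReal_ne_zero.mpr h1.ne'
  have h4 : (1 + x : ℂ) = ((1 + x : ℝ) : ℂ) := by push_cast; ring
  rw [h2, h4, abs_of_pos (by positivity), div_eq_mul_inv x, Complex.ofReal_mul,
    Complex.mul_cpow_ofReal_nonneg hx.le (by positivity), Complex.ofReal_inv,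
    Complex.inv_cpow _ _ (by rw [Complex.arg_ofReal_of_nonneg h1.le]; exact Real.pi_pos.ne),
    Complex.inv_cpow _ _ (by rw [Complex.arg_ofReal_of_nonneg h1.le]; exact Real.pi_pos.ne),
    ← Complex.cpow_neg, ← Complex.cpow_neg, Complex.real_smul,
    show ((1 / (1 + x) ^ 2 : ℝ) : ℂ) = ((1 + x : ℝ) : ℂ) ^ (-2 : ℂ) by
      rw [Complex.cpow_neg, show (2 : ℂ) = ((2 : ℕ) : ℂ) by norm_num, Complex.cpow_natCast]
      push_cast; ring,
    show (-u - v : ℂ) = -2 + (-(u - 1) + -(v - 1)) by ring, Complex.cpow_add _ _ h3,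
    Complex.cpow_add _ _ h3]
  ring

/-- The beta integral over the positive half-line. -/
theorem integral_cpow_mul_one_add_cpow {u v : ℂ} (hu : 0 < u.re) (hv : 0 < v.re) :
    Integrable (fun x : ℝ => (x : ℂ) ^ (u - 1) * (1 + x : ℂ) ^ (-u - v)) posMeasure ∧
      ∫ x, (x : ℂ) ^ (u - 1) * (1 + x : ℂ) ^ (-u - v) ∂posMeasure
        = Complex.Gamma u * Complex.Gamma v / Complex.Gamma (u + v) := by
  have hd : ∀ x ∈ Set.Ioi (0 : ℝ), HasDerivWithinAt (fun x : ℝ => x / (1 + x)) (1 / (1 + x) ^ 2)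
      (Set.Ioi 0) x := fun x hx => (hasDerivAt_div_one_add hx).hasDerivWithinAt
  let g : ℝ → ℂ := fun x => (x : ℂ) ^ (u - 1) * (1 - (x : ℂ)) ^ (v - 1)
  have hg : IntegrableOn g (Set.Ioo 0 1) := by
    have := Complex.betaIntegral_convergent hu hv
    rw [intervalIntegrable_iff_integrableOn_Ioo_of_le zero_le_one] at this
    exact this
  constructor
  · rw [← image_div_one_add, integrableOn_image_iff_integrableOn_abs_deriv_smul measurableSet_Ioi hd
      injOn_div_one_add] at hg
    exact hg.congr_fun (fun x hx => beta_substitution u v hx) measurableSet_Ioi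
  · have h1 := integral_image_eq_integral_abs_deriv_smul measurableSet_Ioi hd injOn_div_one_add g
    rw [image_div_one_add, setIntegral_congr_fun measurableSet_Ioi
      fun x hx => beta_substitution u v hx] at h1
    rw [← h1, Complex.Gamma_mul_Gamma_eq_betaIntegral hu hv, Complex.betaIntegral,
      intervalIntegral.integral_of_le zero_le_one, ← integral_Ioc_eq_integral_Ioo,
      mul_div_cancel_left₀ _ (Complex.Gamma_ne_zero_of_re_pos (by simpa using by positivity))]

/-- The algebraic part of the integrand of the confluent hypergeometric function `U`. -/
def confluentKernel (a c : ℂ) (x : ℝ) : ℂ := (x : ℂ) ^ (a - 1) * (1 + x : ℂ) ^ (c - a)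

@[fun_prop]
theorem measurable_confluentKernel (a c : ℂ) : Measurable (confluentKernel a c) := by
  unfold confluentKernel; fun_prop

theorem norm_confluentKernel (a c : ℂ) {x : ℝ} (hx : 0 < x) :
    ‖confluentKernel a c x‖ = x ^ (a.re - 1) * (1 + x) ^ (c.re - a.re) := by
  rw [confluentKernel, norm_mul, Complex.norm_cpow_eq_rpow_re_of_pos hx,
    show (1 + x : ℂ) = ((1 + x : ℝ) : ℂ) by push_cast; ring,
    Complex.norm_cpow_eq_rpow_re_of_pos (by positivity)]
  simp

theorem integrable_confluentKernel {a c : ℂ} (ha : 0 < a.re) (hc : c.re < 0) :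
    Integrable (confluentKernel a c) posMeasure := by
  have := (integral_cpow_mul_one_add_cpow (v := -c) ha (by simpa using hc)).1
  simp only [neg_sub_neg] at this
  exact this

theorem integral_confluentKernel {a c : ℂ} (ha : 0 < a.re) (hc : c.re < 0) :
    ∫ x, confluentKernel a c x ∂posMeasure
      = Complex.Gamma a * Complex.Gamma (-c) / Complex.Gamma (a - c) := by
  have := (integral_cpow_mul_one_add_cpow (v := -c) ha (by simpa using hc)).2
  simp only [neg_sub_neg, ← sub_eq_add_neg] at this
  exact this

/-- Raise y / A ≤ e^(y/A) to the power A. Exponential decay is thereby traded for a power of chosen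
order, which is what the convergence estimates need. -/
theorem exp_neg_le_mul_rpow_neg {A y : ℝ} (hA : 0 < A) (hy : 0 < y) :
    Real.exp (-y) ≤ A ^ A * y ^ (-A) := by
  have h1 : y / A ≤ Real.exp (y / A) := (lt_add_one _).le.trans (Real.add_one_le_exp _)
  have h2 : (y / A) ^ A ≤ Real.exp y := by
    calc (y / A) ^ A ≤ (Real.exp (y / A)) ^ A := by gcongr
      _ = Real.exp y := by rw [← Real.exp_mul, div_mul_cancel₀ _ hA.ne']
  rw [Real.div_rpow hy.le hA.le] at h2
  rw [Real.exp_neg, Real.rpow_neg hy.le, ← div_eq_mul_inv, inv_le_comm₀ (Real.exp_pos _)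
    (by positivity), inv_div]
  exact h2

/-- A decaying power of 1 + x just lowers c, so it can bring the kernel into the range Re c < 0 of
the beta integral. -/
theorem confluentKernel_mul_rpow (a c : ℂ) (A : ℝ) {x : ℝ} (hx : 0 < x) :
    ‖confluentKernel a c x‖ * (1 + x) ^ (-A) = ‖confluentKernel a (c - A) x‖ := by
  rw [norm_confluentKernel _ _ hx, norm_confluentKernel _ _ hx, mul_assoc,
    ← Real.rpow_add (by positivity)]
  simp
  ring_nf
  simp

theorem integrable_exp_mul_confluentKernel {a : ℂ} (c : ℂ) (ha : 0 < a.re) {t : ℝ} (ht : 0 < t) :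
    Integrable (fun x : ℝ => Real.exp (-(t * x)) * ‖confluentKernel a c x‖) posMeasure := by
  obtain ⟨A, hA0, hA⟩ : ∃ A : ℝ, 0 < A ∧ c.re < A :=
    ⟨max c.re 0 + 1, by positivity, by linarith [le_max_left c.re 0]⟩
  have hint := (integrable_confluentKernel (c := c - A) ha (by simpa using by linarith)).norm
  refine (hint.const_mul (Real.exp t * (A ^ A * t ^ (-A)))).mono'
    (by fun_prop) (ae_posMeasure fun x hx => ?_)
  rw [Real.norm_of_nonneg (by positivity), ← confluentKernel_mul_rpow a c A hx]
  have h1 := exp_neg_le_mul_rpow_neg hA0 (show 0 < t * (1 + x) by positivity)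
  rw [Real.mul_rpow ht.le (by positivity)] at h1
  calc Real.exp (-(t * x)) * ‖confluentKernel a c x‖
      = Real.exp t * Real.exp (-(t * (1 + x))) * ‖confluentKernel a c x‖ := by
        rw [← Real.exp_add]; congr 2; ring
    _ ≤ Real.exp t * (A ^ A * (t ^ (-A) * (1 + x) ^ (-A))) * ‖confluentKernel a c x‖ := by gcongr
    _ = _ := by ring

theorem norm_cexp_neg_mul (t x : ℝ) : ‖Complex.exp (-(t * x))‖ = Real.exp (-(t * x)) := by
  rw [Complex.norm_exp]; simp

/-- The confluent hypergeometric function `U(a, 1 + c, t)` of Tricomi, for `0 < Re a`. -/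
def tricomi (a c : ℂ) (t : ℝ) : ℂ :=
  (Complex.Gamma a)⁻¹ * ∫ x : ℝ, Complex.exp (-(t * x)) * confluentKernel a c x ∂posMeasure

/-- Continuity is what makes Mellin inversion hold at each point t, not merely almost everywhere. -/
theorem continuousAt_tricomi {a : ℂ} (c : ℂ) (ha : 0 < a.re) {t : ℝ} (ht : 0 < t) :
    ContinuousAt (tricomi a c) t := by
  refine ContinuousAt.mul continuousAt_const ?_
  refine continuousAt_of_dominated
    (bound := fun x : ℝ => Real.exp (-(t / 2 * x)) * ‖confluentKernel a c x‖) ?_ ?_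
    (integrable_exp_mul_confluentKernel c ha (by positivity)) ?_
  · exact Eventually.of_forall fun s => by fun_prop
  · filter_upwards [lt_mem_nhds (show t / 2 < t by linarith)] with s hs
    refine ae_posMeasure fun x hx => ?_
    rw [norm_mul, norm_cexp_neg_mul]
    gcongr
  · exact ae_of_all _ fun x => Continuous.continuousAt (by fun_prop)

theorem mul_cexp_integrable {p : ℂ} (hp : 0 < p.re) {x : ℝ} (hx : 0 < x) :
    Integrable (fun t : ℝ => (t : ℂ) ^ (p - 1) * Complex.exp (-(t * x))) posMeasure := by
  -- The Bochner integral of a non-integrable function is 0 by convention, so a nonzero closed form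
  -- proves integrability.
  refine Integrable.of_integral_ne_zero ?_
  have := Complex.integral_cpow_mul_exp_neg_mul_Ioi hp hx
  simp only [mul_comm (x : ℂ)] at this
  rw [this]
  refine mul_ne_zero ?_ (Complex.Gamma_ne_zero_of_re_pos hp)
  rw [Ne, Complex.cpow_eq_zero_iff]
  simp [hx.ne']

theorem integrable_mellin_kernel {p a c : ℂ} (hp : 0 < p.re) (hpa : p.re < a.re)
    (hpc : c.re < p.re) :
    Integrable (fun z : ℝ × ℝ => (z.1 : ℂ) ^ (p - 1) *
      (Complex.exp (-(z.1 * z.2)) * confluentKernel a c z.2)) (posMeasure.prod posMeasure) := by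
  rw [integrable_prod_iff' (by fun_prop)]
  constructor
  · refine ae_posMeasure fun x hx => ?_
    simp only [← mul_assoc]
    exact (mul_cexp_integrable hp hx).mul_const _
  · have h := ((integrable_confluentKernel (a := a - p) (c := c - p) (by simpa using hpa)
      (by simpa using hpc)).norm).const_mul (Real.Gamma p.re)
    refine h.congr (ae_posMeasure fun x hx => ?_)
    have h1 := Real.integral_rpow_mul_exp_neg_mul_Ioi hp hx
    have h2 : ∫ t : ℝ, ‖(t : ℂ) ^ (p - 1) * (Complex.exp (-(t * x)) * confluentKernel a c x)‖
          ∂posMeasure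
        = ∫ t in Set.Ioi 0, (t ^ (p.re - 1) * Real.exp (-(x * t))) * ‖confluentKernel a c x‖ := by
      refine setIntegral_congr_fun measurableSet_Ioi fun t ht => ?_
      rw [norm_mul, norm_mul, norm_cexp_neg_mul, Complex.norm_cpow_eq_rpow_re_of_pos ht,
        mul_comm t x, ← mul_assoc, Complex.sub_re, Complex.one_re]
    simp only
    rw [h2, integral_mul_const, h1, norm_confluentKernel _ _ hx, norm_confluentKernel _ _ hx,
      one_div, Real.inv_rpow hx.le, ← Real.rpow_neg hx.le, Complex.sub_re, Complex.sub_re,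
      show a.re - p.re - 1 = -p.re + (a.re - 1) by ring, Real.rpow_add hx]
    ring_nf

/-- By Fubini the t-integral is done first and gives Γ(p) x^(-p); what remains is a beta integral
with a and c both lowered by p. -/
theorem mellin_tricomi {p a c : ℂ} (hp : 0 < p.re) (hpa : p.re < a.re) (hpc : c.re < p.re) :
    MellinConvergent (tricomi a c) p ∧ mellin (tricomi a c) p
      = Complex.Gamma p * Complex.Gamma (p - c) * Complex.Gamma (a - p)
        / (Complex.Gamma a * Complex.Gamma (a - c)) := by
  have hint := integrable_mellin_kernel hp hpa hpc
  have hfun : (fun t : ℝ => (t : ℂ) ^ (p - 1) • tricomi a c t) = fun t : ℝ =>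
      (Complex.Gamma a)⁻¹ * ∫ x : ℝ, (t : ℂ) ^ (p - 1) *
        (Complex.exp (-(t * x)) * confluentKernel a c x) ∂posMeasure := by
    funext t
    rw [integral_const_mul, smul_eq_mul, tricomi]
    ring
  constructor
  · rw [MellinConvergent, hfun]
    exact hint.integral_prod_left.const_mul _
  · rw [mellin, hfun, integral_const_mul, integral_integral_swap hint]
    have h1 : ∫ x : ℝ, ∫ t : ℝ, (t : ℂ) ^ (p - 1) * (Complex.exp (-(t * x)) *
          confluentKernel a c x) ∂posMeasure ∂posMeasure
        = ∫ x : ℝ, Complex.Gamma p * confluentKernel (a - p) (c - p) x ∂posMeasure := by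
      refine integral_congr_ae (ae_posMeasure fun x hx => ?_)
      have h2 := Complex.integral_cpow_mul_exp_neg_mul_Ioi hp hx
      simp only [mul_comm (x : ℂ)] at h2
      simp only [← mul_assoc]
      rw [integral_mul_const, h2, confluentKernel, confluentKernel, one_div,
        Complex.inv_cpow _ _ (by rw [Complex.arg_ofReal_of_nonneg hx.le]; exact Real.pi_pos.ne),
        ← Complex.cpow_neg, show a - p - 1 = -p + (a - 1) by ring,
        Complex.cpow_add _ _ (Complex.ofReal_ne_zero.mpr hx.ne')]
      ring_nf
    rw [h1, integral_const_mul, integral_confluentKernel (by simpa using hpa) (by simpa using hpc)]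
    rw [show -(c - p) = p - c by ring, show a - p - (c - p) = a - c by ring]
    have := Complex.Gamma_ne_zero_of_re_pos (hp.trans hpa)
    field_simp

theorem norm_Gamma_le {z : ℂ} (hz : 0 < z.re) : ‖Complex.Gamma z‖ ≤ Real.Gamma z.re := by
  rw [Complex.Gamma_eq_integral hz, Real.Gamma_eq_integral hz, Complex.GammaIntegral]
  refine (norm_integral_le_integral_norm _).trans_eq ?_
  refine setIntegral_congr_fun measurableSet_Ioi fun x hx => ?_
  rw [norm_mul, Complex.norm_cpow_eq_rpow_re_of_pos hx, Complex.norm_real,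
    Real.norm_of_nonneg (Real.exp_pos _).le, Complex.sub_re, Complex.one_re]

theorem continuous_Gamma_vertical {z : ℂ} (hz : 0 < z.re) (ε : ℝ) :
    Continuous fun y : ℝ => Complex.Gamma (z + ε * y * Complex.I) := by
  refine continuous_iff_continuousAt.mpr fun y => ?_
  refine ContinuousAt.comp (f := fun y : ℝ => z + ε * y * Complex.I) (g := Complex.Gamma)
    (Complex.differentiableAt_Gamma _ fun m h => ?_).continuousAt (by fun_prop)
  have := congrArg Complex.re h
  simp at this
  have hm : (0 : ℝ) ≤ m := m.cast_nonneg
  linarith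

theorem norm_Gamma_vertical_le {z : ℂ} (hz : 0 < z.re) (ε y : ℝ) :
    ‖Complex.Gamma (z + ε * y * Complex.I)‖ ≤ Real.Gamma z.re := by
  have h := norm_Gamma_le (z := z + ε * y * Complex.I) (by simpa using hz)
  simpa using h

/-- Two applications of the functional equation bound |w|² |Γ(w)| by Γ(Re z + 2). Quadratic decay
suffices, so Stirling's formula is avoided. -/
theorem integrable_Gamma_vertical {z : ℂ} (hz : 0 < z.re) :
    Integrable fun y : ℝ => Complex.Gamma (z + y * Complex.I) := by
  have hcont : Continuous fun y : ℝ => Complex.Gamma (z + y * Complex.I) := by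
    simpa using continuous_Gamma_vertical hz 1
  -- Chosen so that δ (1 + (Im w)²) ≤ (Re w)² + (Im w)² = |w|².
  set δ : ℝ := min (z.re ^ 2) 1 with hδ
  have hδ0 : 0 < δ := by positivity
  have hb : Integrable fun y : ℝ => Real.Gamma (z.re + 2) / δ * (1 + (y + z.im) ^ 2)⁻¹ :=
    (integrable_inv_one_add_sq.comp_add_right z.im).const_mul _
  refine hb.mono' hcont.aestronglyMeasurable (ae_of_all _ fun y => ?_)
  set w := z + y * Complex.I with hw
  have hre : w.re = z.re := by simp [hw]
  have him : w.im = y + z.im := by simp [hw, add_comm]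
  have hw0 : w ≠ 0 := fun h => by rw [h] at hre; simp at hre; linarith
  have hw1 : w + 1 ≠ 0 := fun h => by
    have := congrArg Complex.re h
    simp [hre] at this; linarith
  have h1 : Complex.Gamma (w + 1 + 1) = (w + 1) * (w * Complex.Gamma w) := by
    rw [Complex.Gamma_add_one _ hw1, Complex.Gamma_add_one _ hw0]
  have h2 : ‖Complex.Gamma (w + 1 + 1)‖ ≤ Real.Gamma (z.re + 2) := by
    have := norm_Gamma_le (z := w + 1 + 1) (by simp [hre]; linarith)
    convert this using 2
    simp [hre]; ring
  rw [h1, norm_mul, norm_mul] at h2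
  have h3 : ‖w‖ ^ 2 = z.re ^ 2 + (y + z.im) ^ 2 := by
    rw [Complex.sq_norm, Complex.normSq_apply, hre, him]; ring
  have h4 : ‖w‖ ≤ ‖w + 1‖ := by
    rw [← sq_le_sq₀ (norm_nonneg _) (norm_nonneg _), Complex.sq_norm, Complex.sq_norm,
      Complex.normSq_apply, Complex.normSq_apply]
    simp only [Complex.add_re, Complex.one_re, Complex.add_im, Complex.one_im, add_zero]
    nlinarith
  have h5 : δ * (1 + (y + z.im) ^ 2) ≤ ‖w‖ ^ 2 := by
    rw [h3]
    have ha : δ ≤ z.re ^ 2 := min_le_left _ _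
    have hb : δ ≤ 1 := min_le_right _ _
    nlinarith [sq_nonneg (y + z.im)]
  have h6 : δ * (1 + (y + z.im) ^ 2) * ‖Complex.Gamma w‖ ≤ Real.Gamma (z.re + 2) := by
    refine le_trans ?_ h2
    calc _ ≤ ‖w‖ ^ 2 * ‖Complex.Gamma w‖ := by gcongr
      _ = ‖w‖ * (‖w‖ * ‖Complex.Gamma w‖) := by ring
      _ ≤ _ := by gcongr
  rw [div_mul_eq_mul_div, ← div_eq_mul_inv, div_div, le_div_iff₀ (by positivity)]
  linarith

/-- The one-variable factor of the integrand of a vertex. -/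
def legFactor (a c w : ℂ) : ℂ :=
  Complex.Gamma (-w) * Complex.Gamma (-c - w) * Complex.Gamma (a + w)
    / (Complex.Gamma a * Complex.Gamma (a - c))

/-- The factor Γ(a + w) alone supplies the decay; the two other Gamma functions are bounded on the
line. -/
theorem integrable_legFactor {a c : ℂ} {k : ℝ} (h0 : k < 0) (hc : c.re < -k) (ha : -k < a.re) :
    Integrable fun y : ℝ => legFactor a c (k + y * Complex.I) := by
  unfold legFactor
  refine Integrable.div_const ?_ _
  have h1 : 0 < (-k : ℂ).re := by simpa using h0
  have h2 : 0 < (-c - k : ℂ).re := by simpa using by linarith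
  have h3 : 0 < (a + k : ℂ).re := by simpa using by linarith
  have hi := integrable_Gamma_vertical h3
  have h12 := (((continuous_Gamma_vertical h1 (-1)).mul (continuous_Gamma_vertical h2
    (-1))).aestronglyMeasurable (μ := volume))
  have := hi.bdd_mul (c := Real.Gamma (-k : ℂ).re * Real.Gamma (-c - k : ℂ).re) h12
    (ae_of_all _ fun y => by
      rw [Pi.mul_apply, norm_mul]
      have := Real.Gamma_pos_of_pos h1
      gcongr
      · exact norm_Gamma_vertical_le h1 _ _
      · exact norm_Gamma_vertical_le h2 _ _)
  refine this.congr (ae_of_all _ fun y => ?_)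
  simp only [Pi.mul_apply]
  rw [show -(k + y * Complex.I) = -k + ((-1 : ℝ) : ℂ) * y * Complex.I by push_cast; ring,
    show -c - (k + y * Complex.I) = -c - k + ((-1 : ℝ) : ℂ) * y * Complex.I by push_cast; ring,
    add_assoc a]

/-- The Mellin-Barnes integral of Tricomi's function. -/
theorem integral_legFactor {a c : ℂ} {k : ℝ} (h0 : k < 0) (hc : c.re < -k) (ha : -k < a.re)
    {t : ℝ} (ht : 0 < t) :
    ((2 * Real.pi)⁻¹ : ℝ) * ∫ y : ℝ, (t : ℂ) ^ (k + y * Complex.I : ℂ) *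
      legFactor a c (k + y * Complex.I) = tricomi a c t := by
  -- The leg factor is the Mellin transform at p = -w, whence the reflection of y in the inversion
  -- formula.
  have hm : ∀ y : ℝ, mellin (tricomi a c) ((-k : ℝ) + (-y : ℝ) * Complex.I)
      = legFactor a c (k + y * Complex.I) := fun y => by
    rw [(mellin_tricomi (p := (-k : ℝ) + (-y : ℝ) * Complex.I) (by simpa using h0)
      (by simpa using ha) (by simpa using hc)).2, legFactor]
    congr 2
    · congr 2 <;> push_cast <;> ring
    · congr 1; push_cast; ring
  have hv : Complex.VerticalIntegrable (mellin (tricomi a c)) (-k) := by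
    have := (integrable_legFactor h0 hc ha).comp_neg
    refine this.congr (ae_of_all _ fun y => ?_)
    simp only
    rw [← hm, neg_neg]
  have h := mellinInv_mellin_eq (-k) (tricomi a c) ht
    (mellin_tricomi (p := (-k : ℝ)) (by simpa using h0) (by simpa using ha) (by simpa using hc)).1
    hv (continuousAt_tricomi c (by linarith) ht)
  rw [← h, mellinInv, ← integral_neg_eq_self, Complex.real_smul, one_div]
  congr 2
  funext y
  rw [show ((-k : ℝ) : ℂ) + (y : ℂ) * Complex.I = (-k : ℝ) + (-(-y) : ℝ) * Complex.I by
    rw [neg_neg], hm, smul_eq_mul]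
  congr 2
  push_cast; ring

end Tricomi

/-! ### The t-integral of a product of Tricomi functions: convergence and analyticity. -/

section Base

variable {ι : Type} [Fintype ι]

/-- The affine functions of the parameters whose nonpositive integer values are the poles of a
vertex. -/
def wall (T : Finset ι) (p : ℂ × (ι → ℂ) × (ι → ℂ)) : ℂ := p.1 - ∑ j ∈ T, p.2.2 j

/-- The domain of the continuation of a vertex after `k` steps. -/
def wallDomain (k : Finset ι ⊕ ι → ℕ) : Set (ℂ × (ι → ℂ) × (ι → ℂ)) :=
  {p | (∀ T, -(k (Sum.inl T) : ℝ) < (wall T p).re ∧ ∀ n : ℕ, wall T p ≠ -n) ∧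
    ∀ j, -(k (Sum.inr j) : ℝ) < (p.2.1 j).re ∧ -(k (Sum.inr j) : ℝ) < (p.2.1 j - p.2.2 j).re}

/-- The integrand of the integral representation of a vertex over `t` and the variables of the
functions `U`. -/
def vertexKernel (p : ℂ × (ι → ℂ) × (ι → ℂ)) (z : ℝ × (ι → ℝ)) : ℂ :=
  (z.1 : ℂ) ^ (p.1 - 1) * Complex.exp (-z.1) *
    ∏ j, Complex.exp (-(z.1 * z.2 j)) * confluentKernel (p.2.1 j) (p.2.2 j) (z.2 j)

/-- Lebesgue measure on the positive orthant. -/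
abbrev orthantMeasure (ι : Type) [Fintype ι] : Measure (ℝ × (ι → ℝ)) :=
  posMeasure.prod (Measure.pi fun _ : ι => posMeasure)

theorem ae_orthantMeasure {P : ℝ × (ι → ℝ) → Prop}
    (h : ∀ t x, 0 < t → (∀ j, 0 < x j) → P (t, x)) : ∀ᵐ z ∂orthantMeasure ι, P z := by
  rw [orthantMeasure, ← Measure.restrict_pi_pi, Measure.prod_restrict]
  refine ae_restrict_of_forall_mem
    (measurableSet_Ioi.prod (MeasurableSet.univ_pi fun _ => measurableSet_Ioi)) fun z hz => ?_
  exact h z.1 z.2 hz.1 fun j => hz.2 j (Set.mem_univ j)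

@[fun_prop]
theorem measurable_vertexKernel (p : ℂ × (ι → ℂ) × (ι → ℂ)) : Measurable (vertexKernel p) := by
  unfold vertexKernel
  refine Measurable.mul (by fun_prop) (Finset.measurable_fun_prod _ fun j _ => ?_)
  exact Measurable.mul (by fun_prop)
    ((measurable_confluentKernel _ _).comp (by fun_prop : Measurable fun z : ℝ × (ι → ℝ) => z.2 j))

/-- The strongest of the wall conditions is the one for the set of legs with Re c_j > 0. -/
theorem sum_max_re_lt {p : ℂ × (ι → ℂ) × (ι → ℂ)} (hw : ∀ T, 0 < (wall T p).re) :
    ∑ j, max (p.2.2 j).re 0 < p.1.re := by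
  classical
  have h := hw (Finset.univ.filter fun j => 0 < (p.2.2 j).re)
  rw [wall, Complex.sub_re, Complex.re_sum, Finset.sum_filter] at h
  have h2 : ∑ j, max (p.2.2 j).re 0 = ∑ j, if 0 < (p.2.2 j).re then (p.2.2 j).re else 0 := by
    refine Finset.sum_congr rfl fun j _ => ?_
    split_ifs with hj
    · exact max_eq_left hj.le
    · exact max_eq_right (not_lt.mp hj)
  linarith

theorem integrable_vertexKernel {p : ℂ × (ι → ℂ) × (ι → ℂ)} (ha : ∀ j, 0 < (p.2.1 j).re)
    (hw : ∀ T, 0 < (wall T p).re) : Integrable (vertexKernel p) (orthantMeasure ι) := by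
  -- Split e^(-t) into r + 1 equal factors, one for each leg and one for the t-integral. The excess
  -- of Re A over ∑ max(Re c_j, 0) is split in the same way into shares η.
  set b : ℝ := ((Fintype.card ι : ℝ) + 1)⁻¹ with hb
  have hb0 : 0 < b := by positivity
  have hb1 : b ≤ 1 := inv_le_one_of_one_le₀ (by simp)
  have hbr : (Fintype.card ι : ℝ) * b + b = 1 := by rw [hb]; field_simp
  set η : ℝ := (p.1.re - ∑ j, max (p.2.2 j).re 0) * b with hη
  have hη0 : 0 < η := mul_pos (sub_pos.mpr (sum_max_re_lt hw)) hb0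
  let A : ι → ℝ := fun j => max (p.2.2 j).re 0 + η
  have hA0 : ∀ j, 0 < A j := fun j => by positivity
  have hAc : ∀ j, (p.2.2 j).re < A j := fun j => by
    have := le_max_left (p.2.2 j).re 0
    simp only [A]; linarith
  have hAsum : p.1.re - 1 = (η - 1) + ∑ j, A j := by
    simp only [A, Finset.sum_add_distrib, Finset.sum_const, Finset.card_univ, nsmul_eq_mul]
    have : η + (Fintype.card ι : ℝ) * η = p.1.re - ∑ j, max (p.2.2 j).re 0 := by
      calc _ = (p.1.re - ∑ j, max (p.2.2 j).re 0) * ((Fintype.card ι : ℝ) * b + b) := by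
            rw [hη]; ring
        _ = _ := by rw [hbr, mul_one]
    linarith
  have h1 : Integrable (fun t : ℝ => t ^ (η - 1) * Real.exp (-(b * t))) posMeasure := by
    refine Integrable.of_integral_ne_zero ?_
    rw [Real.integral_rpow_mul_exp_neg_mul_Ioi hη0 hb0]
    have := Real.Gamma_pos_of_pos hη0
    positivity
  have h2 : Integrable (fun x : ι → ℝ => ∏ j, (A j ^ A j * b ^ (-A j)) *
      ‖confluentKernel (p.2.1 j) (p.2.2 j - A j) (x j)‖) (Measure.pi fun _ : ι => posMeasure) := by
    refine Integrable.fintype_prod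
      (f := fun j x => (A j ^ A j * b ^ (-A j)) *
        ‖confluentKernel (p.2.1 j) (p.2.2 j - A j) x‖) fun j => ?_
    exact (integrable_confluentKernel (ha j) (by simpa using hAc j)).norm.const_mul _
  refine (h1.mul_prod h2).mono' (by fun_prop) (ae_orthantMeasure fun t x ht hx => ?_)
  have hexp : Real.exp (-t) = Real.exp (-(b * t)) * ∏ _j : ι, Real.exp (-(b * t)) := by
    rw [Finset.prod_const, Finset.card_univ, ← Real.exp_nat_mul, ← Real.exp_add]
    congr 1
    linear_combination (-t) * (-hbr)
  rw [vertexKernel, norm_mul, norm_mul, Complex.norm_cpow_eq_rpow_re_of_pos ht, norm_prod,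
    Complex.norm_exp]
  simp only [Complex.sub_re, Complex.one_re, Complex.neg_re, Complex.ofReal_re]
  rw [hAsum, Real.rpow_add ht, Real.rpow_sum_of_pos ht, hexp,
    show t ^ (η - 1) * (∏ j, t ^ A j) * (Real.exp (-(b * t)) * ∏ _j : ι, Real.exp (-(b * t)))
        * ∏ j, ‖Complex.exp (-(t * x j)) * confluentKernel (p.2.1 j) (p.2.2 j) (x j)‖
      = t ^ (η - 1) * Real.exp (-(b * t)) * ((∏ j, t ^ A j) * (∏ _j : ι, Real.exp (-(b * t)))
        * ∏ j, ‖Complex.exp (-(t * x j)) * confluentKernel (p.2.1 j) (p.2.2 j) (x j)‖) by ring,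
    -- Each leg absorbs t^(A_j) e^(-bt) and gains (1 + x_j)^(-A_j) with A_j > Re c_j, so its
    -- x_j-integral converges; t^(η-1) e^(-bt) remains for t.
    ← Finset.prod_mul_distrib, ← Finset.prod_mul_distrib]
  refine mul_le_mul_of_nonneg_left (Finset.prod_le_prod (fun _ _ => by positivity) fun j _ => ?_)
    (by positivity)
  rw [norm_mul, norm_cexp_neg_mul, ← confluentKernel_mul_rpow _ _ _ (hx j)]
  have hxj := hx j
  have h3 := exp_neg_le_mul_rpow_neg (hA0 j) (show 0 < b * t * (1 + x j) by positivity)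
  rw [Real.mul_rpow (by positivity) (by positivity), Real.mul_rpow hb0.le ht.le,
    Real.rpow_neg ht.le] at h3
  calc t ^ A j * Real.exp (-(b * t)) * (Real.exp (-(t * x j)) *
        ‖confluentKernel (p.2.1 j) (p.2.2 j) (x j)‖)
      = t ^ A j * Real.exp (-(b * t) - t * x j) *
        ‖confluentKernel (p.2.1 j) (p.2.2 j) (x j)‖ := by rw [sub_eq_add_neg, Real.exp_add]; ring
    _ ≤ t ^ A j * Real.exp (-(b * t * (1 + x j))) *
        ‖confluentKernel (p.2.1 j) (p.2.2 j) (x j)‖ := by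
        gcongr
        have : b * (t * x j) ≤ 1 * (t * x j) := by gcongr
        linarith
    _ ≤ t ^ A j * (A j ^ A j * (b ^ (-A j) * (t ^ A j)⁻¹ * (1 + x j) ^ (-A j))) *
        ‖confluentKernel (p.2.1 j) (p.2.2 j) (x j)‖ := by gcongr
    _ = _ := by
        have : t ^ A j ≠ 0 := by positivity
        field_simp

/-- The integral representation of a vertex, on its domain of absolute convergence. -/
def baseVertex (p : ℂ × (ι → ℂ) × (ι → ℂ)) : ℂ :=
  ∫ t : ℝ, (t : ℂ) ^ (p.1 - 1) * Complex.exp (-t) *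
    ∏ j, tricomi (p.2.1 j) (p.2.2 j) t ∂posMeasure

theorem integral_vertexKernel_slice (p : ℂ × (ι → ℂ) × (ι → ℂ)) (t : ℝ) :
    (t : ℂ) ^ (p.1 - 1) * Complex.exp (-t) * ∏ j, tricomi (p.2.1 j) (p.2.2 j) t
      = (∏ j, Complex.Gamma (p.2.1 j))⁻¹ *
        ∫ x, vertexKernel p (t, x) ∂(Measure.pi fun _ : ι => posMeasure) := by
  simp only [vertexKernel, tricomi, integral_const_mul]
  rw [integral_fintype_prod_eq_prod (μ := fun _ : ι => posMeasure)
    (f := fun j (x : ℝ) => Complex.exp (-(t * x)) * confluentKernel (p.2.1 j) (p.2.2 j) x),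
    Finset.prod_mul_distrib, Finset.prod_inv_distrib]
  ring

theorem integrable_baseVertex {p : ℂ × (ι → ℂ) × (ι → ℂ)} (ha : ∀ j, 0 < (p.2.1 j).re)
    (hw : ∀ T, 0 < (wall T p).re) :
    Integrable (fun t : ℝ => (t : ℂ) ^ (p.1 - 1) * Complex.exp (-t) *
      ∏ j, tricomi (p.2.1 j) (p.2.2 j) t) posMeasure := by
  simp only [integral_vertexKernel_slice p]
  exact (integrable_vertexKernel ha hw).integral_prod_left.const_mul _

theorem baseVertex_eq {p : ℂ × (ι → ℂ) × (ι → ℂ)} (ha : ∀ j, 0 < (p.2.1 j).re)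
    (hw : ∀ T, 0 < (wall T p).re) :
    baseVertex p = (∏ j, Complex.Gamma (p.2.1 j))⁻¹ *
      ∫ z, vertexKernel p z ∂orthantMeasure ι := by
  rw [baseVertex, integral_prod _ (integrable_vertexKernel ha hw), ← integral_const_mul]
  exact integral_congr_ae (ae_of_all _ fun t => integral_vertexKernel_slice p t)

/-- The exponents of `vertexKernel`. -/
def kernelExponent (z : ℝ × (ι → ℝ)) : Unit ⊕ ι ⊕ ι → ℝ :=
  Sum.elim (fun _ => Real.log z.1) (Sum.elim (fun j => Real.log (z.2 j) - Real.log (1 + z.2 j))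
    fun j => Real.log (1 + z.2 j))

theorem measurable_kernelExponent {ι : Type} (i : Unit ⊕ ι ⊕ ι) :
    Measurable fun z : ℝ × (ι → ℝ) => kernelExponent z i := by
  rcases i with _ | j | j <;> simp only [kernelExponent, Sum.elim_inl, Sum.elim_inr] <;>
    fun_prop

/-- The parameters of a vertex as one family. -/
def paramFamily (ι : Type) [Fintype ι] :
    (ℂ × (ι → ℂ) × (ι → ℂ)) →L[ℂ] (Unit ⊕ ι ⊕ ι → ℂ) :=
  ContinuousLinearMap.pi (Sum.elim (fun _ => ContinuousLinearMap.fst ℂ _ _)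
    (Sum.elim
      (fun j => (ContinuousLinearMap.proj j).comp
        ((ContinuousLinearMap.fst ℂ _ _).comp (ContinuousLinearMap.snd ℂ _ _)))
      fun j => (ContinuousLinearMap.proj j).comp
        ((ContinuousLinearMap.snd ℂ _ _).comp (ContinuousLinearMap.snd ℂ _ _))))

/-- The inverse of `paramFamily`. -/
def familyParam (q : Unit ⊕ ι ⊕ ι → ℂ) : ℂ × (ι → ℂ) × (ι → ℂ) :=
  (q (Sum.inl ()), fun j => q (Sum.inr (Sum.inl j)), fun j => q (Sum.inr (Sum.inr j)))

/-- All parameters occur as exponents of positive reals, so the kernel is the exponential of a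
linear form in them. This is the form required by `analyticOnNhd_integral_cexp`. -/
theorem vertexKernel_eq_exp (q : Unit ⊕ ι ⊕ ι → ℂ) {t : ℝ} {x : ι → ℝ} (ht : 0 < t)
    (hx : ∀ j, 0 < x j) :
    vertexKernel (familyParam q) (t, x) = vertexKernel 0 (t, x) *
      Complex.exp (∑ i, q i * kernelExponent (t, x) i) := by
  have hk : ∀ j, confluentKernel (q (Sum.inr (Sum.inl j))) (q (Sum.inr (Sum.inr j))) (x j)
      = confluentKernel 0 0 (x j) *
        Complex.exp (q (Sum.inr (Sum.inl j)) * (Real.log (x j) - Real.log (1 + x j) : ℝ)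
          + q (Sum.inr (Sum.inr j)) * Real.log (1 + x j)) := by
    intro j
    have h1 : ((x j : ℝ) : ℂ) ≠ 0 := Complex.ofReal_ne_zero.mpr (hx j).ne'
    have h2 : ((1 + x j : ℝ) : ℂ) ≠ 0 :=
      Complex.ofReal_ne_zero.mpr (add_pos one_pos (hx j)).ne'
    simp only [confluentKernel]
    rw [show (1 + x j : ℂ) = ((1 + x j : ℝ) : ℂ) by push_cast; ring,
      Complex.cpow_def_of_ne_zero h1, Complex.cpow_def_of_ne_zero h1,
      Complex.cpow_def_of_ne_zero h2, Complex.cpow_def_of_ne_zero h2,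
      ← Complex.ofReal_log (hx j).le, ← Complex.ofReal_log (add_pos one_pos (hx j)).le,
      ← Complex.exp_add, ← Complex.exp_add, ← Complex.exp_add]
    congr 1
    push_cast
    ring
  have ht0 : (t : ℂ) ≠ 0 := Complex.ofReal_ne_zero.mpr ht.ne'
  have h3 : (t : ℂ) ^ (q (Sum.inl ()) - 1)
      = (t : ℂ) ^ ((0 : ℂ) - 1) * Complex.exp (q (Sum.inl ()) * Real.log t) := by
    rw [Complex.cpow_def_of_ne_zero ht0, Complex.cpow_def_of_ne_zero ht0, ← Complex.exp_add,
      ← Complex.ofReal_log ht.le]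
    congr 1
    ring
  simp only [vertexKernel, familyParam, hk, h3, Fintype.sum_sum_type, kernelExponent,
    Sum.elim_inl, Sum.elim_inr, Finset.univ_unique, Finset.sum_singleton, Prod.fst_zero,
    Prod.snd_zero, Pi.zero_apply]
  rw [Complex.exp_add, ← Finset.sum_add_distrib, Complex.exp_sum]
  simp only [Finset.prod_mul_distrib]
  simp only [PUnit.default_eq_unit]
  ring

theorem isOpen_setOf_forall_ne_neg_natCast : IsOpen {z : ℂ | ∀ n : ℕ, z ≠ -n} := by
  have h : {z : ℂ | ∀ n : ℕ, z ≠ -n} = (fun z : ℂ => -z) ⁻¹' (Set.range ((↑) : ℕ → ℂ))ᶜ := by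
    ext z
    simp only [Set.mem_ofPred_eq, Set.mem_preimage, Set.mem_compl_iff, Set.mem_range, not_exists]
    exact forall_congr' fun n => not_congr ⟨fun h => by rw [h, neg_neg],
      fun h => by rw [h, neg_neg]⟩
  rw [h]
  refine IsOpen.preimage continuous_neg (IsClosed.isOpen_compl (self := ?_))
  have h2 : Set.range ((↑) : ℕ → ℂ) = (fun x : ℝ => (x : ℂ)) '' Set.range ((↑) : ℕ → ℝ) := by
    rw [← Set.range_comp]; rfl
  rw [h2]
  exact Complex.isometry_ofReal.isClosedEmbedding.isClosedMap _ Nat.isClosedEmbedding_coe_real.isClosed_range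

theorem continuous_wall {ι : Type} (T : Finset ι) : Continuous (wall T) := by
  unfold wall; fun_prop

theorem isOpen_wallDomain (k : Finset ι ⊕ ι → ℕ) : IsOpen (wallDomain k) := by
  have h1 : IsOpen (⋂ T, {p : ℂ × (ι → ℂ) × (ι → ℂ) | -(k (Sum.inl T) : ℝ) < (wall T p).re} ∩
      wall T ⁻¹' {z : ℂ | ∀ n : ℕ, z ≠ -n}) := by
    refine isOpen_iInter_of_finite fun T => IsOpen.inter ?_ ?_
    · exact isOpen_lt continuous_const (Complex.continuous_re.comp (continuous_wall T))
    · exact isOpen_setOf_forall_ne_neg_natCast.preimage (continuous_wall T)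
  have h2 : IsOpen {p : ℂ × (ι → ℂ) × (ι → ℂ) | ∀ j, -(k (Sum.inr j) : ℝ) < (p.2.1 j).re ∧
      -(k (Sum.inr j) : ℝ) < (p.2.1 j - p.2.2 j).re} := by
    simp only [Set.ofPred_forall, Set.ofPred_and]
    refine isOpen_iInter_of_finite fun j => IsOpen.inter ?_ ?_
    · exact isOpen_lt continuous_const (by fun_prop)
    · exact isOpen_lt continuous_const (by fun_prop)
  convert h1.inter h2 using 1
  ext p
  simp [wallDomain]

theorem analyticAt_param_a (j : ι) (p : ℂ × (ι → ℂ) × (ι → ℂ)) :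
    AnalyticAt ℂ (fun p : ℂ × (ι → ℂ) × (ι → ℂ) => p.2.1 j) p :=
  ((ContinuousLinearMap.proj (R := ℂ) (φ := fun _ : ι => ℂ) j).comp
    ((ContinuousLinearMap.fst ℂ (ι → ℂ) (ι → ℂ)).comp
      (ContinuousLinearMap.snd ℂ ℂ ((ι → ℂ) × (ι → ℂ))))).analyticAt p

theorem analyticAt_param_c (j : ι) (p : ℂ × (ι → ℂ) × (ι → ℂ)) :
    AnalyticAt ℂ (fun p : ℂ × (ι → ℂ) × (ι → ℂ) => p.2.2 j) p :=
  ((ContinuousLinearMap.proj (R := ℂ) (φ := fun _ : ι => ℂ) j).comp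
    ((ContinuousLinearMap.snd ℂ (ι → ℂ) (ι → ℂ)).comp
      (ContinuousLinearMap.snd ℂ ℂ ((ι → ℂ) × (ι → ℂ))))).analyticAt p

theorem analyticAt_wall (T : Finset ι) (p : ℂ × (ι → ℂ) × (ι → ℂ)) :
    AnalyticAt ℂ (wall T) p := by
  unfold wall
  exact analyticAt_fst.sub (Finset.analyticAt_fun_sum _ fun j _ => analyticAt_param_c j p)

/-- The prefactors 1 / Γ(a_j) are entire, and the remaining integral is of Laplace type. -/
theorem analyticOnNhd_baseVertex :
    AnalyticOnNhd ℂ (baseVertex (ι := ι)) (wallDomain (ι := ι) 0) := by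
  have hpos : ∀ p ∈ wallDomain (ι := ι) 0,
      (∀ j, 0 < (p.2.1 j).re) ∧ ∀ T, 0 < (wall T p).re := fun p hp =>
    ⟨fun j => by simpa using (hp.2 j).1, fun T => by simpa using (hp.1 T).1⟩
  have hcont : Continuous (familyParam (ι := ι)) := by unfold familyParam; fun_prop
  have han := analyticOnNhd_integral_cexp (orthantMeasure ι) kernelExponent (vertexKernel 0)
    ((isOpen_wallDomain (ι := ι) 0).preimage hcont) measurable_kernelExponent (fun q hq => by
      refine (integrable_vertexKernel (hpos _ hq).1 (hpos _ hq).2).congr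
        (ae_orthantMeasure fun t x ht hx => vertexKernel_eq_exp q ht hx))
  intro p hp
  have h1 : AnalyticAt ℂ (fun p => ∫ z, vertexKernel 0 z *
      Complex.exp (∑ i, paramFamily ι p i * kernelExponent z i) ∂orthantMeasure ι) p :=
    (han (paramFamily ι p) hp).comp ((paramFamily ι).analyticAt p)
  have h2 : AnalyticAt ℂ (fun p : ℂ × (ι → ℂ) × (ι → ℂ) =>
      ∏ j, (Complex.Gamma (p.2.1 j))⁻¹) p := by
    refine Finset.analyticAt_fun_prod _ fun j _ => ?_
    have h3 : AnalyticAt ℂ (fun z => (Complex.Gamma z)⁻¹) (p.2.1 j) :=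
      (Complex.differentiable_one_div_Gamma).analyticAt _
    exact h3.comp (f := fun p : ℂ × (ι → ℂ) × (ι → ℂ) => p.2.1 j) (analyticAt_param_a j p)
  refine (h2.mul h1).congr ?_
  filter_upwards [(isOpen_wallDomain (ι := ι) 0).mem_nhds hp] with p hp
  rw [Pi.mul_apply, baseVertex_eq (hpos p hp).1 (hpos p hp).2, Finset.prod_inv_distrib]
  congr 1
  refine integral_congr_ae (ae_orthantMeasure fun t x ht hx => ?_)
  exact (vertexKernel_eq_exp (paramFamily ι p) ht hx).symm

end Base

/-! ### From the Mellin-Barnes integral to the t-integral, and contiguity relations. -/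

section MellinBarnes

variable {ι : Type} [Fintype ι]

/-- The integrand of a vertex in the parameters `A = (D + (r - 2) h + ∑ c_a) / 2`,
`a = (h + c - s) / 2` and `c`. -/
def mbIntegrand (p : ℂ × (ι → ℂ) × (ι → ℂ)) (w : ι → ℂ) : ℂ :=
  Complex.Gamma (p.1 + ∑ j, w j) * ∏ j, legFactor (p.2.1 j) (p.2.2 j) (w j)

/-- The point `κ + i y` of a product of vertical lines. -/
def verticalPoint (κ y : ι → ℝ) : ι → ℂ := fun j => κ j + y j * Complex.I

/-- The vertical lines through `κ` separate the poles. -/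
def Admissible (p : ℂ × (ι → ℂ) × (ι → ℂ)) (κ : ι → ℝ) : Prop :=
  0 < p.1.re + ∑ j, κ j ∧ ∀ j, κ j < 0 ∧ (p.2.2 j).re < -κ j ∧ -κ j < (p.2.1 j).re

/-- Each -κ_j is positive and exceeds Re c_j, so ∑_T Re c_j ≤ ∑ -κ_j < Re A. -/
theorem Admissible.re_wall_pos {p : ℂ × (ι → ℂ) × (ι → ℂ)} {κ : ι → ℝ} (h : Admissible p κ)
    (T : Finset ι) : 0 < (wall T p).re := by
  classical
  rw [wall, Complex.sub_re, Complex.re_sum]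
  have h1 : ∑ j ∈ T, (p.2.2 j).re ≤ ∑ j ∈ T, -κ j := Finset.sum_le_sum fun j _ => (h.2 j).2.1.le
  have h2 : ∑ j ∈ T, -κ j ≤ ∑ j, -κ j :=
    Finset.sum_le_sum_of_subset_of_nonneg (Finset.subset_univ T)
      fun j _ _ => (neg_pos.mpr (h.2 j).1).le
  simp only [Finset.sum_neg_distrib] at h1 h2
  linarith [h.1]

theorem Admissible.mem_wallDomain {p : ℂ × (ι → ℂ) × (ι → ℂ)} {κ : ι → ℝ}
    (h : Admissible p κ) : p ∈ wallDomain (ι := ι) 0 := by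
  refine ⟨fun T => ⟨by simpa using h.re_wall_pos T, fun n hn => ?_⟩, fun j => ?_⟩
  · have h1 := h.re_wall_pos T
    rw [hn] at h1
    simp at h1
    linarith [(n.cast_nonneg : (0 : ℝ) ≤ n)]
  · have := h.2 j
    simp only [Pi.zero_apply, Nat.cast_zero, neg_zero, Complex.sub_re]
    constructor <;> linarith

/-- Place each line slightly to the left of -max(Re c_j, 0). The walls leave room for this in the
collective Gamma function, and Re a_j > 0, Re(a_j - c_j) > 0 leave room on the leg. -/
theorem exists_admissible {p : ℂ × (ι → ℂ) × (ι → ℂ)} (hp : p ∈ wallDomain (ι := ι) 0) :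
    ∃ κ, Admissible p κ := by
  have hw : ∀ T, 0 < (wall T p).re := fun T => by simpa using (hp.1 T).1
  have hs := sum_max_re_lt hw
  set B := p.1.re - ∑ j, max (p.2.2 j).re 0 with hB
  have h1 : ∀ j, ∀ᶠ η in 𝓝[>] (0 : ℝ), η < (p.2.1 j).re - max (p.2.2 j).re 0 := fun j => by
    refine mem_nhdsWithin_of_mem_nhds (gt_mem_nhds ?_)
    have h2 := hp.2 j
    simp only [Pi.zero_apply, Nat.cast_zero, neg_zero, Complex.sub_re] at h2
    rw [sub_pos]
    exact max_lt (by linarith) h2.1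
  have h2 : ∀ᶠ η in 𝓝[>] (0 : ℝ), (Fintype.card ι : ℝ) * η < B := by
    refine mem_nhdsWithin_of_mem_nhds ?_
    have : Tendsto (fun η : ℝ => (Fintype.card ι : ℝ) * η) (𝓝 0) (𝓝 0) := by
      simpa using (continuous_const_mul (Fintype.card ι : ℝ)).tendsto 0
    exact this (gt_mem_nhds (by linarith))
  have h3 : ∀ᶠ η in 𝓝[>] (0 : ℝ), 0 < η := eventually_mem_nhdsWithin
  obtain ⟨η, h1, h2, h3⟩ := ((eventually_all.mpr h1).and (h2.and h3)).exists
  refine ⟨fun j => -(max (p.2.2 j).re 0 + η), ?_, fun j => ⟨?_, ?_, ?_⟩⟩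
  · rw [Finset.sum_neg_distrib, Finset.sum_add_distrib, Finset.sum_const, Finset.card_univ,
      nsmul_eq_mul]
    linarith
  · linarith [le_max_right (p.2.2 j).re 0]
  · linarith [le_max_left (p.2.2 j).re 0]
  · linarith [h1 j]

theorem integrable_prod_legFactor {p : ℂ × (ι → ℂ) × (ι → ℂ)} {κ : ι → ℝ} (h : Admissible p κ) :
    Integrable fun y : ι → ℝ => ∏ j, legFactor (p.2.1 j) (p.2.2 j) (verticalPoint κ y j) := by
  rw [volume_pi]
  exact Integrable.fintype_prod
    (f := fun j (y : ℝ) => legFactor (p.2.1 j) (p.2.2 j) (κ j + y * Complex.I))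
    fun j => integrable_legFactor (h.2 j).1 (h.2 j).2.1 (h.2 j).2.2

theorem re_add_sum_verticalPoint (A : ℂ) (κ y : ι → ℝ) :
    (A + ∑ j, verticalPoint κ y j).re = A.re + ∑ j, κ j := by
  simp [verticalPoint]

theorem integrable_mbIntegrand {p : ℂ × (ι → ℂ) × (ι → ℂ)} {κ : ι → ℝ} (h : Admissible p κ) :
    Integrable fun y : ι → ℝ => mbIntegrand p (verticalPoint κ y) := by
  refine (integrable_prod_legFactor h).bdd_mul (c := Real.Gamma (p.1.re + ∑ j, κ j)) ?_
    (ae_of_all _ fun y => ?_)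
  · refine Continuous.aestronglyMeasurable (continuous_iff_continuousAt.mpr fun y => ?_)
    refine ContinuousAt.comp (f := fun y : ι → ℝ => p.1 + ∑ j, verticalPoint κ y j)
      (g := Complex.Gamma) (Complex.differentiableAt_Gamma _ fun m hm => ?_).continuousAt
      (Continuous.continuousAt (by unfold verticalPoint; fun_prop))
    have h1 := re_add_sum_verticalPoint p.1 κ y
    rw [hm] at h1
    simp at h1
    linarith [h.1, (m.cast_nonneg : (0 : ℝ) ≤ m)]
  · rw [← re_add_sum_verticalPoint p.1 κ y]
    exact norm_Gamma_le (by rw [re_add_sum_verticalPoint]; exact h.1)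

theorem cpow_sum {x : ℂ} (hx : x ≠ 0) (f : ι → ℂ) : x ^ (∑ j, f j) = ∏ j, x ^ f j := by
  simp only [Complex.cpow_def_of_ne_zero hx, Finset.mul_sum, Complex.exp_sum]

/-- Write Γ(A + ∑ w_j) as an Euler integral and exchange. Since t^(∑ w_j) is a product, the
w-integral factorizes into the Mellin-Barnes integrals of the functions U. -/
theorem integral_mbIntegrand {p : ℂ × (ι → ℂ) × (ι → ℂ)} {κ : ι → ℝ} (h : Admissible p κ) :
    (((2 * Real.pi)⁻¹ ^ Fintype.card ι : ℝ) : ℂ) * ∫ y : ι → ℝ, mbIntegrand p (verticalPoint κ y)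
      = baseVertex p := by
  let L : (ι → ℝ) → ℂ := fun y => ∏ j, legFactor (p.2.1 j) (p.2.2 j) (verticalPoint κ y j)
  let f : (ι → ℝ) → ℝ → ℂ := fun y t =>
    L y * ((t : ℂ) ^ (p.1 + ∑ j, verticalPoint κ y j - 1) * Complex.exp (-t))
  have hL : Integrable L := integrable_prod_legFactor h
  have hG : Integrable (fun t : ℝ => t ^ (p.1.re + ∑ j, κ j - 1) * Real.exp (-t)) posMeasure := by
    have := Real.GammaIntegral_convergent h.1
    exact this.congr (ae_of_all _ fun t => mul_comm _ _)
  have hf : Integrable (Function.uncurry f) (volume.prod posMeasure) := by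
    refine (hL.norm.mul_prod hG).mono' ?_ ?_
    · refine AEStronglyMeasurable.mul hL.1.comp_fst ?_
      unfold verticalPoint
      exact Measurable.aestronglyMeasurable (by fun_prop)
    · have hae : ∀ᵐ z : (ι → ℝ) × ℝ ∂volume.prod posMeasure, 0 < z.2 :=
        Measure.quasiMeasurePreserving_snd.ae (ae_posMeasure fun x hx => hx)
      filter_upwards [hae] with z hz
      simp only [Function.uncurry, f]
      rw [norm_mul, norm_mul, Complex.norm_cpow_eq_rpow_re_of_pos hz, Complex.norm_exp,
        Complex.sub_re, re_add_sum_verticalPoint]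
      simp
  have h1 : ∀ y, mbIntegrand p (verticalPoint κ y) = ∫ t, f y t ∂posMeasure := by
    intro y
    simp only [f]
    rw [integral_const_mul, mbIntegrand, Complex.Gamma_eq_integral
      (by rw [re_add_sum_verticalPoint]; exact h.1), Complex.GammaIntegral, mul_comm]
    congr 1
    refine integral_congr_ae (ae_of_all _ fun t => ?_)
    simp only
    push_cast
    ring
  simp only [h1]
  rw [integral_integral_swap hf, ← integral_const_mul, baseVertex]
  refine integral_congr_ae (ae_posMeasure fun t ht => ?_)
  have ht0 : (t : ℂ) ≠ 0 := Complex.ofReal_ne_zero.mpr ht.ne'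
  have h2 : ∀ y, f y t = (t : ℂ) ^ (p.1 - 1) * Complex.exp (-t) *
      ∏ j, ((t : ℂ) ^ (κ j + y j * Complex.I : ℂ) *
        legFactor (p.2.1 j) (p.2.2 j) (κ j + y j * Complex.I)) := by
    intro y
    simp only [f, L, verticalPoint]
    rw [Finset.prod_mul_distrib, ← cpow_sum ht0, add_sub_right_comm,
      Complex.cpow_add _ _ ht0]
    ring
  simp only [h2]
  rw [integral_const_mul, volume_pi, integral_fintype_prod_eq_prod (μ := fun _ : ι => volume)
    (f := fun j (y : ℝ) => (t : ℂ) ^ (κ j + y * Complex.I : ℂ) *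
        legFactor (p.2.1 j) (p.2.2 j) (κ j + y * Complex.I)), mul_left_comm]
  congr 1
  rw [Complex.ofReal_pow, ← Finset.card_univ, ← Finset.prod_const, ← Finset.prod_mul_distrib]
  exact Finset.prod_congr rfl fun j _ =>
    integral_legFactor (h.2 j).1 (h.2 j).2.1 (h.2 j).2.2 ht

/-- This and the three lemmas that follow say that a shift of parameters multiplies the leg factor
by a polynomial in w, up to a factor independent of w. Linear relations among such polynomials
become relations among vertices. -/
theorem legFactor_add_one_add_one {a c w : ℂ} (ha : a ≠ 0) (hw : w ≠ 0) :
    a * legFactor (a + 1) (c + 1) (w - 1) = -w * legFactor a c w := by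
  simp only [legFactor]
  rw [show -(w - 1) = -w + 1 by ring, Complex.Gamma_add_one _ (neg_ne_zero.mpr hw),
    Complex.Gamma_add_one _ ha, show -(c + 1) - (w - 1) = -c - w by ring,
    show a + 1 + (w - 1) = a + w by ring, show a + 1 - (c + 1) = a - c by ring]
  -- `Complex.Gamma` is 0 at its poles, so in these degenerate cases division by zero makes both
  -- sides vanish.
  by_cases h0 : Complex.Gamma a = 0
  · simp [h0]
  by_cases h1 : Complex.Gamma (a - c) = 0
  · simp [h1]
  field_simp

theorem legFactor_sub_one {a c w : ℂ} (hac : a - c ≠ 0) (hw : -c - w ≠ 0) :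
    (a - c) * legFactor a (c - 1) w = (-c - w) * legFactor a c w := by
  simp only [legFactor]
  rw [show -(c - 1) - w = -c - w + 1 by ring, Complex.Gamma_add_one _ hw,
    show a - (c - 1) = a - c + 1 by ring, Complex.Gamma_add_one _ hac]
  by_cases h0 : Complex.Gamma a = 0
  · simp [h0]
  by_cases h1 : Complex.Gamma (a - c) = 0
  · simp [h1]
  field_simp

theorem legFactor_add_one {a c w : ℂ} (ha : a ≠ 0) (hac : a - c ≠ 0) (haw : a + w ≠ 0) :
    a * (a - c) * legFactor (a + 1) c w = (a + w) * legFactor a c w := by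
  simp only [legFactor]
  rw [show a + 1 + w = a + w + 1 by ring, Complex.Gamma_add_one _ haw,
    show a + 1 - c = a - c + 1 by ring, Complex.Gamma_add_one _ hac, Complex.Gamma_add_one _ ha]
  by_cases h0 : Complex.Gamma a = 0
  · simp [h0]
  by_cases h1 : Complex.Gamma (a - c) = 0
  · simp [h1]
  field_simp

theorem legFactor_add_one_shift {a c w : ℂ} (ha : a ≠ 0) (hac : a - c ≠ 0) (hw : w ≠ 0)
    (hcw : -c - w ≠ 0) :
    a * (a - c) * legFactor (a + 1) c (w - 1) = w * (w + c) * legFactor a c w := by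
  simp only [legFactor]
  rw [show -(w - 1) = -w + 1 by ring, Complex.Gamma_add_one _ (neg_ne_zero.mpr hw),
    show -c - (w - 1) = -c - w + 1 by ring, Complex.Gamma_add_one _ hcw,
    show a + 1 + (w - 1) = a + w by ring,
    show a + 1 - c = a - c + 1 by ring, Complex.Gamma_add_one _ hac, Complex.Gamma_add_one _ ha]
  by_cases h0 : Complex.Gamma a = 0
  · simp [h0]
  by_cases h1 : Complex.Gamma (a - c) = 0
  · simp [h1]
  field_simp
  ring

theorem mbIntegrand_add_one {p : ℂ × (ι → ℂ) × (ι → ℂ)} {w : ι → ℂ} (h : p.1 + ∑ j, w j ≠ 0) :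
    mbIntegrand (p + (1, 0, 0)) w = (p.1 + ∑ j, w j) * mbIntegrand p w := by
  simp only [mbIntegrand, Prod.fst_add, Prod.snd_add, add_zero]
  rw [add_right_comm, Complex.Gamma_add_one _ h]
  ring

theorem Admissible.add_one {p : ℂ × (ι → ℂ) × (ι → ℂ)} {κ : ι → ℝ} (h : Admissible p κ) :
    Admissible (p + (1, 0, 0)) κ := by
  refine ⟨?_, fun j => by simpa using h.2 j⟩
  simp only [Prod.fst_add, Complex.add_re, Complex.one_re]
  linarith [h.1]

theorem Admissible.re_facts {p : ℂ × (ι → ℂ) × (ι → ℂ)} {κ : ι → ℝ} (h : Admissible p κ)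
    (y : ι → ℝ) : p.1 + ∑ j, verticalPoint κ y j ≠ 0 ∧ ∀ j, p.2.1 j ≠ 0 ∧
      p.2.1 j - p.2.2 j ≠ 0 ∧ verticalPoint κ y j ≠ 0 ∧ -p.2.2 j - verticalPoint κ y j ≠ 0 ∧
      p.2.1 j + verticalPoint κ y j ≠ 0 ∧ p.2.1 j + 1 ≠ 0 ∧ p.2.1 j + 1 - p.2.2 j ≠ 0 ∧
      p.2.1 j + 1 + verticalPoint κ y j ≠ 0 := by
  have key : ∀ z : ℂ, z.re ≠ 0 → z ≠ 0 := fun z hz h0 => hz (by simp [h0])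
  have hv : ∀ j, (verticalPoint κ y j).re = κ j := fun j => by simp [verticalPoint]
  refine ⟨key _ ?_, fun j => ?_⟩
  · rw [re_add_sum_verticalPoint]; exact h.1.ne'
  · obtain ⟨h1, h2, h3⟩ := h.2 j
    refine ⟨key _ ?_, key _ ?_, key _ ?_, key _ ?_, key _ ?_, key _ ?_, key _ ?_, key _ ?_⟩ <;>
      (try simp only [Complex.sub_re, Complex.add_re, Complex.neg_re, hv, Complex.one_re]) <;>
      first | exact ne_of_gt (by linarith) | exact ne_of_lt (by linarith)

variable [DecidableEq ι]

/-- Change of one leg in a product over all legs. -/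
theorem mul_prod_eq_of_forall_ne {f g : ι → ℂ} (j : ι) {k K : ℂ} (h : ∀ i ≠ j, f i = g i)
    (hj : k * f j = K * g j) : k * ∏ i, f i = K * ∏ i, g i := by
  rw [← Finset.mul_prod_erase _ _ (Finset.mem_univ j), ← Finset.mul_prod_erase _ g
    (Finset.mem_univ j), ← mul_assoc, hj, Finset.prod_congr rfl fun i hi =>
    h i (Finset.ne_of_mem_erase hi), mul_assoc]

/-- The shift of the parameters in the term of the leg `j` in the relation that crosses the
wall `T`. -/
def legShift (T : Finset ι) (j : ι) : ℂ × (ι → ℂ) × (ι → ℂ) :=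
  if j ∈ T then (0, 0, -Pi.single j 1) else (1, Pi.single j 1, Pi.single j 1)

/-- The coefficient of the leg `j` in the relation that crosses the wall `T`. -/
def legCoeff (T : Finset ι) (j : ι) (p : ℂ × (ι → ℂ) × (ι → ℂ)) : ℂ :=
  if j ∈ T then p.2.1 j - p.2.2 j else p.2.1 j

theorem verticalPoint_sub_single {ι : Type} [DecidableEq ι] (κ y : ι → ℝ) (j : ι) :
    verticalPoint (κ - Pi.single j 1) y = verticalPoint κ y - Pi.single j 1 := by
  ext i
  by_cases hi : i = j
  · subst hi; simp [verticalPoint]; ring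
  · simp [verticalPoint, hi]

theorem sum_sub_single (w : ι → ℂ) (j : ι) : ∑ i, (w - Pi.single j 1 : ι → ℂ) i = ∑ i, w i - 1 := by
  simp [Finset.sum_sub_distrib]

theorem legCoeff_mul_mbIntegrand_of_mem {p : ℂ × (ι → ℂ) × (ι → ℂ)} {w : ι → ℂ} {T : Finset ι}
    {j : ι} (hj : j ∈ T) (h1 : p.2.1 j - p.2.2 j ≠ 0) (h2 : -p.2.2 j - w j ≠ 0) :
    legCoeff T j p * mbIntegrand (p + legShift T j) w = (-p.2.2 j - w j) * mbIntegrand p w := by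
  simp only [legCoeff, legShift, if_pos hj, mbIntegrand, Prod.fst_add, Prod.snd_add, add_zero]
  rw [mul_left_comm, mul_left_comm (-p.2.2 j - w j)]
  congr 1
  refine mul_prod_eq_of_forall_ne j (fun i hi => by simp [hi]) ?_
  have := legFactor_sub_one h1 h2
  simpa [sub_eq_add_neg] using this

theorem legCoeff_mul_mbIntegrand_of_notMem {p : ℂ × (ι → ℂ) × (ι → ℂ)} {w : ι → ℂ} {T : Finset ι}
    {j : ι} (hj : j ∉ T) (h1 : p.2.1 j ≠ 0) (h2 : w j ≠ 0) :
    legCoeff T j p * mbIntegrand (p + legShift T j) (w - Pi.single j 1)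
      = -w j * mbIntegrand p w := by
  simp only [legCoeff, legShift, if_neg hj, mbIntegrand, Prod.fst_add, Prod.snd_add]
  rw [mul_left_comm, mul_left_comm (-w j), sum_sub_single, add_add_sub_cancel]
  congr 1
  refine mul_prod_eq_of_forall_ne j (fun i hi => by simp [hi]) ?_
  simpa using legFactor_add_one_add_one (c := p.2.2 j) h1 h2

theorem mbIntegrand_leg_add_one {p : ℂ × (ι → ℂ) × (ι → ℂ)} {w : ι → ℂ}
    (j : ι) (h1 : p.2.1 j ≠ 0) (h2 : p.2.1 j - p.2.2 j ≠ 0) (h3 : p.2.1 j + w j ≠ 0) :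
    p.2.1 j * (p.2.1 j - p.2.2 j) * mbIntegrand (p + (0, Pi.single j 1, 0)) w
      = (p.2.1 j + w j) * mbIntegrand p w := by
  simp only [mbIntegrand, Prod.fst_add, Prod.snd_add, add_zero]
  rw [mul_left_comm, mul_left_comm (p.2.1 j + w j)]
  congr 1
  refine mul_prod_eq_of_forall_ne j (fun i hi => by simp [hi]) ?_
  simpa using legFactor_add_one h1 h2 h3

theorem mbIntegrand_leg_add_one_shift {p : ℂ × (ι → ℂ) × (ι → ℂ)} {w : ι → ℂ}
    (j : ι) (h1 : p.2.1 j ≠ 0) (h2 : p.2.1 j - p.2.2 j ≠ 0) (h3 : w j ≠ 0)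
    (h4 : -p.2.2 j - w j ≠ 0) :
    p.2.1 j * (p.2.1 j - p.2.2 j) *
        mbIntegrand (p + (1, Pi.single j 1, 0)) (w - Pi.single j 1)
      = w j * (w j + p.2.2 j) * mbIntegrand p w := by
  simp only [mbIntegrand, Prod.fst_add, Prod.snd_add, add_zero]
  rw [mul_left_comm, mul_left_comm (w j * _), sum_sub_single, add_add_sub_cancel]
  congr 1
  refine mul_prod_eq_of_forall_ne j (fun i hi => by simp [hi]) ?_
  simpa using legFactor_add_one_shift h1 h2 h3 h4

theorem sum_sub_single_real (κ : ι → ℝ) (j : ι) :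
    ∑ i, (κ - Pi.single j 1 : ι → ℝ) i = ∑ i, κ i - 1 := by
  simp [Finset.sum_sub_distrib]

/-- For j outside T the contour moves left by one together with the raised a_j and c_j. The shifted
vertex is thus integrated over the same y, and no pole is crossed. -/
theorem Admissible.legShift {p : ℂ × (ι → ℂ) × (ι → ℂ)} {κ : ι → ℝ} (h : Admissible p κ)
    (T : Finset ι) (j : ι) :
    Admissible (p + legShift T j) (if j ∈ T then κ else κ - Pi.single j 1) := by
  by_cases hj : j ∈ T
  · simp only [WittenTree.legShift, if_pos hj]
    refine ⟨by simpa using h.1, fun i => ?_⟩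
    obtain ⟨h1, h2, h3⟩ := h.2 i
    refine ⟨h1, ?_, by simpa using h3⟩
    by_cases hi : i = j
    · subst hi; simp; linarith
    · simpa [hi] using h2
  · simp only [WittenTree.legShift, if_neg hj]
    refine ⟨?_, fun i => ?_⟩
    · rw [sum_sub_single_real]
      simp only [Prod.fst_add, Complex.add_re, Complex.one_re]
      linarith [h.1]
    · obtain ⟨h1, h2, h3⟩ := h.2 i
      by_cases hi : i = j
      · subst hi
        simp
        exact ⟨by linarith, by linarith, by linarith⟩
      · simpa [hi] using h.2 i

theorem Admissible.leg_add_one {p : ℂ × (ι → ℂ) × (ι → ℂ)} {κ : ι → ℝ} (h : Admissible p κ)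
    (j : ι) : Admissible (p + (0, Pi.single j 1, 0)) κ := by
  refine ⟨by simpa using h.1, fun i => ?_⟩
  obtain ⟨h1, h2, h3⟩ := h.2 i
  refine ⟨h1, by simpa using h2, ?_⟩
  by_cases hi : i = j
  · subst hi; simp; linarith
  · simpa [hi] using h3

theorem Admissible.leg_add_one_shift {p : ℂ × (ι → ℂ) × (ι → ℂ)} {κ : ι → ℝ}
    (h : Admissible p κ) (j : ι) :
    Admissible (p + (1, Pi.single j 1, 0)) (κ - Pi.single j 1) := by
  refine ⟨?_, fun i => ?_⟩
  · rw [sum_sub_single_real]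
    simp only [Prod.fst_add, Complex.add_re, Complex.one_re]
    linarith [h.1]
  · obtain ⟨h1, h2, h3⟩ := h.2 i
    by_cases hi : i = j
    · subst hi
      simp
      exact ⟨by linarith, by linarith, by linarith⟩
    · simpa [hi] using h.2 i

/-- The relation that continues a vertex across the wall `T`. -/
theorem wall_mul_baseVertex (T : Finset ι) {p : ℂ × (ι → ℂ) × (ι → ℂ)}
    (hp : p ∈ wallDomain (ι := ι) 0) :
    wall T p * baseVertex p = baseVertex (p + (1, 0, 0)) +
      ∑ j, legCoeff T j p * baseVertex (p + legShift T j) := by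
  obtain ⟨κ, h⟩ := exists_admissible hp
  rw [← integral_mbIntegrand h, ← integral_mbIntegrand h.add_one]
  simp only [← integral_mbIntegrand (h.legShift T _)]
  simp only [mul_left_comm _ (((2 * Real.pi)⁻¹ ^ Fintype.card ι : ℝ) : ℂ)]
  rw [← Finset.mul_sum, ← mul_add]
  congr 1
  simp only [← integral_const_mul]
  rw [← integral_finsetSum _ fun j _ => (integrable_mbIntegrand (h.legShift T j)).const_mul _,
    ← integral_add (integrable_mbIntegrand h.add_one) (integrable_finsetSum _ fun j _ =>
      (integrable_mbIntegrand (h.legShift T j)).const_mul _)]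
  refine integral_congr_ae (ae_of_all _ fun y => ?_)
  obtain ⟨hA, hl⟩ := h.re_facts y
  set w := verticalPoint κ y with hw
  have h1 : ∀ j, legCoeff T j p * mbIntegrand (p + legShift T j)
      (verticalPoint (if j ∈ T then κ else κ - Pi.single j 1) y)
      = (-w j - if j ∈ T then p.2.2 j else 0) * mbIntegrand p w := by
    intro j
    obtain ⟨h1, h2, h3, h4, -⟩ := hl j
    by_cases hj : j ∈ T
    · rw [if_pos hj, legCoeff_mul_mbIntegrand_of_mem hj h2 h4, if_pos hj]
      ring
    · rw [if_neg hj, verticalPoint_sub_single, legCoeff_mul_mbIntegrand_of_notMem hj h1 h3,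
        if_neg hj, sub_zero]
  simp only [h1]
  -- The polynomial identity behind the relation is (A + ∑ w_j) + ∑_{j ∈ T} (-c_j - w_j) + ∑_{j ∉ T}
  -- (-w_j) = A - ∑_T c_j, in which w cancels.
  rw [mbIntegrand_add_one hA, ← Finset.sum_mul, ← add_mul, Finset.sum_sub_distrib,
    Finset.sum_neg_distrib, Finset.sum_ite_mem, Finset.univ_inter, wall]
  ring

/-- The relation that continues a vertex in the parameter `a` of the leg `j`. -/
theorem baseVertex_leg_relation (j : ι) {p : ℂ × (ι → ℂ) × (ι → ℂ)}
    (hp : p ∈ wallDomain (ι := ι) 0) :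
    baseVertex p = (2 * p.2.1 j + 1 - p.2.2 j) * baseVertex (p + (0, Pi.single j 1, 0))
      + baseVertex (p + (1, Pi.single j 1, 0))
      - (p.2.1 j + 1) * (p.2.1 j + 1 - p.2.2 j) *
        baseVertex (p + (0, Pi.single j 1, 0) + (0, Pi.single j 1, 0)) := by
  obtain ⟨κ, h⟩ := exists_admissible hp
  have h1 := h.leg_add_one j
  have h2 := h.leg_add_one_shift j
  have h3 := h1.leg_add_one j
  rw [← integral_mbIntegrand h, ← integral_mbIntegrand h1, ← integral_mbIntegrand h2,
    ← integral_mbIntegrand h3]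
  simp only [mul_left_comm _ (((2 * Real.pi)⁻¹ ^ Fintype.card ι : ℝ) : ℂ)]
  rw [← mul_add, ← mul_sub]
  congr 1
  simp only [← integral_const_mul]
  have hi : Integrable fun y => (2 * p.2.1 j + 1 - p.2.2 j) *
      mbIntegrand (p + (0, Pi.single j 1, 0)) (verticalPoint κ y) +
        mbIntegrand (p + (1, Pi.single j 1, 0)) (verticalPoint (κ - Pi.single j 1) y) :=
    ((integrable_mbIntegrand h1).const_mul _).add (integrable_mbIntegrand h2)
  rw [← integral_add ((integrable_mbIntegrand h1).const_mul _) (integrable_mbIntegrand h2),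
    ← integral_sub hi ((integrable_mbIntegrand h3).const_mul _)]
  refine integral_congr_ae (ae_of_all _ fun y => ?_)
  obtain ⟨-, hl⟩ := h.re_facts y
  obtain ⟨n1, n2, n3, n4, n5, n6, n7, n8⟩ := hl j
  have e1 := mbIntegrand_leg_add_one j n1 n2 n5
  have e2 := mbIntegrand_leg_add_one_shift j n1 n2 n3 n4
  have e3 := mbIntegrand_leg_add_one (p := p + (0, Pi.single j 1, 0)) (w := verticalPoint κ y) j
    (by simpa using n6) (by simpa using n7) (by simpa using n8)
  simp only [Prod.snd_add, Prod.fst_add, Pi.add_apply, Pi.single_eq_same, Pi.zero_apply,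
    add_zero] at e3
  rw [← verticalPoint_sub_single] at e2
  -- After multiplication by a (a - c), the claim for the integrands is (2a + 1 - c)(a + w) + w (w +
  -- c) - (a + 1 + w)(a + w) = a (a - c).
  refine mul_left_cancel₀ (mul_ne_zero n1 n2) ?_
  simp only
  linear_combination (-(2 * p.2.1 j + 1 - p.2.2 j) + (p.2.1 j + 1 + verticalPoint κ y j)) * e1
    - e2 + p.2.1 j * (p.2.1 j - p.2.2 j) * e3

end MellinBarnes

/-! ### How the shifts of the relations move the domains of continuation. -/

section Shifts

variable {ι : Type}

/-- Shifts by natural numbers improve the bounds on real parts, and they never move a wall function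
onto a nonpositive integer if it was not at one before. -/
theorem mem_wallDomain_of_shift {k k' : Finset ι ⊕ ι → ℕ} {p v : ℂ × (ι → ℂ) × (ι → ℂ)}
    (hp : p ∈ wallDomain k')
    (h1 : ∀ T, ∃ m : ℕ, wall T (p + v) = wall T p + m ∧ k' (Sum.inl T) ≤ k (Sum.inl T) + m)
    (h2 : ∀ j, ∃ m m' : ℕ, v.2.1 j = m ∧ v.2.1 j - v.2.2 j = m' ∧
      k' (Sum.inr j) ≤ k (Sum.inr j) + m ∧ k' (Sum.inr j) ≤ k (Sum.inr j) + m') :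
    p + v ∈ wallDomain k := by
  refine ⟨fun T => ?_, fun j => ?_⟩
  · obtain ⟨m, hm, hk⟩ := h1 T
    obtain ⟨h3, h4⟩ := hp.1 T
    have hk' : (k' (Sum.inl T) : ℝ) ≤ k (Sum.inl T) + m := by exact_mod_cast hk
    refine ⟨?_, fun n hn => h4 (n + m) ?_⟩
    · rw [hm, Complex.add_re, Complex.natCast_re]; linarith
    · rw [hm] at hn
      push_cast
      linear_combination hn
  · obtain ⟨m, m', hm, hm', hk, hk1⟩ := h2 j
    obtain ⟨h3, h4⟩ := hp.2 j
    have hk' : (k' (Sum.inr j) : ℝ) ≤ k (Sum.inr j) + m := by exact_mod_cast hk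
    have hk1' : (k' (Sum.inr j) : ℝ) ≤ k (Sum.inr j) + m' := by exact_mod_cast hk1
    constructor
    · rw [Prod.snd_add, Prod.fst_add, Pi.add_apply, hm, Complex.add_re, Complex.natCast_re]
      linarith
    · rw [Prod.snd_add, Prod.fst_add, Prod.snd_add, Pi.add_apply, Pi.add_apply,
        add_sub_add_comm, hm', Complex.add_re, Complex.natCast_re]
      linarith

theorem wallDomain_mono : Monotone (wallDomain (ι := ι)) := by
  intro k k' hk p hp
  have := mem_wallDomain_of_shift (k := k') (v := 0) hp (fun T => ⟨0, by simp, by simpa using hk _⟩)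
    fun j => ⟨0, 0, by simp, by simp, by simpa using hk _, by simpa using hk _⟩
  simpa using this

theorem wall_add (T : Finset ι) (p v : ℂ × (ι → ℂ) × (ι → ℂ)) :
    wall T (p + v) = wall T p + wall T v := by
  simp only [wall, Prod.fst_add, Prod.snd_add, Pi.add_apply, Finset.sum_add_distrib]
  ring

variable [DecidableEq ι]

/-- For S = T every leg term gains a full unit, which is the progress of the continuation; for the
other walls nothing is lost. -/
theorem wall_legShift (S T : Finset ι) (j : ι) :
    wall S (legShift T j) = if (j ∈ T ↔ j ∈ S) then 1 else 0 := by
  by_cases hT : j ∈ T <;> by_cases hS : j ∈ S <;>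
    simp [wall, legShift, hT, hS]

variable {k : Finset ι ⊕ ι → ℕ} {p : ℂ × (ι → ℂ) × (ι → ℂ)}

theorem add_one_mem_wallDomain {T : Finset ι}
    (hp : p ∈ wallDomain (k + Pi.single (Sum.inl T) 1)) : p + (1, 0, 0) ∈ wallDomain k := by
  refine mem_wallDomain_of_shift hp (fun S => ⟨1, by simp [wall]; ring, ?_⟩)
    fun j => ⟨0, 0, by simp, by simp, by simp, by simp⟩
  rw [Pi.add_apply]
  gcongr
  rw [Pi.single_apply]
  split_ifs <;> simp

theorem legShift_mem_wallDomain {T : Finset ι} (j : ι)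
    (hp : p ∈ wallDomain (k + Pi.single (Sum.inl T) 1)) : p + legShift T j ∈ wallDomain k := by
  refine mem_wallDomain_of_shift hp (fun S => ⟨if (j ∈ T ↔ j ∈ S) then 1 else 0, ?_, ?_⟩)
    fun i => ⟨if j ∉ T ∧ i = j then 1 else 0, if j ∈ T ∧ i = j then 1 else 0, ?_, ?_,
      by simp, by simp⟩
  · rw [wall_add, wall_legShift]; split_ifs <;> simp
  · rw [Pi.add_apply]
    gcongr
    by_cases hS : S = T
    · subst hS; simp
    · simp [hS]
  · by_cases hT : j ∈ T <;> by_cases hi : i = j <;> simp [legShift, hT, hi]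
  · by_cases hT : j ∈ T <;> by_cases hi : i = j <;> simp [legShift, hT, hi]

theorem leg_add_one_mem_wallDomain {j : ι}
    (hp : p ∈ wallDomain (k + Pi.single (Sum.inr j) 1)) :
    p + (0, Pi.single j 1, 0) ∈ wallDomain k := by
  refine mem_wallDomain_of_shift hp (fun S => ⟨0, by simp [wall], by simp⟩)
    fun i => ⟨if i = j then 1 else 0, if i = j then 1 else 0, ?_, ?_, ?_, ?_⟩ <;>
  by_cases hi : i = j <;> simp [hi]

theorem leg_add_one_shift_mem_wallDomain {j : ι}
    (hp : p ∈ wallDomain (k + Pi.single (Sum.inr j) 1)) :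
    p + (1, Pi.single j 1, 0) ∈ wallDomain k := by
  refine mem_wallDomain_of_shift hp (fun S => ⟨1, by simp [wall]; ring, by simp⟩)
    fun i => ⟨if i = j then 1 else 0, if i = j then 1 else 0, ?_, ?_, ?_, ?_⟩ <;>
  by_cases hi : i = j <;> simp [hi]

theorem leg_add_two_mem_wallDomain {j : ι}
    (hp : p ∈ wallDomain (k + Pi.single (Sum.inr j) 1)) :
    p + (0, Pi.single j 1, 0) + (0, Pi.single j 1, 0) ∈ wallDomain k := by
  rw [add_assoc]
  refine mem_wallDomain_of_shift hp (fun S => ⟨0, by simp [wall], by simp⟩)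
    fun i => ⟨if i = j then 2 else 0, if i = j then 2 else 0, ?_, ?_, ?_, ?_⟩ <;>
  by_cases hi : i = j <;> simp [hi] <;> norm_num

end Shifts

/-! ### Existence of the continuation to the complement of the walls. -/

section VertexContinuation

variable {ι : Type} [Fintype ι]

/-- The parameters at which a vertex is analytic. -/
def regularSet (ι : Type) : Set (ℂ × (ι → ℂ) × (ι → ℂ)) :=
  {p | ∀ (T : Finset ι) (n : ℕ), wall T p ≠ -n}

/-- The bounds on real parts hold for large n at any given point, so in the union only the avoidance
of the walls survives. -/
theorem iUnion_wallDomain :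
    (⋃ n : ℕ, wallDomain (ι := ι) fun _ => n) = regularSet ι := by
  classical
  ext p
  rw [Set.mem_iUnion]
  constructor
  · rintro ⟨n, hn⟩ T
    exact (hn.1 T).2
  · intro hp
    obtain ⟨n, hn⟩ := exists_nat_gt ((∑ T, ‖wall T p‖) + ∑ j, (‖p.2.1 j‖ + ‖p.2.1 j - p.2.2 j‖))
    have h1 : ∀ T, ‖wall T p‖ ≤ ∑ T, ‖wall T p‖ := fun T =>
      Finset.single_le_sum (f := fun T => ‖wall T p‖) (fun _ _ => norm_nonneg _)
        (Finset.mem_univ T)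
    have h2 : ∀ j, ‖p.2.1 j‖ + ‖p.2.1 j - p.2.2 j‖
        ≤ ∑ j, (‖p.2.1 j‖ + ‖p.2.1 j - p.2.2 j‖) := fun j =>
      Finset.single_le_sum (f := fun j => ‖p.2.1 j‖ + ‖p.2.1 j - p.2.2 j‖)
        (fun _ _ => by positivity) (Finset.mem_univ j)
    have h3 : 0 ≤ ∑ T, ‖wall T p‖ := Finset.sum_nonneg fun _ _ => norm_nonneg _
    have h4 : 0 ≤ ∑ j, (‖p.2.1 j‖ + ‖p.2.1 j - p.2.2 j‖) :=
      Finset.sum_nonneg fun _ _ => by positivity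
    have key : ∀ z : ℂ, ‖z‖ < n → -(n : ℝ) < z.re := fun z hz => by
      have := neg_abs_le z.re
      have := Complex.abs_re_le_norm z
      linarith
    refine ⟨n, fun T => ⟨key _ ?_, hp T⟩, fun j => ⟨key _ ?_, key _ ?_⟩⟩
    · linarith [h1 T]
    · linarith [h2 j, norm_nonneg (p.2.1 j - p.2.2 j)]
    · linarith [h2 j, norm_nonneg (p.2.1 j)]

variable [DecidableEq ι]

/-- The operators of the continuation of a vertex. -/
def continuationStep : Finset ι ⊕ ι → (ℂ × (ι → ℂ) × (ι → ℂ) → ℂ) → ℂ × (ι → ℂ) × (ι → ℂ) → ℂ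
  | Sum.inl T, f, p =>
    (f (p + (1, 0, 0)) + ∑ j, legCoeff T j p * f (p + legShift T j)) / wall T p
  | Sum.inr j, f, p =>
    (2 * p.2.1 j + 1 - p.2.2 j) * f (p + (0, Pi.single j 1, 0)) + f (p + (1, Pi.single j 1, 0))
      - (p.2.1 j + 1) * (p.2.1 j + 1 - p.2.2 j) *
        f (p + (0, Pi.single j 1, 0) + (0, Pi.single j 1, 0))

theorem analyticAt_comp_add_right {E : Type*} [NormedAddCommGroup E] [NormedSpace ℂ E]
    {f : E → ℂ} {p v : E} (hf : AnalyticAt ℂ f (p + v)) : AnalyticAt ℂ (fun q => f (q + v)) p :=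
  hf.comp (f := fun q => q + v) (analyticAt_id.add analyticAt_const)

theorem analyticAt_legCoeff (T : Finset ι) (j : ι) (p : ℂ × (ι → ℂ) × (ι → ℂ)) :
    AnalyticAt ℂ (legCoeff T j) p := by
  by_cases hj : j ∈ T
  · simp only [funext fun p => show legCoeff T j p = p.2.1 j - p.2.2 j from if_pos hj]
    exact (analyticAt_param_a j p).sub (analyticAt_param_c j p)
  · simp only [funext fun p => show legCoeff T j p = p.2.1 j from if_neg hj]
    exact analyticAt_param_a j p

theorem analyticAt_continuationStep_leg {f : ℂ × (ι → ℂ) × (ι → ℂ) → ℂ} {j : ι}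
    {p : ℂ × (ι → ℂ) × (ι → ℂ)} (h1 : AnalyticAt ℂ f (p + (0, Pi.single j 1, 0)))
    (h2 : AnalyticAt ℂ f (p + (1, Pi.single j 1, 0)))
    (h3 : AnalyticAt ℂ f (p + (0, Pi.single j 1, 0) + (0, Pi.single j 1, 0))) :
    AnalyticAt ℂ (continuationStep (Sum.inr j) f) p := by
  have ha := analyticAt_param_a j p
  have hc := analyticAt_param_c j p
  have h3' : AnalyticAt ℂ
      (fun q => f (q + (0, Pi.single j 1, 0) + (0, Pi.single j 1, 0))) p := by
    simp only [add_assoc] at h3 ⊢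
    exact analyticAt_comp_add_right h3
  exact ((((analyticAt_const.mul ha).add analyticAt_const).sub hc).mul (analyticAt_comp_add_right h1)).add
    (analyticAt_comp_add_right h2) |>.sub (((ha.add analyticAt_const).mul
      ((ha.add analyticAt_const).sub hc)).mul h3')

theorem analyticAt_continuationStep_wall {f : ℂ × (ι → ℂ) × (ι → ℂ) → ℂ} {T : Finset ι}
    {p : ℂ × (ι → ℂ) × (ι → ℂ)} (h1 : AnalyticAt ℂ f (p + (1, 0, 0)))
    (h2 : ∀ j, AnalyticAt ℂ f (p + legShift T j)) (h3 : wall T p ≠ 0) :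
    AnalyticAt ℂ (continuationStep (Sum.inl T) f) p :=
  ((analyticAt_comp_add_right h1).add (Finset.analyticAt_fun_sum _ fun j _ =>
    (analyticAt_legCoeff T j p).mul (analyticAt_comp_add_right (h2 j)))).div (analyticAt_wall T p) h3

/-- Only wall relations divide, and only by the wall function itself; the leg relations are
polynomial. Hence a and a - c contribute no singularities. -/
theorem exists_vertex_continuation :
    ∃ F : ℂ × (ι → ℂ) × (ι → ℂ) → ℂ, AnalyticOnNhd ℂ F (regularSet ι) ∧
      Set.EqOn F baseVertex (wallDomain (ι := ι) 0) := by
  rw [← iUnion_wallDomain]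
  refine exists_analytic_continuation wallDomain wallDomain_mono isOpen_wallDomain
    continuationStep baseVertex analyticOnNhd_baseVertex ?_ ?_ ?_
  · rintro (T | j) k f hf p hp
    · refine analyticAt_continuationStep_wall (hf _ (add_one_mem_wallDomain hp))
        (fun j => hf _ (legShift_mem_wallDomain j hp)) fun h0 => (hp.1 T).2 0 (by simpa using h0)
    · exact analyticAt_continuationStep_leg (hf _ (leg_add_one_mem_wallDomain hp))
        (hf _ (leg_add_one_shift_mem_wallDomain hp)) (hf _ (leg_add_two_mem_wallDomain hp))
  · rintro (T | j) k f g hfg p hp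
    · simp only [continuationStep]
      rw [hfg (add_one_mem_wallDomain hp), Finset.sum_congr rfl fun j _ => by
        rw [hfg (legShift_mem_wallDomain j hp)]]
    · simp only [continuationStep]
      rw [hfg (leg_add_one_mem_wallDomain hp), hfg (leg_add_one_shift_mem_wallDomain hp),
        hfg (leg_add_two_mem_wallDomain hp)]
  · rintro (T | j) p hp
    · have h0 : wall T p ≠ 0 := fun h0 => (hp.1 T).2 0 (by simpa using h0)
      simp only [continuationStep]
      rw [← wall_mul_baseVertex T hp, mul_div_cancel_left₀ _ h0]
    · exact (baseVertex_leg_relation j hp).symm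

theorem isPreconnected_regularSet {ι : Type} [Fintype ι] : IsPreconnected (regularSet ι) := by
  have h := isPreconnected_setOf_forall_affine_ne_zero (E := ℂ × (ι → ℂ) × (ι → ℂ))
    (κ := Finset ι × ℕ)
    (fun i => { toFun := wall i.1
                map_add' := wall_add i.1
                map_smul' := fun z p => by
                  change z * p.1 - ∑ j ∈ i.1, z * p.2.2 j = z * (p.1 - ∑ j ∈ i.1, p.2.2 j)
                  rw [mul_sub, Finset.mul_sum] }) fun i => i.2
  have h2 : regularSet ι = {p | ∀ i : Finset ι × ℕ, wall i.1 p + (i.2 : ℂ) ≠ 0} := by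
    ext p
    simp only [regularSet, Set.mem_ofPred_eq, Prod.forall, ne_eq, eq_neg_iff_add_eq_zero]
  rw [h2]
  exact h

/-- A point with contours Re w_j = -1 at which the identity theorem can start. -/
theorem basePoint_mem (ι : Type) [Fintype ι] :
    ((Fintype.card ι + 1 : ℂ), (fun _ => 2 : ι → ℂ), (fun _ => 0 : ι → ℂ))
      ∈ wallDomain (ι := ι) 0 := by
  refine Admissible.mem_wallDomain (κ := fun _ => -1) ⟨by simp, fun j => by simp⟩

theorem wallDomain_zero_subset {ι : Type} : wallDomain (ι := ι) 0 ⊆ regularSet ι :=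
  fun _ hp T n => (hp.1 T).2 n

end VertexContinuation

/-! ### Return to the variables (D, c, s); uniqueness. -/

section VertexRule

variable {ι : Type} [Fintype ι]

/-- The parameters `(A, a, c)` as functions of `(D, c, s)`. -/
def vertexParam (h : ℂ) (p : ℂ × (ι → ℂ) × (ι → ℂ)) : ℂ × (ι → ℂ) × (ι → ℂ) :=
  ((p.1 + ((Fintype.card ι : ℂ) - 2) * h + ∑ j, p.2.1 j) / 2,
    fun j => (h + p.2.1 j - p.2.2 j) / 2, p.2.1)

theorem vertexIntegrand_eq (h D : ℂ) (c s w : ι → ℂ) :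
    vertexIntegrand h D c s w = mbIntegrand (vertexParam h (D, c, s)) w := by
  have h1 : vertexArg h D c w = (vertexParam h (D, c, s)).1 + ∑ j, w j := by
    simp only [vertexArg, vertexParam, Finset.sum_add_distrib, ← Finset.mul_sum]
    ring
  rw [vertexIntegrand, mbIntegrand, h1]
  congr 1
  refine Finset.prod_congr rfl fun j _ => ?_
  simp only [legFactor, vertexParam]
  rw [show (h + c j - s j) / 2 - c j = (h - c j - s j) / 2 by ring]

theorem separates_iff_admissible (h D : ℂ) (c s : ι → ℂ) (κ : ι → ℝ) :
    Separates h D c s κ ↔ Admissible (vertexParam h (D, c, s)) κ := by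
  have h1 : vertexArg h D c (fun a => (κ a : ℂ))
      = (vertexParam h (D, c, s)).1 + ((∑ j, κ j : ℝ) : ℂ) := by
    simp only [vertexArg, vertexParam, Finset.sum_add_distrib, ← Finset.mul_sum]
    push_cast
    ring
  rw [Separates, Admissible, h1, Complex.add_re, Complex.ofReal_re]
  refine and_congr Iff.rfl (forall_congr' fun j => ?_)
  simp only [vertexParam, Complex.neg_re, Complex.ofReal_re, Complex.sub_re, Complex.add_re]
  constructor
  · rintro ⟨h1, h2, h3⟩
    exact ⟨by linarith, by linarith, by linarith⟩
  · rintro ⟨h1, h2, h3⟩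
    exact ⟨by linarith, by linarith, by linarith⟩

theorem vertexIntegral_eq_baseVertex {h D : ℂ} {c s : ι → ℂ} {κ : ι → ℝ}
    (hs : Separates h D c s κ) :
    vertexIntegral h D c s κ = baseVertex (vertexParam h (D, c, s)) := by
  rw [← integral_mbIntegrand ((separates_iff_admissible h D c s κ).mp hs), ← integral_const_mul]
  simp only [vertexIntegral, vertexIntegrand_eq]
  rfl

/-- A contains all c_j / 2 with a plus sign, and subtracting c_j for j in T reverses exactly those
signs. -/
theorem two_mul_wall_vertexParam (h : ℂ) (p : ℂ × (ι → ℂ) × (ι → ℂ)) (T : Finset ι)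
    (σ : ι → ℤˣ) (hσ : ∀ j, j ∈ T ↔ σ j = -1) :
    2 * wall T (vertexParam h p)
      = p.1 + ((Fintype.card ι : ℂ) - 2) * h + ∑ j, (((σ j : ℤˣ) : ℤ) : ℂ) * p.2.1 j := by
  classical
  have h1 : ∑ j ∈ T, p.2.1 j = ∑ j, if j ∈ T then p.2.1 j else 0 := by simp
  have h2 : ∑ j, (((σ j : ℤˣ) : ℤ) : ℂ) * p.2.1 j
      = ∑ j, p.2.1 j - 2 * ∑ j, if j ∈ T then p.2.1 j else 0 := by
    rw [Finset.mul_sum, ← Finset.sum_sub_distrib]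
    refine Finset.sum_congr rfl fun j _ => ?_
    rcases Int.units_eq_one_or (σ j) with hj | hj
    · have : j ∉ T := fun hT => by rw [hσ, hj] at hT; exact absurd hT (by decide)
      simp [hj, this]
    · have : j ∈ T := (hσ j).mpr hj
      simp [hj, this]
      ring
  simp only [wall, vertexParam]
  rw [h1, h2]
  ring

theorem mem_vertexRegular_iff (h : ℂ) (p : ℂ × (ι → ℂ) × (ι → ℂ)) :
    p ∈ vertexRegular ι h ↔ vertexParam h p ∈ regularSet ι := by
  classical
  constructor
  · intro hp T n hn
    have h1 := two_mul_wall_vertexParam h p T (fun j => if j ∈ T then -1 else 1) fun j => by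
      by_cases hj : j ∈ T <;> simp [hj]
    refine hp _ n (h1.symm.trans ?_)
    rw [hn]; ring
  · intro hp σ k hk
    have h1 := two_mul_wall_vertexParam h p (Finset.univ.filter fun j => σ j = -1) σ (by simp)
    refine hp _ k (mul_left_cancel₀ (two_ne_zero : (2 : ℂ) ≠ 0) (h1.trans (hk.trans ?_)))
    ring

theorem analyticAt_vertexParam (h : ℂ) (p : ℂ × (ι → ℂ) × (ι → ℂ)) :
    AnalyticAt ℂ (vertexParam (ι := ι) h) p := by
  have hD : AnalyticAt ℂ (fun p : ℂ × (ι → ℂ) × (ι → ℂ) => p.1) p := analyticAt_fst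
  have hc := fun j => analyticAt_param_a j p
  have hs := fun j => analyticAt_param_c j p
  refine AnalyticAt.prod ?_ (AnalyticAt.prod (AnalyticAt.pi fun j => ?_)
    (AnalyticAt.pi fun j => hc j))
  · exact ((hD.add analyticAt_const).add (Finset.analyticAt_fun_sum _ fun j _ => hc j)).div
      analyticAt_const two_ne_zero
  · exact ((analyticAt_const.add (hc j)).sub (hs j)).div analyticAt_const two_ne_zero

theorem IsVertexFactor.eqOn {h : ℂ} {F G : ℂ × (ι → ℂ) × (ι → ℂ) → ℂ}
    (hF : IsVertexFactor h F) (hG : IsVertexFactor h G) :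
    Set.EqOn F G (vertexRegular ι h) := by
  -- The preimage of the base point A = r + 1, a = 2, c = 0. Near it the fixed contours Re w_j = -1
  -- stay separating, so both candidates equal the same integral on an open set.
  let p₀ : ℂ × (ι → ℂ) × (ι → ℂ) :=
    (2 * Fintype.card ι + 2 - ((Fintype.card ι : ℂ) - 2) * h, fun _ => 0, fun _ => h - 4)
  have hparam : vertexParam h p₀
      = ((Fintype.card ι + 1 : ℂ), (fun _ => 2 : ι → ℂ), (fun _ => 0 : ι → ℂ)) := by
    simp only [vertexParam, p₀, Finset.sum_const_zero]
    refine Prod.ext ?_ (Prod.ext ?_ rfl)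
    · change (2 * (Fintype.card ι : ℂ) + 2 - ((Fintype.card ι : ℂ) - 2) * h +
        ((Fintype.card ι : ℂ) - 2) * h + 0) / 2 = Fintype.card ι + 1
      ring
    · funext j
      change (h + 0 - (h - 4)) / 2 = 2
      ring
  have hmem : p₀ ∈ vertexRegular ι h := by
    rw [mem_vertexRegular_iff, hparam]
    exact wallDomain_zero_subset (basePoint_mem ι)
  have hconn : IsPreconnected (vertexRegular ι h) := by
    let L : (ι → ℤˣ) → (ℂ × (ι → ℂ) × (ι → ℂ)) →ₗ[ℂ] ℂ := fun σ =>
      LinearMap.fst ℂ ℂ _ + ∑ j, (((σ j : ℤˣ) : ℤ) : ℂ) • ((LinearMap.proj j).comp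
        ((LinearMap.fst ℂ (ι → ℂ) (ι → ℂ)).comp (LinearMap.snd ℂ ℂ _)))
    have hL : ∀ σ p, L σ p = p.1 + ∑ j, (((σ j : ℤˣ) : ℤ) : ℂ) * p.2.1 j := fun σ p => by
      simp [L]
    have h1 := isPreconnected_setOf_forall_affine_ne_zero
      (fun i : (ι → ℤˣ) × ℕ => L i.1) fun i => ((Fintype.card ι : ℂ) - 2) * h + 2 * i.2
    have h2 : vertexRegular ι h = {p | ∀ i : (ι → ℤˣ) × ℕ,
        L i.1 p + (((Fintype.card ι : ℂ) - 2) * h + 2 * i.2) ≠ 0} := by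
      ext p
      simp only [vertexRegular, Set.mem_ofPred_eq, Prod.forall, hL]
      refine forall_congr' fun σ => forall_congr' fun k => not_congr ?_
      constructor <;> intro hk <;> linear_combination hk
    rw [h2]
    exact h1
  refine hF.1.eqOn_of_preconnected_of_eventuallyEq hG.1 hconn hmem ?_
  have hopen : ∀ᶠ p in 𝓝 p₀, Admissible (vertexParam h p) fun _ => -1 := by
    have hc : ContinuousAt (vertexParam (ι := ι) h) p₀ := (analyticAt_vertexParam h p₀).continuousAt
    refine hc.eventually (p := fun q => Admissible q fun _ => -1) ?_
    rw [hparam]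
    have hU : IsOpen {q : ℂ × (ι → ℂ) × (ι → ℂ) | Admissible q fun _ => -1} := by
      have e : {q : ℂ × (ι → ℂ) × (ι → ℂ) | Admissible q fun _ => -1}
          = {q | 0 < q.1.re + ∑ _j : ι, (-1 : ℝ)} ∩ ⋂ j, ({q | (q.2.2 j).re < 1} ∩
            {q | 1 < (q.2.1 j).re}) := by
        ext q
        simp [Admissible]
      rw [e]
      refine IsOpen.inter (isOpen_lt continuous_const (by fun_prop))
        (isOpen_iInter_of_finite fun j => IsOpen.inter ?_ ?_)
      · exact isOpen_lt (by fun_prop) continuous_const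
      · exact isOpen_lt continuous_const (by fun_prop)
    exact hU.mem_nhds ⟨by simp, fun j => by simp⟩
  filter_upwards [hopen] with p hp
  have hs := (separates_iff_admissible h p.1 p.2.1 p.2.2 fun _ => -1).mpr hp
  rw [show p = (p.1, p.2.1, p.2.2) from rfl, hF.2 _ _ _ _ hs, hG.2 _ _ _ _ hs]

theorem isVertexFactor_comp_vertexParam {F : ℂ × (ι → ℂ) × (ι → ℂ) → ℂ}
    (hF : AnalyticOnNhd ℂ F (regularSet ι))
    (hF0 : Set.EqOn F baseVertex (wallDomain (ι := ι) 0)) (h : ℂ) :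
    IsVertexFactor h fun p => F (vertexParam h p) := by
  refine ⟨fun p hp => ?_, fun D c s κ hs => ?_⟩
  · exact (hF _ ((mem_vertexRegular_iff h p).mp hp)).comp (f := vertexParam h)
      (analyticAt_vertexParam h p)
  · rw [vertexIntegral_eq_baseVertex hs]
    exact hF0 ((separates_iff_admissible h D c s κ).mp hs).mem_wallDomain

theorem isVertexFactor_vertexFactor (h : ℂ) : IsVertexFactor h (vertexFactor (ι := ι) h) := by
  classical
  obtain ⟨F, hF, hF0⟩ := exists_vertex_continuation (ι := ι)
  have hex : ∃ F : ℂ × (ι → ℂ) × (ι → ℂ) → ℂ, IsVertexFactor h F :=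
    ⟨_, isVertexFactor_comp_vertexParam hF hF0 h⟩
  rw [vertexFactor, dif_pos hex]
  exact hex.choose_spec

theorem vertexFactor_eq {F : ℂ × (ι → ℂ) × (ι → ℂ) → ℂ}
    (hF : AnalyticOnNhd ℂ F (regularSet ι))
    (hF0 : Set.EqOn F baseVertex (wallDomain (ι := ι) 0)) {h : ℂ}
    {p : ℂ × (ι → ℂ) × (ι → ℂ)} (hp : p ∈ vertexRegular ι h) :
    vertexFactor h p = F (vertexParam h p) :=
  (isVertexFactor_vertexFactor h).eqOn (isVertexFactor_comp_vertexParam hF hF0 h) hp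

end VertexRule

/-! ### Descent in a, and the value of a vertex at a = 0. -/

section Evaluation

theorem tendsto_exp_mul_one_add_cpow {c : ℂ} (hc : c.re < 0) {t : ℝ} (ht : 0 < t) :
    Tendsto (fun x : ℝ => -(Complex.exp (-(t * x)) * (1 + x : ℂ) ^ c)) atTop (𝓝 0) := by
  rw [← neg_zero]
  refine Tendsto.neg (squeeze_zero_norm' (a := fun x : ℝ => Real.exp (-(t * x))) ?_ ?_)
  · filter_upwards [eventually_ge_atTop 0] with x hx
    rw [norm_mul, norm_cexp_neg_mul, show (1 + x : ℂ) = ((1 + x : ℝ) : ℂ) by push_cast; ring,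
      Complex.norm_cpow_eq_rpow_re_of_pos (by positivity)]
    exact mul_le_of_le_one_right (Real.exp_pos _).le
      (Real.rpow_le_one_of_one_le_of_nonpos (by linarith) hc.le)
  · exact Real.tendsto_exp_neg_atTop_nhds_zero.comp (tendsto_id.const_mul_atTop ht)

/-- The combined integrand is the derivative of -e^(-tx) (1 + x)^c, whose boundary value at 0 gives
the 1. This expresses U(0, 1 + c, t) = 1, although the integral for U needs Re a > 0. -/
theorem tricomi_one_relation {c : ℂ} (hc : c.re < 0) {t : ℝ} (ht : 0 < t) :
    t * tricomi 1 (c + 1) t - c * tricomi 1 c t = 1 := by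
  have hint : ∀ c : ℂ, Integrable (fun x : ℝ => Complex.exp (-(t * x)) * confluentKernel 1 c x)
      posMeasure := fun c => by
    refine (integrable_exp_mul_confluentKernel c (a := 1) (by simp) ht).mono' (by fun_prop)
      (ae_of_all _ fun x => ?_)
    rw [norm_mul, norm_cexp_neg_mul]
  have hderiv : ∀ x ∈ Set.Ici (0 : ℝ),
      HasDerivAt (fun x : ℝ => -(Complex.exp (-(t * x)) * (1 + x : ℂ) ^ c))
        (t * (Complex.exp (-(t * x)) * confluentKernel 1 (c + 1) x)
          - c * (Complex.exp (-(t * x)) * confluentKernel 1 c x)) x := by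
    intro x hx
    have hx : 0 ≤ x := hx
    have h1 : HasDerivAt (fun x : ℝ => Complex.exp (-(t * x)))
        (Complex.exp (-(t * x)) * -(t * 1)) x :=
      (((Complex.ofRealCLM.hasDerivAt (x := x)).const_mul (t : ℂ)).neg).cexp
    have h2 : HasDerivAt (fun x : ℝ => (1 + x : ℂ) ^ c) (c * (1 + x : ℂ) ^ (c - 1) * 1) x := by
      have h3 : HasDerivAt (fun z : ℂ => (1 + z) ^ c) (c * (1 + x : ℂ) ^ (c - 1) * 1) x := by
        refine ((hasDerivAt_id' (x : ℂ)).const_add 1).cpow_const (Or.inl ?_)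
        simp
        linarith
      exact h3.comp_ofReal
    refine (h1.mul h2).neg.congr_deriv ?_
    simp only [confluentKernel, sub_self, Complex.cpow_zero, add_sub_cancel_right]
    ring
  have h := integral_Ioi_of_hasDerivAt_of_tendsto' hderiv
    (((hint (c + 1)).const_mul _).sub ((hint c).const_mul _)) (tendsto_exp_mul_one_add_cpow hc ht)
  rw [integral_sub ((hint (c + 1)).const_mul _) ((hint c).const_mul _), integral_const_mul,
    integral_const_mul] at h
  simpa [tricomi] using h

variable {ι : Type} [Fintype ι] [DecidableEq ι]

/-- The relation between the vertices with `a`, `c` and `a + 1` in the leg `j`. -/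
theorem baseVertex_descent (j : ι) {p : ℂ × (ι → ℂ) × (ι → ℂ)}
    (hp : p ∈ wallDomain (ι := ι) 0) :
    baseVertex p = baseVertex (p + (1, Pi.single j 1, Pi.single j 1))
      + (p.2.1 j - p.2.2 j) * baseVertex (p + (0, Pi.single j 1, 0)) := by
  obtain ⟨κ, h⟩ := exists_admissible hp
  have h1 := h.leg_add_one j
  have h2 := h.legShift ∅ j
  have hl : legShift ∅ j = (1, Pi.single j 1, Pi.single j 1) := by simp [legShift]
  rw [if_neg (Finset.notMem_empty j), hl] at h2
  rw [← integral_mbIntegrand h, ← integral_mbIntegrand h1, ← integral_mbIntegrand h2]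
  simp only [mul_left_comm _ (((2 * Real.pi)⁻¹ ^ Fintype.card ι : ℝ) : ℂ)]
  rw [← mul_add]
  congr 1
  simp only [← integral_const_mul]
  rw [← integral_add (integrable_mbIntegrand h2) ((integrable_mbIntegrand h1).const_mul _)]
  refine integral_congr_ae (ae_of_all _ fun y => ?_)
  obtain ⟨-, hf⟩ := h.re_facts y
  obtain ⟨n1, n2, n3, n4, n5, -⟩ := hf j
  have e1 := mbIntegrand_leg_add_one j n1 n2 n5
  have e2 := legCoeff_mul_mbIntegrand_of_notMem (Finset.notMem_empty j) n1 n3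
  rw [← verticalPoint_sub_single, hl, legCoeff, if_neg (Finset.notMem_empty j)] at e2
  -- Times a, the two terms on the right carry the polynomials -w and a + w, whose sum is a.
  refine mul_left_cancel₀ n1 ?_
  simp only
  linear_combination -e1 - e2

theorem regularSet_shift {ι : Type} [DecidableEq ι] {p : ℂ × (ι → ℂ) × (ι → ℂ)} (hp : p ∈ regularSet ι) (j : ι) :
    p + (0, Pi.single j 1, 0) ∈ regularSet ι ∧
      p + (1, Pi.single j 1, Pi.single j 1) ∈ regularSet ι := by
  refine ⟨fun T n => ?_, fun T n h => ?_⟩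
  · have : wall T (p + (0, Pi.single j 1, 0)) = wall T p := by simp [wall]
    rw [this]; exact hp T n
  · have hl : legShift ∅ j = (1, Pi.single j 1, Pi.single j 1) := by simp [legShift]
    rw [← hl, wall_add, wall_legShift] at h
    split_ifs at h
    · refine hp T (n + 1) ?_
      push_cast
      linear_combination h
    · exact hp T n (by linear_combination h)

/-- Both sides are analytic on the connected regular set and agree near the base point, so the
relation remains available where a is a nonpositive integer. -/
theorem descent_of_continuation {F : ℂ × (ι → ℂ) × (ι → ℂ) → ℂ}
    (hF : AnalyticOnNhd ℂ F (regularSet ι)) (hF0 : Set.EqOn F baseVertex (wallDomain (ι := ι) 0))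
    (j : ι) {p : ℂ × (ι → ℂ) × (ι → ℂ)} (hp : p ∈ regularSet ι) :
    F p = F (p + (1, Pi.single j 1, Pi.single j 1))
      + (p.2.1 j - p.2.2 j) * F (p + (0, Pi.single j 1, 0)) := by
  have hR : AnalyticOnNhd ℂ (fun p => F (p + (1, Pi.single j 1, Pi.single j 1))
      + (p.2.1 j - p.2.2 j) * F (p + (0, Pi.single j 1, 0))) (regularSet ι) := fun p hp =>
    (analyticAt_comp_add_right (hF _ (regularSet_shift hp j).2)).add
      (((analyticAt_param_a j p).sub (analyticAt_param_c j p)).mul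
        (analyticAt_comp_add_right (hF _ (regularSet_shift hp j).1)))
  have h0 := basePoint_mem ι
  refine hF.eqOn_of_preconnected_of_eventuallyEq hR isPreconnected_regularSet
    (wallDomain_zero_subset h0) ?_ hp
  have hev : ∀ v : ℂ × (ι → ℂ) × (ι → ℂ),
      ((Fintype.card ι + 1 : ℂ), (fun _ => 2 : ι → ℂ), (fun _ => 0 : ι → ℂ)) + v
        ∈ wallDomain (ι := ι) 0 →
      ∀ᶠ p in 𝓝 ((Fintype.card ι + 1 : ℂ), (fun _ => 2 : ι → ℂ), (fun _ => 0 : ι → ℂ)),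
        p + v ∈ wallDomain (ι := ι) 0 := fun v hv =>
    (continuous_add_const v).continuousAt.eventually ((isOpen_wallDomain (ι := ι) 0).mem_nhds hv)
  obtain ⟨κ, hκ⟩ := exists_admissible h0
  have hs : ((Fintype.card ι + 1 : ℂ), (fun _ => 2 : ι → ℂ), (fun _ => 0 : ι → ℂ))
      + (1, Pi.single j 1, Pi.single j 1) ∈ wallDomain (ι := ι) 0 := by
    have := (hκ.legShift ∅ j).mem_wallDomain
    simpa [legShift] using this
  filter_upwards [(isOpen_wallDomain (ι := ι) 0).mem_nhds h0,
    hev _ (hκ.leg_add_one j).mem_wallDomain, hev _ hs] with p h1 h2 h3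
  rw [hF0 h1, hF0 h2, hF0 h3]
  exact baseVertex_descent j h1

/-- The product of the functions `U` of the legs outside of `S`. -/
def tricomiProd (S : Finset ι) (p : ℂ × (ι → ℂ) × (ι → ℂ)) (t : ℝ) : ℂ :=
  ∏ j, if j ∈ S then 1 else tricomi (p.2.1 j) (p.2.2 j) t

theorem tricomiProd_insert {S : Finset ι} {j : ι} (hj : j ∉ S) {p : ℂ × (ι → ℂ) × (ι → ℂ)}
    (ha : p.2.1 j = 0) (hc : (p.2.2 j).re < 0) {t : ℝ} (ht : 0 < t) :
    t * tricomiProd S (p + (1, Pi.single j 1, Pi.single j 1)) t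
      - p.2.2 j * tricomiProd S (p + (0, Pi.single j 1, 0)) t = tricomiProd (insert j S) p t := by
  have key : ∀ (f : ι → ℂ) (K : ℂ), (∀ i ≠ j, f i
      = if i ∈ insert j S then 1 else tricomi (p.2.1 i) (p.2.2 i) t) →
      K * ∏ i, f i = K * f j * tricomiProd (insert j S) p t := fun f K h1 =>
    mul_prod_eq_of_forall_ne j h1 (by simp)
  simp only [tricomiProd] at key ⊢
  rw [key _ (t : ℂ) (fun i hi => by simp [hi]), key _ (p.2.2 j) (fun i hi => by simp [hi]),
    ← sub_mul]
  have := tricomi_one_relation hc ht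
  simp only [if_neg hj, Prod.snd_add, Prod.fst_add, Pi.add_apply, ha, Pi.single_eq_same, zero_add,
    Pi.zero_apply, add_zero]
  rw [this, one_mul]

/-- Legs are brought to a = 0 one at a time: descent expresses the value by two vertices with a = 1
on that leg, both inside the region of the integral, and `tricomi_one_relation` collapses their
U-functions to 1. -/
theorem continuation_eq_integral_tricomiProd {F : ℂ × (ι → ℂ) × (ι → ℂ) → ℂ}
    (hF : AnalyticOnNhd ℂ F (regularSet ι)) (hF0 : Set.EqOn F baseVertex (wallDomain (ι := ι) 0))
    (S : Finset ι) (p : ℂ × (ι → ℂ) × (ι → ℂ)) (hw : ∀ T, 0 < (wall T p).re)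
    (hS : ∀ j ∈ S, p.2.1 j = 0 ∧ (p.2.2 j).re < 0)
    (hS' : ∀ j ∉ S, 0 < (p.2.1 j).re ∧ 0 < (p.2.1 j - p.2.2 j).re) :
    Integrable (fun t : ℝ => (t : ℂ) ^ (p.1 - 1) * Complex.exp (-t) * tricomiProd S p t)
      posMeasure ∧
    F p = ∫ t : ℝ, (t : ℂ) ^ (p.1 - 1) * Complex.exp (-t) * tricomiProd S p t ∂posMeasure := by
  have hpos : ∀ {p : ℂ × (ι → ℂ) × (ι → ℂ)}, (∀ T, 0 < (wall T p).re) →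
      ∀ T (n : ℕ), wall T p ≠ -n := fun h1 T n hn => by
    have := h1 T
    rw [hn] at this
    simp at this
    linarith [(n.cast_nonneg : (0 : ℝ) ≤ n)]
  induction S using Finset.induction_on generalizing p with
  | empty =>
    have hp : p ∈ wallDomain (ι := ι) 0 :=
      ⟨fun T => ⟨by simpa using hw T, hpos hw T⟩, fun j => by
        simpa using hS' j (Finset.notMem_empty j)⟩
    simp only [tricomiProd, Finset.notMem_empty, if_false]
    exact ⟨integrable_baseVertex (fun j => (hS' j (Finset.notMem_empty j)).1) hw, hF0 hp⟩
  | insert j S hj ih =>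
    obtain ⟨ha, hc⟩ := hS j (Finset.mem_insert_self j S)
    have hl : legShift ∅ j = (1, Pi.single j 1, Pi.single j 1) := by simp [legShift]
    have hne : ∀ i ∈ S, i ≠ j := fun i hi h => hj (h ▸ hi)
    obtain ⟨i1, e1⟩ := ih (p + (1, Pi.single j 1, Pi.single j 1))
      (fun T => by
        rw [← hl, wall_add, wall_legShift, Complex.add_re]
        split_ifs
        · rw [Complex.one_re]; linarith [hw T]
        · rw [Complex.zero_re]; linarith [hw T])
      (fun i hi => by simpa [hne i hi] using hS i (Finset.mem_insert_of_mem hi))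
      (fun i hi => by
        by_cases hij : i = j
        · subst hij; simpa [ha] using hc
        · simpa [hij] using hS' i (by simp [hij, hi]))
    obtain ⟨i2, e2⟩ := ih (p + (0, Pi.single j 1, 0))
      (fun T => by
        have : wall T (p + (0, Pi.single j 1, 0)) = wall T p := by simp [wall]
        rw [this]; exact hw T)
      (fun i hi => by simpa [hne i hi] using hS i (Finset.mem_insert_of_mem hi))
      (fun i hi => by
        by_cases hij : i = j
        · subst hij; simp [ha]; linarith
        · simpa [hij] using hS' i (by simp [hij, hi]))
    have hpt : ∀ᵐ t : ℝ ∂posMeasure,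
        (t : ℂ) ^ ((p + (1, Pi.single j 1, Pi.single j 1)).1 - 1) * Complex.exp (-t) *
          tricomiProd S (p + (1, Pi.single j 1, Pi.single j 1)) t
        - p.2.2 j * ((t : ℂ) ^ ((p + (0, Pi.single j 1, 0)).1 - 1) * Complex.exp (-t) *
          tricomiProd S (p + (0, Pi.single j 1, 0)) t)
        = (t : ℂ) ^ (p.1 - 1) * Complex.exp (-t) * tricomiProd (insert j S) p t := by
      refine ae_posMeasure fun t ht => ?_
      rw [← tricomiProd_insert hj ha hc ht, Prod.fst_add, Prod.fst_add, add_zero,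
        show p.1 + 1 - 1 = (p.1 - 1) + 1 by ring,
        Complex.cpow_add _ _ (Complex.ofReal_ne_zero.mpr ht.ne'), Complex.cpow_one]
      ring
    refine ⟨(i1.sub (i2.const_mul _)).congr hpt, ?_⟩
    rw [← integral_congr_ae hpt, integral_sub i1 (i2.const_mul _), integral_const_mul, ← e1, ← e2,
      descent_of_continuation hF hF0 j (fun T n => hpos hw T n), ha]
    ring

/-- With every U replaced by 1 the t-integral is Euler's. That computation needs Re c_j < 0 and
walls with positive real part; the identity theorem removes both, after setting a = 0, which the
walls do not see. -/
theorem continuation_zero {F : ℂ × (ι → ℂ) × (ι → ℂ) → ℂ}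
    (hF : AnalyticOnNhd ℂ F (regularSet ι)) (hF0 : Set.EqOn F baseVertex (wallDomain (ι := ι) 0))
    {p : ℂ × (ι → ℂ) × (ι → ℂ)} (hp : p ∈ regularSet ι) (ha : p.2.1 = 0) :
    F p = Complex.Gamma p.1 := by
  let Z : (ℂ × (ι → ℂ) × (ι → ℂ)) → (ℂ × (ι → ℂ) × (ι → ℂ)) := fun p => (p.1, 0, p.2.2)
  have hZ : ∀ p, AnalyticAt ℂ Z p := fun p =>
    analyticAt_fst.prod (analyticAt_const.prod (AnalyticAt.pi fun j => analyticAt_param_c j p))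
  have h1 : AnalyticOnNhd ℂ (fun p => F (Z p)) (regularSet ι) := fun p hp =>
    AnalyticAt.comp (g := F) (f := Z) (hF (Z p) hp) (hZ p)
  have h2 : AnalyticOnNhd ℂ (fun p : ℂ × (ι → ℂ) × (ι → ℂ) => Complex.Gamma p.1)
      (regularSet ι) := fun p hp => by
    have hG : AnalyticAt ℂ Complex.Gamma p.1 := by
      refine Complex.analyticAt_iff_eventually_differentiableAt.mpr ?_
      have hm : p.1 ∈ {z : ℂ | ∀ n : ℕ, z ≠ -n} := fun n => by simpa [wall] using hp ∅ n
      filter_upwards [isOpen_setOf_forall_ne_neg_natCast.mem_nhds hm] with z hz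
      exact Complex.differentiableAt_Gamma z hz
    exact hG.comp (f := fun p : ℂ × (ι → ℂ) × (ι → ℂ) => p.1) analyticAt_fst
  let p₀ : ℂ × (ι → ℂ) × (ι → ℂ) := (1, 0, fun _ => -1)
  let U : Set (ℂ × (ι → ℂ) × (ι → ℂ)) := {p | ∀ T, 0 < (wall T p).re} ∩ {p | ∀ j, (p.2.2 j).re < 0}
  have hU : IsOpen U := by
    refine IsOpen.inter ?_ ?_
    · simp only [Set.ofPred_forall]
      exact isOpen_iInter_of_finite fun T =>
        isOpen_lt continuous_const (Complex.continuous_re.comp (continuous_wall T))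
    · simp only [Set.ofPred_forall]
      exact isOpen_iInter_of_finite fun j => isOpen_lt (by fun_prop) continuous_const
  have hU0 : p₀ ∈ U := by
    refine ⟨fun T => ?_, fun j => by simp [p₀]⟩
    simp [wall, p₀]
    positivity
  have hreg : p₀ ∈ regularSet ι := fun T n hn => by
    have := hU0.1 T
    rw [hn] at this
    simp at this
    linarith [(n.cast_nonneg : (0 : ℝ) ≤ n)]
  have h3 := h1.eqOn_of_preconnected_of_eventuallyEq h2 isPreconnected_regularSet hreg (by
    filter_upwards [hU.mem_nhds hU0] with p hp
    have h4 := (continuation_eq_integral_tricomiProd hF hF0 Finset.univ (Z p) hp.1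
      (fun j _ => ⟨rfl, hp.2 j⟩) (fun j hj => absurd (Finset.mem_univ j) hj)).2
    have h5 : 0 < p.1.re := by simpa [wall] using hp.1 ∅
    rw [h4, Complex.Gamma_eq_integral h5, Complex.GammaIntegral]
    refine integral_congr_ae (ae_of_all _ fun t => ?_)
    simp only [tricomiProd, Finset.mem_univ, if_true, Finset.prod_const_one, mul_one, Z]
    push_cast
    ring) hp
  rw [show p = Z p from Prod.ext rfl (Prod.ext ha rfl)]
  exact h3

end Evaluation

/-! ### Laguerre polynomials and the Lauricella function. -/

section Lauricella

open Polynomial in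
/-- The linear functional `X ^ i ↦ Γ(A + i)` on polynomials. -/
def gammaFunctional (A : ℂ) : ℂ[X] →ₗ[ℂ] ℂ :=
  Polynomial.lsum fun i => Complex.Gamma (A + i) • LinearMap.id

theorem gammaFunctional_monomial (A : ℂ) (i : ℕ) (z : ℂ) :
    gammaFunctional A (Polynomial.monomial i z) = Complex.Gamma (A + i) * z := by
  simp [gammaFunctional, Polynomial.lsum_apply]

/-- Algebraic form of integration against t^(A-1) e^(-t), valid also where that integral diverges: a
factor t raises A by one, as in the descent relation. -/
theorem gammaFunctional_X_mul (A : ℂ) (f : Polynomial ℂ) :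
    gammaFunctional A (Polynomial.X * f) = gammaFunctional (A + 1) f := by
  induction f using Polynomial.induction_on' with
  | add f g hf hg => rw [mul_add, map_add, map_add, hf, hg]
  | monomial i z =>
    rw [Polynomial.X_mul_monomial, gammaFunctional_monomial, gammaFunctional_monomial]
    push_cast
    rw [add_assoc, add_comm (1 : ℂ)]

/-- The coefficient of `X ^ i` in `laguerre n c`. -/
def laguerreCoeff (n i : ℕ) (c : ℂ) : ℂ := (-1) ^ i * (n.choose i : ℂ) * poch (c + 1 + i) (n - i)

/-- The Laguerre polynomial `(1 + c)_n ₁F₁(-n; 1 + c; X)`. -/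
def laguerre (n : ℕ) (c : ℂ) : Polynomial ℂ :=
  ∑ i ∈ Finset.range (n + 1), Polynomial.monomial i (laguerreCoeff n i c)

theorem coeff_laguerre (n i : ℕ) (c : ℂ) : (laguerre n c).coeff i = laguerreCoeff n i c := by
  simp only [laguerre, Polynomial.finsetSum_coeff, Polynomial.coeff_monomial]
  rw [Finset.sum_ite_eq']
  split_ifs with h
  · rfl
  · rw [Finset.mem_range, not_lt] at h
    rw [laguerreCoeff, Nat.choose_eq_zero_of_lt (by omega)]
    simp

theorem poch_succ (x : ℂ) (n : ℕ) : poch x (n + 1) = poch x n * (x + n) := by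
  simp [poch, ascPochhammer_succ_eval]

theorem laguerre_zero (c : ℂ) : laguerre 0 c = 1 := by
  simp [laguerre, laguerreCoeff, poch]

/-- The counterpart, up to sign, of the descent relation at a = -(n + 1). On coefficients it is
Pascal's rule. -/
theorem laguerre_succ (n : ℕ) (c : ℂ) :
    laguerre (n + 1) c
      = Polynomial.C ((n + 1 : ℂ) + c) * laguerre n c - Polynomial.X * laguerre n (c + 1) := by
  ext i
  rw [Polynomial.coeff_sub, Polynomial.coeff_C_mul, coeff_laguerre, coeff_laguerre]
  cases i with
  | zero =>
    rw [Polynomial.coeff_X_mul_zero]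
    simp only [laguerreCoeff, Nat.choose_zero_right, Nat.sub_zero, poch_succ]
    push_cast
    ring
  | succ i =>
    rw [Polynomial.coeff_X_mul, coeff_laguerre]
    simp only [laguerreCoeff, Nat.choose_succ_succ, Nat.succ_sub_succ]
    push_cast
    rw [show c + 1 + 1 + (i : ℂ) = c + 1 + (i + 1) by ring]
    rcases lt_or_ge i n with h | h
    · obtain ⟨m, rfl⟩ := Nat.exists_eq_add_of_lt h
      rw [show i + m + 1 - i = m + 1 by omega, show i + m + 1 - (i + 1) = m by omega, poch_succ]
      push_cast
      ring
    · rw [Nat.choose_eq_zero_of_lt (show n < i + 1 by omega)]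
      push_cast
      ring

/-- Induction on ∑ n_j: descent on a leg with n_j > 0 lowers n_j by one in both terms, and
`laguerre_succ` recombines them at the cost of one sign. -/
theorem continuation_neg_natCast {ι : Type} [Fintype ι] [DecidableEq ι]
    {F : ℂ × (ι → ℂ) × (ι → ℂ) → ℂ} (hF : AnalyticOnNhd ℂ F (regularSet ι))
    (hF0 : Set.EqOn F baseVertex (wallDomain (ι := ι) 0)) (n : ι → ℕ)
    (p : ℂ × (ι → ℂ) × (ι → ℂ)) (hp : p ∈ regularSet ι) (ha : ∀ j, p.2.1 j = -(n j : ℂ)) :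
    F p = (-1) ^ (∑ j, n j) * gammaFunctional p.1 (∏ j, laguerre (n j) (p.2.2 j)) := by
  obtain ⟨N, hN⟩ : ∃ N, ∑ j, n j = N := ⟨_, rfl⟩
  induction N generalizing n p with
  | zero =>
    have h0 : ∀ j, n j = 0 := fun j => by
      simpa using (Finset.sum_eq_zero_iff.mp hN) j (Finset.mem_univ j)
    rw [continuation_zero hF hF0 hp (funext fun j => by simp [ha j, h0 j])]
    simp only [h0, laguerre_zero, Finset.prod_const_one, Finset.sum_const_zero, pow_zero, one_mul]
    rw [← Polynomial.C_1, ← Polynomial.monomial_zero_left, gammaFunctional_monomial]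
    simp
  | succ N ih =>
    obtain ⟨j, hj⟩ : ∃ j, n j ≠ 0 := by
      by_contra hcon
      push Not at hcon
      simp [hcon] at hN
    obtain ⟨m, hm⟩ := Nat.exists_eq_succ_of_ne_zero hj
    let n' : ι → ℕ := Function.update n j m
    have hn' : ∀ i ≠ j, n' i = n i := fun i hi => Function.update_of_ne hi _ _
    have hnj : n' j = m := Function.update_self _ _ _
    have hsum : ∑ j, n' j = N := by
      have h1 : n j + ∑ x ∈ Finset.univ.erase j, n x = ∑ x, n x :=
        Finset.add_sum_erase Finset.univ n (Finset.mem_univ j)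
      have h2 : n' j + ∑ x ∈ Finset.univ.erase j, n' x = ∑ x, n' x :=
        Finset.add_sum_erase Finset.univ n' (Finset.mem_univ j)
      have h3 : ∑ x ∈ Finset.univ.erase j, n' x = ∑ x ∈ Finset.univ.erase j, n x :=
        Finset.sum_congr rfl fun i hi => hn' i (Finset.ne_of_mem_erase hi)
      rw [h3, hnj] at h2
      omega
    have hpa : ∀ i, p.2.1 i + Pi.single (M := fun _ => ℂ) j 1 i = -(n' i : ℂ) := by
      intro i
      by_cases hi : i = j
      · subst hi; rw [ha, hnj, hm]; simp
      · rw [ha, hn' i hi]; simp [hi]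
    have e1 := ih n' (p + (1, Pi.single j 1, Pi.single j 1)) (regularSet_shift hp j).2 hpa hsum
    have e2 := ih n' (p + (0, Pi.single j 1, 0)) (regularSet_shift hp j).1 hpa hsum
    rw [hsum] at e1 e2
    rw [descent_of_continuation hF hF0 j hp, e1, e2, hN]
    simp only [Prod.fst_add, Prod.snd_add, add_zero, Pi.add_apply, Pi.zero_apply]
    let Q : Polynomial ℂ := ∏ i ∈ Finset.univ.erase j, laguerre (n i) (p.2.2 i)
    have q1 : ∏ i, laguerre (n' i) (p.2.2 i + Pi.single (M := fun _ => ℂ) j 1 i)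
        = laguerre m (p.2.2 j + 1) * Q := by
      rw [← Finset.mul_prod_erase _ _ (Finset.mem_univ j), hnj, Pi.single_eq_same]
      congr 1
      refine Finset.prod_congr rfl fun i hi => ?_
      rw [hn' i (Finset.ne_of_mem_erase hi), Pi.single_eq_of_ne (Finset.ne_of_mem_erase hi),
        add_zero]
    have q2 : ∏ i, laguerre (n' i) (p.2.2 i) = laguerre m (p.2.2 j) * Q := by
      rw [← Finset.mul_prod_erase _ _ (Finset.mem_univ j), hnj]
      congr 1
      exact Finset.prod_congr rfl fun i hi => by rw [hn' i (Finset.ne_of_mem_erase hi)]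
    have q3 : ∏ i, laguerre (n i) (p.2.2 i) = ((m : ℂ) + 1 + p.2.2 j) • (laguerre m (p.2.2 j) * Q)
        - Polynomial.X * (laguerre m (p.2.2 j + 1) * Q) := by
      rw [← Finset.mul_prod_erase _ _ (Finset.mem_univ j), hm, Nat.succ_eq_add_one, laguerre_succ,
        Polynomial.smul_eq_C_mul]
      ring
    rw [q1, q2, q3, map_sub, map_smul, gammaFunctional_X_mul, ha, hm, smul_eq_mul, pow_succ]
    push_cast
    ring

theorem poch_add (x : ℂ) (m k : ℕ) : poch x (m + k) = poch x m * poch (x + m) k := by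
  induction k with
  | zero => simp [poch]
  | succ k ih => rw [← add_assoc, poch_succ, ih, poch_succ]; push_cast; ring

theorem poch_neg_natCast (n i : ℕ) :
    poch (-(n : ℂ)) i = (-1) ^ i * (i.factorial : ℂ) * (n.choose i : ℂ) := by
  rw [poch, ascPochhammer_eval_neg_eq_descPochhammer, descPochhammer_eval_eq_descFactorial,
    Nat.descFactorial_eq_factorial_mul_choose]
  push_cast
  ring

theorem Gamma_mul_poch {A : ℂ} (hA : ∀ m : ℕ, A ≠ -m) (m : ℕ) :
    Complex.Gamma A * poch A m = Complex.Gamma (A + m) := by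
  induction m with
  | zero => simp [poch]
  | succ m ih =>
    have : A + m ≠ 0 := fun h0 => hA m (by linear_combination h0)
    rw [poch_succ, ← mul_assoc, ih, Nat.cast_succ, ← add_assoc, Complex.Gamma_add_one _ this]
    ring

theorem poch_ne_zero {x : ℂ} {n : ℕ} (h : ∀ k < n, x + k ≠ 0) : poch x n ≠ 0 := by
  induction n with
  | zero => simp [poch]
  | succ n ih =>
    rw [poch_succ]
    exact mul_ne_zero (ih fun k hk => h k (by omega)) (h n (by omega))

theorem gammaFunctional_prod_laguerre {κ : Type} [Fintype κ] [DecidableEq κ] (A : ℂ) (n : κ → ℕ)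
    (c : κ → ℂ) : gammaFunctional A (∏ a, laguerre (n a) (c a))
      = ∑ i ∈ Fintype.piFinset fun a => Finset.range (n a + 1),
        Complex.Gamma (A + (∑ a, i a : ℕ)) * ∏ a, laguerreCoeff (n a) (i a) (c a) := by
  simp only [laguerre]
  rw [Finset.prod_univ_sum, map_sum]
  refine Finset.sum_congr rfl fun i _ => ?_
  have h : ∏ a, Polynomial.monomial (i a) (laguerreCoeff (n a) (i a) (c a))
      = Polynomial.monomial (∑ a, i a) (∏ a, laguerreCoeff (n a) (i a) (c a)) := by
    simp only [← Polynomial.C_mul_X_pow_eq_monomial]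
    rw [Finset.prod_mul_distrib, Finset.prod_pow_eq_pow_sum, map_prod]
  rw [h, gammaFunctional_monomial]

/-- The symbols (-n_a)_i cut the series off at i_a ≤ n_a. The prefactor (Δ_a - h + 1)_{n_a} cancels
the denominators and leaves Laguerre coefficients; this is where its nonvanishing enters. -/
theorem knownVertex_eq {κ : Type} [Fintype κ] (h : ℂ) (Δ : κ → ℂ) (n : κ → ℕ)
    (hA : ∀ m : ℕ, (∑ a, Δ a) / 2 - h ≠ -m) (hc : ∀ a, ∀ k < n a, Δ a - h + 1 + k ≠ 0) :
    knownVertex h Δ n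
      = gammaFunctional ((∑ a, Δ a) / 2 - h) (∏ a, laguerre (n a) (Δ a - h)) := by
  classical
  rw [gammaFunctional_prod_laguerre, knownVertex, lauricellaFA,
    tsum_eq_sum (s := Fintype.piFinset fun a => Finset.range (n a + 1)), Finset.mul_sum]
  · refine Finset.sum_congr rfl fun i hi => ?_
    have hi' : ∀ a, i a ≤ n a := fun a => by
      have := Fintype.mem_piFinset.mp hi a
      rw [Finset.mem_range] at this
      omega
    rw [← Gamma_mul_poch hA]
    simp only [one_pow, Finset.prod_const_one, mul_one]
    have h1 : (∏ a, poch (Δ a - h + 1) (n a)) * ((∏ a, poch (-(n a : ℂ)) (i a)) /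
        ((∏ a, poch (Δ a - h + 1) (i a)) * ∏ a, ((i a).factorial : ℂ)))
        = ∏ a, laguerreCoeff (n a) (i a) (Δ a - h) := by
      rw [← Finset.prod_mul_distrib, ← Finset.prod_div_distrib, ← Finset.prod_mul_distrib]
      refine Finset.prod_congr rfl fun a _ => ?_
      have hp : poch (Δ a - h + 1) (i a) ≠ 0 :=
        poch_ne_zero fun k hk => hc a k (hk.trans_le (hi' a))
      have hf : ((i a).factorial : ℂ) ≠ 0 := Nat.cast_ne_zero.mpr (Nat.factorial_ne_zero _)
      have hs := poch_add (Δ a - h + 1) (i a) (n a - i a)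
      rw [Nat.add_sub_cancel' (hi' a)] at hs
      rw [hs, poch_neg_natCast, laguerreCoeff]
      field_simp
    rw [← h1]
    ring
  · intro i hi
    obtain ⟨a, ha⟩ : ∃ a, n a < i a := by
      by_contra hcon
      push Not at hcon
      exact hi (Fintype.mem_piFinset.mpr fun a => Finset.mem_range.mpr
        (Nat.lt_succ_of_le (hcon a)))
    have : ∏ a, poch (-(n a : ℂ)) (i a) = 0 := by
      refine Finset.prod_eq_zero (Finset.mem_univ a) ?_
      rw [poch_neg_natCast, Nat.choose_eq_zero_of_lt ha]
      simp
    rw [this]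
    simp

/-- The vertex rule at the poles of the propagators. -/
theorem vertexFactor_eq_knownVertex (h : ℂ) {E ι : Type} [Fintype E] [Fintype ι] (δ : E → ℂ)
    (Δ : ι → ℂ) (n : ι → ℕ)
    (hreg : (∑ i, δ i, (fun a => Δ a - h), fun a => Δ a + 2 * n a) ∈ vertexRegular ι h)
    (hc : ∀ a, ∀ k < n a, Δ a - h + 1 + k ≠ 0) :
    vertexFactor h (∑ i, δ i, (fun a => Δ a - h), fun a => Δ a + 2 * n a)
      = (-1) ^ (∑ a, n a) * knownVertex h (Sum.elim δ Δ) (Sum.elim (fun _ => 0) n) := by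
  classical
  obtain ⟨F, hF, hF0⟩ := exists_vertex_continuation (ι := ι)
  have hp := (mem_vertexRegular_iff h _).mp hreg
  have hA : (vertexParam h (∑ i, δ i, (fun a => Δ a - h), fun a => Δ a + 2 * (n a : ℂ))).1
      = (∑ a, (Sum.elim δ Δ) a) / 2 - h := by
    simp only [vertexParam, Fintype.sum_sum_type, Sum.elim_inl, Sum.elim_inr,
      Finset.sum_sub_distrib, Finset.sum_const, Finset.card_univ, nsmul_eq_mul]
    ring
  rw [vertexFactor_eq hF hF0 hreg, continuation_neg_natCast hF hF0 n _ hp fun j => by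
    simp only [vertexParam]; ring, hA, knownVertex_eq]
  · rw [Fintype.prod_sum_type]
    simp [laguerre_zero, vertexParam]
  · intro m hm
    refine hp ∅ m ?_
    rw [← hm, ← hA]
    simp [wall]
  · rintro (a | a) k hk
    · exact absurd hk (Nat.not_lt_zero k)
    · exact hc a k hk

theorem vertexFactor_eq_knownVertex_internal (h : ℂ) {ι : Type} [Fintype ι] (Δ : ι → ℂ)
    (n : ι → ℕ)
    (hreg : (0, (fun a => Δ a - h), fun a => Δ a + 2 * n a) ∈ vertexRegular ι h)
    (hc : ∀ a, ∀ k < n a, Δ a - h + 1 + k ≠ 0) :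
    vertexFactor h (0, (fun a => Δ a - h), fun a => Δ a + 2 * n a)
      = (-1) ^ (∑ a, n a) * knownVertex h Δ n := by
  classical
  obtain ⟨F, hF, hF0⟩ := exists_vertex_continuation (ι := ι)
  have hp := (mem_vertexRegular_iff h _).mp hreg
  have hA : (vertexParam h (0, (fun a => Δ a - h), fun a => Δ a + 2 * (n a : ℂ))).1
      = (∑ a, Δ a) / 2 - h := by
    simp only [vertexParam, Finset.sum_sub_distrib, Finset.sum_const, Finset.card_univ,
      nsmul_eq_mul]
    ring
  rw [vertexFactor_eq hF hF0 hreg, continuation_neg_natCast hF hF0 n _ hp fun j => by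
    simp only [vertexParam]; ring, hA, knownVertex_eq h Δ n ?_ hc]
  · rfl
  · intro m hm
    refine hp ∅ m ?_
    rw [← hm, ← hA]
    simp [wall]

end Lauricella

/-! ### Evenness of a vertex in each spectrum variable. -/

section Symmetry

variable {ι : Type} [Fintype ι]

/-- Flips the signs of spectrum variables. -/
def flipSpectrum (σ : ι → ℤˣ) (p : ℂ × (ι → ℂ) × (ι → ℂ)) : ℂ × (ι → ℂ) × (ι → ℂ) :=
  (p.1, fun j => (((σ j : ℤˣ) : ℤ) : ℂ) * p.2.1 j, p.2.2)

theorem flipSpectrum_mem {h : ℂ} {p : ℂ × (ι → ℂ) × (ι → ℂ)} (hp : p ∈ vertexRegular ι h)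
    (σ : ι → ℤˣ) : flipSpectrum σ p ∈ vertexRegular ι h := by
  intro τ k hk
  refine hp (τ * σ) k (Eq.trans ?_ hk)
  simp [flipSpectrum, mul_assoc]

theorem vertexArg_flip (h D : ℂ) (c w : ι → ℂ) (σ : ι → ℤˣ) :
    vertexArg h D (fun j => (((σ j : ℤˣ) : ℤ) : ℂ) * c j)
      (fun j => w j + if σ j = 1 then 0 else c j) = vertexArg h D c w := by
  rw [vertexArg, vertexArg]
  congr 2
  refine Finset.sum_congr rfl fun j _ => ?_
  rcases Int.units_eq_one_or (σ j) with hj | hj <;> simp [hj]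
  ring

/-- Under c → -c and w → w + c the factors Γ(-w) and Γ(-c - w) change places, as do the two Gamma
functions of the denominator. -/
theorem vertexIntegrand_flip (h D : ℂ) (c s w : ι → ℂ) (σ : ι → ℤˣ) :
    vertexIntegrand h D (fun j => (((σ j : ℤˣ) : ℤ) : ℂ) * c j) s
      (fun j => w j + if σ j = 1 then 0 else c j) = vertexIntegrand h D c s w := by
  rw [vertexIntegrand, vertexIntegrand, vertexArg_flip]
  congr 1
  refine Finset.prod_congr rfl fun j _ => ?_
  rcases Int.units_eq_one_or (σ j) with hj | hj
  · simp [hj]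
  · simp only [hj, show (-1 : ℤˣ) ≠ 1 by decide, if_false]
    push_cast
    rw [show -(w j + c j) = -c j - w j by ring, show -(-1 * c j) - (w j + c j) = -w j by ring,
      show (h + -1 * c j - s j) / 2 + (w j + c j) = (h + c j - s j) / 2 + w j by ring,
      show h + -1 * c j = h - c j by ring, show h - -1 * c j = h + c j by ring]
    ring

/-- The shift by c_j splits: its real part displaces the contour, its imaginary part is a
translation of y. -/
theorem vertexIntegral_flip (h D : ℂ) (c s : ι → ℂ) (κ : ι → ℝ) (σ : ι → ℤˣ) :
    vertexIntegral h D (fun j => (((σ j : ℤˣ) : ℤ) : ℂ) * c j) s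
      (fun j => κ j + if σ j = 1 then 0 else (c j).re) = vertexIntegral h D c s κ := by
  rw [vertexIntegral, vertexIntegral,
    ← integral_add_right_eq_self _ (fun j => if σ j = 1 then 0 else (c j).im)]
  refine integral_congr_ae (Eventually.of_forall fun y => ?_)
  beta_reduce
  rw [← vertexIntegrand_flip h D c s _ σ]
  congr 2
  funext j
  by_cases hj : σ j = 1
  · simp [hj]
  · simp only [hj, if_false, Pi.add_apply]
    conv_rhs => rw [← Complex.re_add_im (c j)]
    push_cast
    ring

theorem Separates.flip {h D : ℂ} {c s : ι → ℂ} {κ : ι → ℝ} (hs : Separates h D c s κ)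
    (σ : ι → ℤˣ) : Separates h D (fun j => (((σ j : ℤˣ) : ℤ) : ℂ) * c j) s
      (fun j => κ j + if σ j = 1 then 0 else (c j).re) := by
  refine ⟨?_, fun j => ?_⟩
  · have hs1 := hs.1
    rw [← vertexArg_flip h D c _ σ] at hs1
    refine hs1.trans_eq ?_
    have h1 : ∀ w, vertexArg h D (fun j => (((σ j : ℤˣ) : ℤ) : ℂ) * c j) w
        = (D + ((Fintype.card ι : ℂ) - 2) * h + ∑ j, (((σ j : ℤˣ) : ℤ) : ℂ) * c j) / 2
          + ∑ j, w j := fun w => by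
      rw [vertexArg, Finset.sum_add_distrib, ← Finset.mul_sum]
      ring
    rw [h1, h1, Complex.add_re, Complex.add_re, Complex.re_sum, Complex.re_sum]
    congr 1
    refine Finset.sum_congr rfl fun j _ => ?_
    by_cases hj : σ j = 1 <;> simp [hj]
  · obtain ⟨h1, h2, h3⟩ := hs.2 j
    rcases Int.units_eq_one_or (σ j) with hj | hj
    · simp only [hj, if_true, add_zero, Units.val_one, Int.cast_one, one_mul]
      exact ⟨h1, h2, h3⟩
    · simp only [hj, show (-1 : ℤˣ) ≠ 1 by decide, if_false]
      simp only [Complex.neg_re, Complex.sub_re, Complex.add_re, Complex.ofReal_re,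
        Complex.div_ofNat_re] at h1 h2 h3
      push_cast
      simp only [Complex.neg_re, Complex.sub_re, Complex.add_re, Complex.ofReal_re,
        Complex.div_ofNat_re, neg_mul, one_mul]
      exact ⟨by linarith, by linarith, by linarith⟩

/-- The flipped function also continues the Mellin integral, so uniqueness applies. -/
theorem vertexFactor_flip {h : ℂ} {p : ℂ × (ι → ℂ) × (ι → ℂ)} (hp : p ∈ vertexRegular ι h)
    (σ : ι → ℤˣ) : vertexFactor h (flipSpectrum σ p) = vertexFactor h p := by
  have hG : IsVertexFactor h fun p : ℂ × (ι → ℂ) × (ι → ℂ) =>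
      vertexFactor h (flipSpectrum σ p) := by
    refine ⟨fun q hq => ?_, fun D c s κ hs => ?_⟩
    · have hΦ : AnalyticAt ℂ (flipSpectrum σ) q :=
        AnalyticAt.prod analyticAt_fst (AnalyticAt.prod
          (AnalyticAt.pi fun j => analyticAt_const.mul (analyticAt_param_a j q))
          (AnalyticAt.pi fun j => analyticAt_param_c j q))
      exact ((isVertexFactor_vertexFactor h).1 _ (flipSpectrum_mem hq σ)).comp
        (f := flipSpectrum σ) hΦ
    · exact ((isVertexFactor_vertexFactor h).2 _ _ _ _ (hs.flip σ)).trans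
        (vertexIntegral_flip h D c s κ σ)
  exact hG.eqOn (isVertexFactor_vertexFactor h) hp

theorem mem_vertexRegular_congr {h D : ℂ} {c s : ι → ℂ} (hp : (D, c, s) ∈ vertexRegular ι h)
    (s' : ι → ℂ) : (D, c, s') ∈ vertexRegular ι h := hp

end Symmetry

/-! ### Residues of the spectrum density and of the propagator factor. -/

section Residues

/-- Because `Complex.Gamma` is 0 at its poles, nonvanishing serves as the criterion for regularity
here. -/
theorem ne_neg_natCast_of_Gamma_ne_zero {z : ℂ} (hz : Complex.Gamma z ≠ 0) (m : ℕ) : z ≠ -m := by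
  rintro rfl
  exact hz (Complex.Gamma_neg_nat_eq_zero m)

theorem continuousAt_Gamma_of_ne_zero {z : ℂ} (hz : Complex.Gamma z ≠ 0) :
    ContinuousAt Complex.Gamma z :=
  (Complex.differentiableAt_Gamma z (ne_neg_natCast_of_Gamma_ne_zero hz)).continuousAt

theorem Gamma_ne_zero_of_forall_int {z : ℂ} (hz : ∀ k : ℤ, z ≠ k) : Complex.Gamma z ≠ 0 :=
  Complex.Gamma_ne_zero fun m hm => hz (-m) (by rw [hm]; push_cast; rfl)

/-- The residue of the Gamma function at `-n`. -/
theorem tendsto_add_mul_Gamma (n : ℕ) :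
    Tendsto (fun z : ℂ => (z + n) * Complex.Gamma z) (𝓝[≠] (-(n : ℂ)))
      (𝓝 ((-1) ^ n / (n.factorial : ℂ))) := by
  induction n with
  | zero => simpa using Complex.tendsto_self_mul_Gamma_nhds_zero
  | succ n ih =>
    have h1 : Tendsto (fun z : ℂ => z + 1) (𝓝[≠] (-((n + 1 : ℕ) : ℂ))) (𝓝[≠] (-(n : ℂ))) := by
      refine tendsto_nhdsWithin_iff.mpr ⟨?_, ?_⟩
      · have : Tendsto (fun z : ℂ => z + 1) (𝓝 (-((n + 1 : ℕ) : ℂ)))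
            (𝓝 (-((n + 1 : ℕ) : ℂ) + 1)) := (continuous_id.add continuous_const).tendsto _
        rw [show -((n + 1 : ℕ) : ℂ) + 1 = -(n : ℂ) by push_cast; ring] at this
        exact this.mono_left nhdsWithin_le_nhds
      · filter_upwards [self_mem_nhdsWithin] with z hz hz'
        refine hz ?_
        rw [Set.mem_singleton_iff] at hz' ⊢
        push_cast
        linear_combination hz'
    have hne : (-((n + 1 : ℕ) : ℂ)) ≠ 0 := neg_ne_zero.mpr (Nat.cast_ne_zero.mpr n.succ_ne_zero)
    have h2 : Tendsto (fun z : ℂ => z) (𝓝[≠] (-((n + 1 : ℕ) : ℂ))) (𝓝 (-((n + 1 : ℕ) : ℂ))) :=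
      nhdsWithin_le_nhds
    have h3 := (ih.comp h1).div h2 hne
    have hval : ((-1) ^ n / (n.factorial : ℂ)) / (-((n + 1 : ℕ) : ℂ))
        = (-1) ^ (n + 1) / ((n + 1).factorial : ℂ) := by
      rw [Nat.factorial_succ, pow_succ]
      push_cast
      have hf : (n.factorial : ℂ) ≠ 0 := Nat.cast_ne_zero.mpr (Nat.factorial_ne_zero _)
      have : (n : ℂ) + 1 ≠ 0 := Nat.cast_add_one_ne_zero n
      field_simp
    rw [hval] at h3
    refine h3.congr' ?_
    filter_upwards [h2.eventually_ne hne] with z hz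
    simp only [Pi.div_apply, Function.comp_apply, Complex.Gamma_add_one z hz]
    push_cast
    field_simp
    ring

/-- Iterating the functional equation in both factors gives all of the reflection that is needed; no
sine appears. -/
theorem Gamma_sub_natCast_mul_Gamma_add {x : ℂ} (hx : ∀ k : ℤ, x ≠ k) (n : ℕ) :
    Complex.Gamma (-x - n) * Complex.Gamma (x + n + 1)
      = (-1) ^ n * (Complex.Gamma (-x) * (x * Complex.Gamma x)) := by
  induction n with
  | zero =>
    rw [← Complex.Gamma_add_one x fun h0 => hx 0 (by simp [h0])]
    simp
  | succ n ih =>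
    have h0 : x + n + 1 ≠ 0 := fun h0 => hx (-(n + 1)) (by push_cast; linear_combination h0)
    have h1 := Complex.Gamma_add_one (-x - (n + 1 : ℕ)) (fun h1 => h0 (by
      push_cast at h1; linear_combination -h1))
    rw [show -x - ((n + 1 : ℕ) : ℂ) + 1 = -x - n by push_cast; ring] at h1
    have h2 := Complex.Gamma_add_one (x + n + 1) h0
    rw [show x + n + 1 + 1 = x + ((n + 1 : ℕ) : ℂ) + 1 by push_cast; ring] at h2
    rw [h2, pow_succ, mul_assoc, mul_comm (-1 : ℂ), ← mul_assoc ((-1) ^ n), ← ih, h1]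
    push_cast
    ring

theorem tendsto_mul_spectrumDensity {h Δ : ℂ} (hx : ∀ k : ℤ, Δ - h ≠ k) (ε : ℤˣ) :
    Tendsto (fun c => (Δ - h - ((ε : ℤ) : ℂ) * c) * spectrumDensity h Δ c)
      (𝓝[≠] (((ε : ℤ) : ℂ) * (Δ - h)))
      (𝓝 (1 / (2 * (Δ - h)) / (Complex.Gamma (Δ - h) * Complex.Gamma (-(Δ - h))))) := by
  set x := Δ - h with hxdef
  have hx0 : x ≠ 0 := fun h0 => hx 0 (by simp [h0])
  have hxn : ∀ k : ℤ, -x ≠ k := fun k hk => hx (-k) (by push_cast; linear_combination -hk)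
  have hε : ((ε : ℤ) : ℂ) * ((ε : ℤ) : ℂ) = 1 := by
    rcases Int.units_eq_one_or ε with hj | hj <;> simp [hj]
  have hG : Complex.Gamma (((ε : ℤ) : ℂ) * x) ≠ 0 ∧ Complex.Gamma (-(((ε : ℤ) : ℂ) * x)) ≠ 0 ∧
      Complex.Gamma (((ε : ℤ) : ℂ) * x) * Complex.Gamma (-(((ε : ℤ) : ℂ) * x))
        = Complex.Gamma x * Complex.Gamma (-x) := by
    have h1 := Gamma_ne_zero_of_forall_int hx
    have h2 := Gamma_ne_zero_of_forall_int hxn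
    rcases Int.units_eq_one_or ε with hj | hj
    · simp [hj, h1, h2]
    · simp [hj, h1, h2, mul_comm]
  have hc : ContinuousAt (fun c => 1 / (x + ((ε : ℤ) : ℂ) * c)
      / (Complex.Gamma c * Complex.Gamma (-c))) (((ε : ℤ) : ℂ) * x) := by
    refine ContinuousAt.div (ContinuousAt.div continuousAt_const (by fun_prop) ?_)
      (ContinuousAt.mul (continuousAt_Gamma_of_ne_zero hG.1)
        (ContinuousAt.comp' (continuousAt_Gamma_of_ne_zero hG.2.1) continuousAt_neg))
      (mul_ne_zero hG.1 hG.2.1)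
    rw [← mul_assoc, hε, one_mul, ← two_mul]
    exact mul_ne_zero two_ne_zero hx0
  have ht := hc.tendsto.mono_left (nhdsWithin_le_nhds (s := {((ε : ℤ) : ℂ) * x}ᶜ))
  rw [hG.2.2, ← mul_assoc, hε, one_mul, ← two_mul] at ht
  refine ht.congr' ?_
  filter_upwards [self_mem_nhdsWithin] with c hcne
  have hne : x - ((ε : ℤ) : ℂ) * c ≠ 0 := fun h0 => hcne (by
    rw [Set.mem_singleton_iff]
    linear_combination -((ε : ℤ) : ℂ) * h0 - c * hε)
  rw [spectrumDensity, ← hxdef, show x ^ 2 - c ^ 2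
    = (x - ((ε : ℤ) : ℂ) * c) * (x + ((ε : ℤ) : ℂ) * c) by linear_combination c ^ 2 * hε,
    ← mul_div_assoc, mul_one_div, div_mul_cancel_left₀ hne, one_div]

theorem propagatorFactor_units_mul (h c s : ℂ) (ε : ℤˣ) :
    propagatorFactor h (((ε : ℤ) : ℂ) * c) s = propagatorFactor h c s := by
  rcases Int.units_eq_one_or ε with hj | hj
  · simp [hj]
  · simp only [hj, propagatorFactor]
    push_cast
    rw [mul_comm, show h - -1 * c = h + c by ring, show h + -1 * c = h - c by ring]

theorem continuousAt_propagatorFactor {h c s : ℂ} (hs : propagatorFactor h c s ≠ 0) :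
    ContinuousAt (fun c => propagatorFactor h c s) c := by
  refine ContinuousAt.mul
    (ContinuousAt.comp' (continuousAt_Gamma_of_ne_zero (left_ne_zero_of_mul hs)) ?_)
    (ContinuousAt.comp' (continuousAt_Gamma_of_ne_zero (right_ne_zero_of_mul hs)) ?_) <;>
  fun_prop

/-- At c = Δ - h the pole comes from Γ((Δ - s) / 2) alone, since Δ - h is not an integer. With z =
(Δ - s) / 2 one has s - Δ - 2n = -2 (z + n). -/
theorem tendsto_mul_propagatorFactor {h Δ : ℂ} (hx : ∀ k : ℤ, Δ - h ≠ k) (n : ℕ) :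
    Tendsto (fun s => (s - Δ - 2 * n) * propagatorFactor h (Δ - h) s) (𝓝[≠] (Δ + 2 * n))
      (𝓝 (-2 * ((-1) ^ n / (n.factorial : ℂ)) * Complex.Gamma (-(Δ - h) - n))) := by
  have h1 : Tendsto (fun s : ℂ => (Δ - s) / 2) (𝓝[≠] (Δ + 2 * n)) (𝓝[≠] (-(n : ℂ))) := by
    refine tendsto_nhdsWithin_iff.mpr ⟨?_, ?_⟩
    · have : ContinuousAt (fun s : ℂ => (Δ - s) / 2) (Δ + 2 * n) := by fun_prop
      have := this.tendsto
      rw [show (Δ - (Δ + 2 * n)) / 2 = -(n : ℂ) by ring] at this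
      exact this.mono_left nhdsWithin_le_nhds
    · filter_upwards [self_mem_nhdsWithin] with s hs hs'
      refine hs ?_
      rw [Set.mem_singleton_iff] at hs' ⊢
      linear_combination -2 * hs'
  have hG : Complex.Gamma (-(Δ - h) - n) ≠ 0 := Gamma_ne_zero_of_forall_int fun k hk =>
    hx (-k - n) (by push_cast; linear_combination -hk)
  have h2 : ContinuousAt (fun s : ℂ => Complex.Gamma ((h - (Δ - h) - s) / 2)) (Δ + 2 * n) := by
    have e : (h - (Δ - h) - (Δ + 2 * n)) / 2 = -(Δ - h) - n := by ring
    refine ContinuousAt.comp' (g := Complex.Gamma) ?_ (by fun_prop)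
    rw [e]
    exact continuousAt_Gamma_of_ne_zero hG
  have h3 := h2.tendsto.mono_left (nhdsWithin_le_nhds (s := {Δ + 2 * (n : ℂ)}ᶜ))
  rw [show (h - (Δ - h) - (Δ + 2 * n)) / 2 = -(Δ - h) - n by ring] at h3
  refine ((((tendsto_add_mul_Gamma n).comp h1).const_mul (-2)).mul h3).congr fun s => ?_
  simp only [Function.comp_apply, propagatorFactor]
  rw [show h + (Δ - h) - s = Δ - s by ring]
  ring

theorem residue_eq_knownPropagator {h Δ : ℂ} (hx : ∀ k : ℤ, Δ - h ≠ k) (n : ℕ) :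
    1 / (2 * (Δ - h)) / (Complex.Gamma (Δ - h) * Complex.Gamma (-(Δ - h))) *
      (-2 * ((-1) ^ n / (n.factorial : ℂ)) * Complex.Gamma (-(Δ - h) - n))
      = knownPropagator h Δ n := by
  have h1 := Gamma_sub_natCast_mul_Gamma_add hx n
  rw [knownPropagator]
  set x := Δ - h
  have hx0 : x ≠ 0 := fun h0 => hx 0 (by simp [h0])
  have hG1 := Gamma_ne_zero_of_forall_int hx
  have hG2 : Complex.Gamma (-x) ≠ 0 := Gamma_ne_zero_of_forall_int fun k hk =>
    hx (-k) (by push_cast; linear_combination -hk)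
  have hG3 : Complex.Gamma (x + n + 1) ≠ 0 := Gamma_ne_zero_of_forall_int fun k hk =>
    hx (k - n - 1) (by push_cast; linear_combination hk)
  have hf : (n.factorial : ℂ) ≠ 0 := Nat.cast_ne_zero.mpr (Nat.factorial_ne_zero _)
  have hs : ((-1 : ℂ) ^ n) * (-1) ^ n = 1 := by rw [← mul_pow]; simp
  have h2 : Complex.Gamma (-x - n)
      = (-1) ^ n * (Complex.Gamma (-x) * (x * Complex.Gamma x)) / Complex.Gamma (x + n + 1) := by
    rw [← h1, mul_div_cancel_right₀ _ hG3]
  rw [h2]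
  field_simp
  linear_combination -hs

theorem tendsto_eval_nhdsWithin_ne {P : Type} (x : P → ℂ) (a : P) :
    Tendsto (fun c : P → ℂ => c a) (𝓝[{c | ∀ b, c b ≠ x b}] x) (𝓝[≠] (x a)) :=
  tendsto_nhdsWithin_iff.mpr ⟨((continuous_apply a).tendsto x).mono_left nhdsWithin_le_nhds,
    eventually_nhdsWithin_of_forall fun _ hc => hc a⟩

/-- The singular factors are products over propagators, so the multiple limits factorize, and W is
merely evaluated. W = 1 gives the propagator rule, the product of the vertices gives the tree. -/
theorem isPhysicalResidue_mul {P : Type} [Fintype P] {h : ℂ} {Δ : P → ℂ}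
    (hx : ∀ a, ∀ k : ℤ, Δ a - h ≠ k) (n : P → ℕ) (ε : P → ℤˣ) {W : (P → ℂ) → (P → ℂ) → ℂ}
    (hc : ∀ s, ContinuousAt (fun c => W c s) fun a => (((ε a : ℤˣ) : ℤ) : ℂ) * (Δ a - h))
    (hs : ContinuousAt (fun s => W (fun a => (((ε a : ℤˣ) : ℤ) : ℂ) * (Δ a - h)) s)
      fun a => Δ a + 2 * n a) :
    IsPhysicalResidue h Δ n ε
      (fun c s => (∏ a, spectrumDensity h (Δ a) (c a)) *
        ((∏ a, propagatorFactor h (c a) (s a)) * W c s))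
      ((∏ a, knownPropagator h (Δ a) (n a)) *
        W (fun a => (((ε a : ℤˣ) : ℤ) : ℂ) * (Δ a - h)) fun a => Δ a + 2 * n a) := by
  refine ⟨fun s => (∏ a, 1 / (2 * (Δ a - h)) /
    (Complex.Gamma (Δ a - h) * Complex.Gamma (-(Δ a - h)))) *
    ((∏ a, propagatorFactor h (Δ a - h) (s a)) *
      W (fun a => (((ε a : ℤˣ) : ℤ) : ℂ) * (Δ a - h)) s), ?_, ?_⟩
  · have hne : ∀ᶠ s in 𝓝[{s | ∀ a, s a ≠ Δ a + 2 * n a}] (fun a => Δ a + 2 * (n a : ℂ)),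
        ∀ a, propagatorFactor h (Δ a - h) (s a) ≠ 0 := by
      refine eventually_all.mpr fun a => ?_
      have hlim : -2 * ((-1) ^ n a / ((n a).factorial : ℂ)) * Complex.Gamma (-(Δ a - h) - n a)
          ≠ 0 := by
        refine mul_ne_zero (mul_ne_zero (by norm_num) (div_ne_zero (by simp)
          (Nat.cast_ne_zero.mpr (Nat.factorial_ne_zero _)))) ?_
        exact Gamma_ne_zero_of_forall_int fun k hk =>
          hx a (-k - n a) (by push_cast; linear_combination -hk)
      have := (tendsto_eval_nhdsWithin_ne (fun a => Δ a + 2 * (n a : ℂ)) a).eventually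
        ((tendsto_mul_propagatorFactor (hx a) (n a)).eventually_ne hlim)
      exact this.mono fun s hs => right_ne_zero_of_mul hs
    filter_upwards [hne] with s hne
    have t1 := tendsto_finsetProd Finset.univ fun a (_ : a ∈ Finset.univ) =>
      (tendsto_mul_spectrumDensity (hx a) (ε a)).comp
        (tendsto_eval_nhdsWithin_ne (fun a => (((ε a : ℤˣ) : ℤ) : ℂ) * (Δ a - h)) a)
    have t2 : Tendsto (fun c : P → ℂ => ∏ a, propagatorFactor h (c a) (s a))
        (𝓝[{c | ∀ a, c a ≠ (((ε a : ℤˣ) : ℤ) : ℂ) * (Δ a - h)}]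
          (fun a => (((ε a : ℤˣ) : ℤ) : ℂ) * (Δ a - h)))
        (𝓝 (∏ a, propagatorFactor h (Δ a - h) (s a))) := by
      refine tendsto_finsetProd _ fun a _ => ?_
      have hcont : ContinuousAt (fun c => propagatorFactor h c (s a))
          ((((ε a : ℤˣ) : ℤ) : ℂ) * (Δ a - h)) :=
        continuousAt_propagatorFactor (by rw [propagatorFactor_units_mul]; exact hne a)
      have := hcont.tendsto
      rw [propagatorFactor_units_mul] at this
      exact (this.mono_left nhdsWithin_le_nhds).comp
        (tendsto_eval_nhdsWithin_ne (fun a => (((ε a : ℤˣ) : ℤ) : ℂ) * (Δ a - h)) a)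
    refine (t1.mul (t2.mul ((hc s).tendsto.mono_left nhdsWithin_le_nhds))).congr fun c => ?_
    simp only [Function.comp_apply, Finset.prod_mul_distrib]
    ring
  · have t1 := tendsto_finsetProd Finset.univ fun a (_ : a ∈ Finset.univ) =>
      ((tendsto_mul_propagatorFactor (hx a) (n a)).const_mul (1 / (2 * (Δ a - h)) /
        (Complex.Gamma (Δ a - h) * Complex.Gamma (-(Δ a - h))))).comp
        (tendsto_eval_nhdsWithin_ne (fun a => Δ a + 2 * (n a : ℂ)) a)
    rw [Finset.prod_congr rfl fun a _ => residue_eq_knownPropagator (hx a) (n a)] at t1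
    refine (t1.mul (hs.tendsto.mono_left nhdsWithin_le_nhds)).congr fun s => ?_
    simp only [Function.comp_apply, Finset.prod_mul_distrib]
    ring

theorem isPhysicalResidue_propagator {h Δ : ℂ} (n : ℕ) (ε : ℤˣ) (hx : ∀ k : ℤ, Δ - h ≠ k) :
    IsPhysicalResidue (P := Unit) h (fun _ => Δ) (fun _ => n) (fun _ => ε)
      (fun c s => spectrumDensity h Δ (c ()) * propagatorFactor h (c ()) (s ()))
      (knownPropagator h Δ n) := by
  simpa using isPhysicalResidue_mul (P := Unit) (fun _ => hx) (fun _ => n) (fun _ => ε)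
    (W := fun _ _ => 1) (fun _ => continuousAt_const) continuousAt_const

end Residues

/-! ### Assembly of the tree residue. -/

section TreeResidue

variable {V E : Type} [Fintype V] [DecidableEq V] [Fintype E]

/-- A sign on an edge occurs at both ends of the edge. -/
theorem prod_prod_inc_neg_one_pow (G : SimpleGraph V) [DecidableRel G.Adj] (n : G.edgeSet → ℕ) :
    ∏ A : V, (-1 : ℂ) ^ (∑ e : Inc G A, n e) = 1 := by
  have h1 : ∀ A : V, (-1 : ℂ) ^ (∑ e : Inc G A, n e)
      = ∏ e : G.edgeSet, if A ∈ (e : Sym2 V) then (-1) ^ n e else 1 := fun A => by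
    rw [← Finset.prod_pow_eq_pow_sum, ← Finset.prod_filter]
    exact (Finset.prod_subtype _ (by simp) fun e : G.edgeSet => (-1 : ℂ) ^ n e).symm
  rw [Finset.prod_congr rfl fun A _ => h1 A, Finset.prod_comm]
  refine Finset.prod_eq_one fun e _ => ?_
  have h2 : (Finset.univ.filter fun A => A ∈ (e : Sym2 V)) = (e : Sym2 V).toFinset := by
    ext A; simp
  -- A simple graph has no loops, so exactly two vertices carry the sign of the edge e.
  rw [← Finset.prod_filter, Finset.prod_const, h2,
    Sym2.card_toFinset_of_not_isDiag _ (G.not_isDiag_of_mem_edgeSet e.2), ← pow_mul, mul_comm,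
    pow_mul]
  simp

theorem isPhysicalResidue_tree {h : ℂ} (G : SimpleGraph V) [DecidableRel G.Adj] (att : E → V)
    (δ : E → ℂ) (Δ : G.edgeSet → ℂ) (n : G.edgeSet → ℕ) (ε : G.edgeSet → ℤˣ)
    (hx : ∀ (e : G.edgeSet) (k : ℤ), Δ e - h ≠ k)
    (hreg : ∀ A : V, (∑ i : Ext att A, δ i, (fun e : Inc G A => Δ e - h),
      fun e : Inc G A => Δ e + 2 * n e) ∈ vertexRegular (Inc G A) h) :
    IsPhysicalResidue h Δ n ε (fun c s => amplitudeIntegrand G att h δ Δ c s)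
      ((∏ e, knownPropagator h (Δ e) (n e)) * ∏ A, knownVertexAt G att h δ Δ n A) := by
  let W : (G.edgeSet → ℂ) → (G.edgeSet → ℂ) → ℂ := fun c s =>
    ∏ A, vertexFactor h (∑ i : Ext att A, δ i, (fun e : Inc G A => c e), fun e : Inc G A => s e)
  have hmem : ∀ (A : V) (s : Inc G A → ℂ), (∑ i : Ext att A, δ i,
      (fun e : Inc G A => (((ε e : ℤˣ) : ℤ) : ℂ) * (Δ e - h)), s) ∈ vertexRegular (Inc G A) h :=
    fun A s => mem_vertexRegular_congr
      (flipSpectrum_mem (hreg A) fun e : Inc G A => ε e) s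
  have hval : W (fun e => (((ε e : ℤˣ) : ℤ) : ℂ) * (Δ e - h)) (fun e => Δ e + 2 * n e)
      = ∏ A, knownVertexAt G att h δ Δ n A := by
    have h1 : ∀ A, vertexFactor h (∑ i : Ext att A, δ i,
        (fun e : Inc G A => (((ε e : ℤˣ) : ℤ) : ℂ) * (Δ e - h)), fun e : Inc G A => Δ e + 2 * n e)
        = (-1) ^ (∑ e : Inc G A, n e) * knownVertexAt G att h δ Δ n A := fun A =>
      (vertexFactor_flip (hreg A) fun e : Inc G A => ε e).trans
        (vertexFactor_eq_knownVertex h (fun i : Ext att A => δ i) (fun e : Inc G A => Δ e)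
          -- A vanishing factor of the Pochhammer symbol would make Δ - h an integer.
          (fun e => n e) (hreg A) fun e k _ h0 => hx e (-(k + 1)) (by
            push_cast; linear_combination h0))
    simp only [W]
    rw [Finset.prod_congr rfl fun A _ => h1 A, Finset.prod_mul_distrib,
      prod_prod_inc_neg_one_pow, one_mul]
  rw [← hval]
  refine isPhysicalResidue_mul hx n ε (W := W) (fun s => ?_) ?_
  · refine tendsto_finsetProd _ fun A _ => ?_
    have hF := ((isVertexFactor_vertexFactor h).1 _
      (hmem A fun e : Inc G A => s e)).continuousAt
    exact ContinuousAt.comp' (f := fun c : G.edgeSet → ℂ =>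
      (∑ i : Ext att A, δ i, (fun e : Inc G A => c e), fun e : Inc G A => s e)) hF
        (continuous_const.prodMk ((continuous_pi fun e => continuous_apply _).prodMk
          continuous_const)).continuousAt
  · refine tendsto_finsetProd _ fun A _ => ?_
    have hF := ((isVertexFactor_vertexFactor h).1 _
      (hmem A fun e : Inc G A => Δ e + 2 * n e)).continuousAt
    exact ContinuousAt.comp' (f := fun s : G.edgeSet → ℂ =>
      (∑ i : Ext att A, δ i, (fun e : Inc G A => (((ε e : ℤˣ) : ℤ) : ℂ) * (Δ e - h)),
        fun e : Inc G A => s e)) hF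
        (continuous_const.prodMk (continuous_const.prodMk
          (continuous_pi fun e => continuous_apply _))).continuousAt

end TreeResidue

end WittenTree

end

theorem mainTheorem9 (h : ℂ) :
    -- the Mellin integral of the vertex rule is a well-defined function
    (∀ (ι : Type) [Fintype ι],
      WittenTree.IsVertexFactor h (WittenTree.vertexFactor (ι := ι) h) ∧
      ∀ F : ℂ × (ι → ℂ) × (ι → ℂ) → ℂ, WittenTree.IsVertexFactor h F →
        Set.EqOn F (WittenTree.vertexFactor h) (WittenTree.vertexRegular ι h)) ∧
    -- the vertex rule for a purely internal vertex
    (∀ (ι : Type) [Fintype ι] (Δ : ι → ℂ) (n : ι → ℕ),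
      (0, (fun a => Δ a - h), fun a => Δ a + 2 * n a) ∈ WittenTree.vertexRegular ι h →
      (∀ a, ∀ k < n a, Δ a - h + 1 + k ≠ 0) →
      WittenTree.vertexFactor h (0, (fun a => Δ a - h), fun a => Δ a + 2 * n a) =
        (-1) ^ (∑ a, n a) * WittenTree.knownVertex h Δ n) ∧
    -- the vertex rule for a vertex with boundary points
    (∀ (E ι : Type) [Fintype E] [Fintype ι] (δ : E → ℂ) (Δ : ι → ℂ) (n : ι → ℕ),
      (∑ i, δ i, (fun a => Δ a - h), fun a => Δ a + 2 * n a) ∈ WittenTree.vertexRegular ι h →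
      (∀ a, ∀ k < n a, Δ a - h + 1 + k ≠ 0) →
      WittenTree.vertexFactor h (∑ i, δ i, (fun a => Δ a - h), fun a => Δ a + 2 * n a) =
        (-1) ^ (∑ a, n a) *
          WittenTree.knownVertex h (Sum.elim δ Δ) (Sum.elim (fun _ => 0) n)) ∧
    -- the propagator rule
    (∀ (Δ : ℂ) (n : ℕ) (ε : ℤˣ), (∀ k : ℤ, Δ - h ≠ k) →
      WittenTree.IsPhysicalResidue (P := Unit) h (fun _ => Δ) (fun _ => n) (fun _ => ε)
        (fun c s => WittenTree.spectrumDensity h Δ (c ()) *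
          WittenTree.propagatorFactor h (c ()) (s ()))
        (WittenTree.knownPropagator h Δ n)) ∧
    -- the residue of a tree diagram
    (∀ (V E : Type) [Fintype V] [DecidableEq V] [Fintype E] (G : SimpleGraph V)
      [DecidableRel G.Adj] (att : E → V) (δ : E → ℂ) (Δ : G.edgeSet → ℂ) (n : G.edgeSet → ℕ)
      (ε : G.edgeSet → ℤˣ), G.IsTree →
      (∀ (e : G.edgeSet) (k : ℤ), Δ e - h ≠ k) →
      (∀ A : V, (∑ i : WittenTree.Ext att A, δ i, (fun e : WittenTree.Inc G A => Δ e - h),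
        fun e : WittenTree.Inc G A => Δ e + 2 * n e) ∈
          WittenTree.vertexRegular (WittenTree.Inc G A) h) →
      WittenTree.IsPhysicalResidue h Δ n ε
        (fun c s => WittenTree.amplitudeIntegrand G att h δ Δ c s)
        ((∏ e, WittenTree.knownPropagator h (Δ e) (n e)) *
          ∏ A, WittenTree.knownVertexAt G att h δ Δ n A)) := by
  exact ⟨fun ι _ => ⟨WittenTree.isVertexFactor_vertexFactor h, fun F hF =>
      hF.eqOn (WittenTree.isVertexFactor_vertexFactor h)⟩,
    fun ι _ Δ n hreg hc => WittenTree.vertexFactor_eq_knownVertex_internal h Δ n hreg hc,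
    fun E ι _ _ δ Δ n hreg hc => WittenTree.vertexFactor_eq_knownVertex h δ Δ n hreg hc,
    fun Δ n ε hx => WittenTree.isPhysicalResidue_propagator n ε hx,
    fun V E _ _ _ G _ att δ Δ n ε _ hx hreg =>
      WittenTree.isPhysicalResidue_tree G att δ Δ n ε hx hreg⟩
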